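/- **Theorem 4.1.** Let $p,\alpha,\beta>2$, $\lambda>0$, $\lambda_0,\lambda_1>0$ and $\tilde\lambda_0,\tilde\lambda_1\in\mathbb R$ with $|\tilde\lambda_0+\tilde\lambda_1|<2\sqrt{\lambda_0\lambda_1}$. For $\tilde h_0,\tilde h_1:\mathbb R_+\to\mathbb R$ consider the problem $$u_{tt}-u_{xx}+u+\lambda u_t=|u|^{p-2}u,\qquad 0<x<1,\ t>0,$$ $$u_x(0,t)=-|u(0,t)|^{\alpha-2}u(0,t)+\lambda_0u_t(0,t)+\tilde h_1(t)u(1,t)+\tilde\lambda_1u_t(1,t),$$ $$-u_x(1,t)=-|u(1,t)|^{\beta-2}u(1,t)+\lambda_1u_t(1,t)+\tilde h_0(t)u(0,t)+\tilde\lambda_0u_t(0,t),$$ $$u(x,0)=u_0(x),\qquad u_t(x,0)=u_1(x),$$ with $(u_0,u_1)\in H^1(0,1)\times L^2(0,1)$. A weak solution on $[0,T]$ is a function $u\in C([0,T];H^1)\cap C^1([0,T];L^2)$ with $u(0,\cdot),u(1,\cdot)\in H^1(0,T)$, $u(0)=u_0$, $u'(0)=u_1$, such that for every $v\in H^1(0,1)$,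 weakly on $(0,T)$, $$\tfrac{d}{dt}\langle u',v\rangle+\langle u_x,v_x\rangle+\langle u,v\rangle+\lambda\langle u',v\rangle+\big(\lambda_0u'(0,t)+\tilde h_1u(1,t)+\tilde\lambda_1u'(1,t)\big)v(0)+\big(\lambda_1u'(1,t)+\tilde h_0u(0,t)+\tilde\lambda_0u'(0,t)\big)v(1)$$ $$=\langle|u|^{p-2}u,v\rangle+|u(0,t)|^{\alpha-2}u(0,t)v(0)+|u(1,t)|^{\beta-2}u(1,t)v(1);$$ a global weak solution is one that is a weak solution on $[0,T]$ for every $T>0$. Here $\|\cdot\|$ is the norm of $L^2(0,1)$ and $\|v\|_1=(\|v\|^2+\|v_x\|^2)^{1/2}$. Put $$E(t)=\tfrac12\|u'(t)\|^2+\tfrac12\|u(t)\|_1^2-\tfrac1p\|u(t)\|_{L^p}^p-\tfrac1\alpha|u(0,t)|^\alpha-\tfrac1\beta|u(1,t)|^\beta,$$ so that $E(0)$ is the same expression in $(u_0,u_1)$, and $$I(0)=\|u_0\|_1^2-\|u_0\|_{L^p}^p-|u_0(0)|^\alpha-|u_0(1)|^\beta,\quad q=\min\{p,\alpha,\beta\},$$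 $$\mu_*=\tfrac14\big[4\lambda_0\lambda_1-(\tilde\lambda_0+\tilde\lambda_1)^2\big]\min\{\tfrac1{\lambda_0},\tfrac1{\lambda_1}\},\quad r=\exp\Big[\tfrac{4q}{\mu_*(q-2)}\big(\|\tilde h_0\|_{L^2(\mathbb R_+)}^2+\|\tilde h_1\|_{L^2(\mathbb R_+)}^2\big)\Big],$$ $$\eta^*=C_p^p\Big(\tfrac{2qr}{q-2}E(0)\Big)^{(p-2)/2}+2^{\alpha/2}\Big(\tfrac{2qr}{q-2}E(0)\Big)^{(\alpha-2)/2}+2^{\beta/2}\Big(\tfrac{2qr}{q-2}E(0)\Big)^{(\beta-2)/2},$$ where $C_p$ is a constant with $\|v\|_{L^p}\le C_p\|v\|_1$ for all $v\in H^1(0,1)$. Suppose $I(0)>0$. Then there are constants $\varepsilon,C,\gamma>0$ (depending on the constants above and on $u_0,u_1$) such that the following holds for all $\tilde h_0,\tilde h_1\in L^\infty(\mathbb R_+)\cap L^2(\mathbb R_+)$ with $\eta^*<1$. The problem has a global weak solution $u$, and every weak solution on an interval $[0,T]$, $T>0$, is the restriction of $u$ to $[0,T]$. If moreover $\|\tilde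 h_0\|_{L^2(\mathbb R_+)}<\varepsilon$ and $\|\tilde h_1\|_{L^2(\mathbb R_+)}<\varepsilon$, then $$E(t)\le C e^{-\gamma t}\qquad\text{for all }t\ge0.$$ -/

import Mathlib

open MeasureTheory Set
open scoped ContDiff ENNReal

noncomputable section

namespace TwoPointWave

/-! ### Weak derivatives on an interval and the spaces `L²(0,1)` and `H¹(0,1)` -/

/-- `g` is the weak derivative of `f` on the bounded open interval `(a, b)`:
both are integrable there, and `∫ f φ' = - ∫ g φ` for every test function `φ ∈ C_c^∞(a, b)`. -/
def HasWeakDerivOn (f g : ℝ → ℝ) (a b : ℝ) : Prop :=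
  IntegrableOn f (Ioo a b) ∧ IntegrableOn g (Ioo a b) ∧
    ∀ φ : ℝ → ℝ, ContDiff ℝ ∞ φ → HasCompactSupport φ → tsupport φ ⊆ Ioo a b →
      ∫ x in Ioo a b, f x * deriv φ x = - ∫ x in Ioo a b, g x * φ x

/-- The integrable product of an integrable function and a continuous compactly supported one. -/
theorem integrableOn_mul_test {f φ : ℝ → ℝ} {s : Set ℝ} (hf : IntegrableOn f s)
    (hφ : Continuous φ) (hc : HasCompactSupport φ) : IntegrableOn (fun x => f x * φ x) s := by
  obtain ⟨C, hC⟩ := hc.exists_bound_of_continuous hφ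
  exact hf.mul_bdd (c := C) hφ.aestronglyMeasurable (Filter.Eventually.of_forall hC)

theorem HasWeakDerivOn.congr {f g f' g' : ℝ → ℝ} {a b : ℝ} (h : HasWeakDerivOn f g a b)
    (hf : f' =ᵐ[volume.restrict (Ioo a b)] f) (hg : g' =ᵐ[volume.restrict (Ioo a b)] g) :
    HasWeakDerivOn f' g' a b := by
  refine ⟨h.1.congr hf.symm, h.2.1.congr hg.symm, fun φ h1 h2 h3 => ?_⟩
  have e1 : ∫ x in Ioo a b, f' x * deriv φ x = ∫ x in Ioo a b, f x * deriv φ x :=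
    integral_congr_ae (hf.mono fun x hx => by simp only [hx])
  have e2 : ∫ x in Ioo a b, g' x * φ x = ∫ x in Ioo a b, g x * φ x :=
    integral_congr_ae (hg.mono fun x hx => by simp only [hx])
  rw [e1, e2, h.2.2 φ h1 h2 h3]

theorem HasWeakDerivOn.add {f g f' g' : ℝ → ℝ} {a b : ℝ} (h : HasWeakDerivOn f g a b)
    (h' : HasWeakDerivOn f' g' a b) :
    HasWeakDerivOn (fun x => f x + f' x) (fun x => g x + g' x) a b := by
  refine ⟨h.1.add h'.1, h.2.1.add h'.2.1, fun φ h1 h2 h3 => ?_⟩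
  have cd : Continuous (deriv φ) := h1.continuous_deriv (by simp)
  simp only [add_mul]
  rw [integral_add (integrableOn_mul_test h.1 cd h2.deriv) (integrableOn_mul_test h'.1 cd h2.deriv),
    integral_add (integrableOn_mul_test h.2.1 h1.continuous h2)
      (integrableOn_mul_test h'.2.1 h1.continuous h2),
    h.2.2 φ h1 h2 h3, h'.2.2 φ h1 h2 h3]
  ring

theorem HasWeakDerivOn.const_mul {f g : ℝ → ℝ} {a b : ℝ} (c : ℝ) (h : HasWeakDerivOn f g a b) :
    HasWeakDerivOn (fun x => c * f x) (fun x => c * g x) a b := by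
  refine ⟨h.1.const_mul c, h.2.1.const_mul c, fun φ h1 h2 h3 => ?_⟩
  simp only [mul_assoc]
  rw [integral_const_mul, integral_const_mul, h.2.2 φ h1 h2 h3]
  ring

/-- A primitive of an integrable function has that function as weak derivative. -/
theorem hasWeakDerivOn_primitive {g : ℝ → ℝ} {a b : ℝ} (hab : a < b)
    (hg : IntegrableOn g (Ioo a b)) : HasWeakDerivOn (fun x => ∫ t in a..x, g t) g a b := by
  have hgi : IntervalIntegrable g volume a b :=
    (intervalIntegrable_iff_integrableOn_Ioo_of_le hab.le).2 hg
  have hac : AbsolutelyContinuousOnInterval (fun x => ∫ t in a..x, g t) a b :=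
    hgi.absolutelyContinuousOnInterval_intervalIntegral (by simp)
  refine ⟨?_, hg, fun φ h1 h2 h3 => ?_⟩
  · exact ((hac.continuousOn.integrableOn_compact isCompact_uIcc).mono_set
      (by rw [uIcc_of_le hab.le]; exact Ioo_subset_Icc_self))
  · have hφ : AbsolutelyContinuousOnInterval φ a b :=
      (h1.of_le (by simp)).contDiffOn.absolutelyContinuousOnInterval
    have hb : φ b = 0 := image_eq_zero_of_notMem_tsupport fun h => (h3 h).2.ne rfl
    have ha : φ a = 0 := image_eq_zero_of_notMem_tsupport fun h => (h3 h).1.ne rfl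
    have := hac.integral_mul_deriv_eq_deriv_mul hφ
    rw [hb, ha] at this
    simp only [mul_zero, sub_self, zero_sub] at this
    rw [← integral_Ioc_eq_integral_Ioo, ← integral_Ioc_eq_integral_Ioo,
      ← intervalIntegral.integral_of_le hab.le, ← intervalIntegral.integral_of_le hab.le, this]
    congr 1
    refine intervalIntegral.integral_congr_ae ?_
    filter_upwards [hgi.ae_hasDerivAt_integral] with x hx hxm
    rw [(hx (uIoc_subset_uIcc hxm) a (by simp)).deriv]

/-- A function with vanishing weak derivative is almost everywhere constant. -/
theorem HasWeakDerivOn.ae_const {f : ℝ → ℝ} {a b : ℝ} (hab : a < b)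
    (h : HasWeakDerivOn f (fun _ => 0) a b) :
    ∃ c : ℝ, ∀ᵐ x ∂(volume.restrict (Ioo a b)), f x = c := by
  let ρ : ContDiffBump ((a + b) / 2) :=
    ⟨(b - a) / 8, (b - a) / 4, by linarith, by linarith⟩
  set r : ℝ → ℝ := ρ.normed volume with hr
  have r1 : ContDiff ℝ ∞ r := ρ.contDiff_normed
  have r2 : HasCompactSupport r := ρ.hasCompactSupport_normed
  have r3 : tsupport r = Icc ((a + b) / 2 - (b - a) / 4) ((a + b) / 2 + (b - a) / 4) := by
    rw [hr, ρ.tsupport_normed_eq, Real.closedBall_eq_Icc]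
  have r4 : ∫ x, r x = 1 := ρ.integral_normed
  refine ⟨∫ x in Ioo a b, f x * r x, ?_⟩
  set k := ∫ x in Ioo a b, f x * r x with hk
  have main : ∀ᵐ x, x ∈ Ioo a b → f x - k = 0 := by
    refine isOpen_Ioo.ae_eq_zero_of_integral_contDiff_smul_eq_zero
      ((h.1.sub (integrableOn_const (by simp))).locallyIntegrableOn) ?_
    intro φ p1 p2 p3
    set m := ∫ x, φ x with hm
    set θ : ℝ → ℝ := fun x => φ x - m * r x with hθ
    have t1 : ContDiff ℝ ∞ θ := p1.sub (contDiff_const.mul r1)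
    have tc : Continuous θ := t1.continuous
    obtain ⟨c, d, hac, hdb, hcd, hz⟩ : ∃ c d, a < c ∧ d < b ∧ c ≤ d ∧ ∀ x, x ∉ Icc c d → θ x = 0 := by
      have hK : IsCompact (tsupport φ ∪ tsupport r) := p2.union r2
      have hne : (tsupport φ ∪ tsupport r).Nonempty :=
        ⟨(a + b) / 2, Or.inr (by rw [r3]; constructor <;> linarith)⟩
      have hsub : tsupport φ ∪ tsupport r ⊆ Ioo a b := by
        refine union_subset p3 ?_
        rw [r3]
        intro x hx
        exact ⟨by linarith [hx.1], by linarith [hx.2]⟩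
      refine ⟨_, _, (hsub (hK.sInf_mem hne)).1, (hsub (hK.sSup_mem hne)).2,
        csInf_le hK.bddBelow (hK.sSup_mem hne), fun x hx => ?_⟩
      have hx' : x ∉ tsupport φ ∪ tsupport r := fun hx'' =>
        hx ⟨csInf_le hK.bddBelow hx'', le_csSup hK.bddAbove hx''⟩
      rw [mem_union, not_or] at hx'
      simp [hθ, image_eq_zero_of_notMem_tsupport hx'.1, image_eq_zero_of_notMem_tsupport hx'.2]
    have ti : ∫ x, θ x = 0 := by
      simp only [hθ]
      rw [integral_sub (p1.continuous.integrable_of_hasCompactSupport p2)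
        ((r1.continuous.integrable_of_hasCompactSupport r2).const_mul m), integral_const_mul, r4]
      simp [hm]
    set ψ : ℝ → ℝ := fun x => ∫ t in a..x, θ t with hψ
    have dψ : deriv ψ = θ := by
      funext x
      exact (tc.deriv_integral θ a x)
    have s1 : ContDiff ℝ ∞ ψ := by
      refine contDiff_infty_iff_deriv.2 ⟨fun x => ?_, by rw [dψ]; exact t1⟩
      exact (intervalIntegral.integral_hasDerivAt_right (tc.intervalIntegrable _ _)
        (tc.stronglyMeasurableAtFilter _ _) tc.continuousAt).differentiableAt
    have s0 : Function.support ψ ⊆ Icc c d := by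
      intro x hx
      by_contra hxn
      refine hx ?_
      rw [mem_Icc, not_and_or, not_le, not_le] at hxn
      rcases hxn with hxc | hxd
      · refine intervalIntegral.integral_zero_ae (Filter.Eventually.of_forall fun t ht => hz t ?_)
        intro htc
        have : t ≤ max a x := ht.2
        have := htc.1
        have : max a x < c := max_lt hac hxc
        linarith
      · change ∫ t in a..x, θ t = 0
        rw [intervalIntegral.integral_of_le (by linarith),
          setIntegral_eq_integral_of_forall_compl_eq_zero, ti]
        intro t ht
        refine hz t fun htc => ht ⟨by linarith [htc.1], by linarith [htc.2]⟩
    have s2 : HasCompactSupport ψ :=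
      HasCompactSupport.of_support_subset_isCompact isCompact_Icc s0
    have s3 : tsupport ψ ⊆ Ioo a b :=
      (closure_minimal s0 isClosed_Icc).trans fun x hx =>
        ⟨by linarith [hx.1], by linarith [hx.2]⟩
    have key := h.2.2 ψ s1 s2 s3
    rw [dψ] at key
    simp only [zero_mul, integral_zero, neg_zero] at key
    have e1 : ∫ x in Ioo a b, f x * θ x = (∫ x in Ioo a b, f x * φ x) - m * k := by
      rw [hk, ← integral_const_mul, ← integral_sub (integrableOn_mul_test h.1 p1.continuous p2)
        ((integrableOn_mul_test h.1 r1.continuous r2).const_mul m)]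
      refine integral_congr_ae (Filter.Eventually.of_forall fun x => ?_)
      simp only [hθ]
      ring
    have e2 : ∫ x, φ x • (f x - k) = ∫ x in Ioo a b, φ x • (f x - k) := by
      rw [setIntegral_eq_integral_of_forall_compl_eq_zero]
      intro x hx
      rw [image_eq_zero_of_notMem_tsupport fun hx' => hx (p3 hx'), zero_smul]
    have e3 : m = ∫ x in Ioo a b, φ x := by
      rw [setIntegral_eq_integral_of_forall_compl_eq_zero]
      intro x hx
      exact image_eq_zero_of_notMem_tsupport fun hx' => hx (p3 hx')
    have e4 : ∫ x in Ioo a b, φ x • (f x - k) = (∫ x in Ioo a b, f x * φ x) - k * m := by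
      rw [e3, ← integral_const_mul, ← integral_sub (integrableOn_mul_test h.1 p1.continuous p2)
        ((p1.continuous.integrable_of_hasCompactSupport p2).integrableOn.const_mul k)]
      refine integral_congr_ae (Filter.Eventually.of_forall fun x => ?_)
      simp only [smul_eq_mul]
      ring
    rw [e2, e4]
    linarith
  rw [ae_restrict_iff' measurableSet_Ioo]
  filter_upwards [main] with x hx hxm
  linarith [hx hxm]

/-- A function with a weak derivative on `(a, b)` has a continuous representative on `[a, b]`. -/
theorem HasWeakDerivOn.exists_rep {f g : ℝ → ℝ} {a b : ℝ} (hab : a < b)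
    (h : HasWeakDerivOn f g a b) :
    ∃ F : ℝ → ℝ, ContinuousOn F (Icc a b) ∧ F =ᵐ[volume.restrict (Ioo a b)] f := by
  have hp := hasWeakDerivOn_primitive hab h.2.1
  have hd := h.add (hp.const_mul (-1))
  obtain ⟨c, hc⟩ := (hd.congr (Filter.EventuallyEq.refl _ _)
    (Filter.Eventually.of_forall fun x => by simp :
      (fun _ => (0 : ℝ)) =ᵐ[volume.restrict (Ioo a b)] fun x => g x + -1 * g x)).ae_const hab
  refine ⟨fun x => c + ∫ t in a..x, g t, ?_, ?_⟩
  · have hac : AbsolutelyContinuousOnInterval (fun x => ∫ t in a..x, g t) a b :=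
      ((intervalIntegrable_iff_integrableOn_Ioo_of_le hab.le).2
        h.2.1).absolutelyContinuousOnInterval_intervalIntegral (by simp)
    have := hac.continuousOn
    rw [uIcc_of_le hab.le] at this
    exact continuousOn_const.add this
  · filter_upwards [hc] with x hx
    linarith

/-- Lebesgue measure on `Ω = (0, 1)`. -/
abbrev volI : Measure ℝ := volume.restrict (Ioo (0 : ℝ) 1)

/-- The Hilbert space `L²(0, 1)`. -/
abbrev L2I : Type := Lp ℝ 2 volI

theorem L2I.integrableOn (v : L2I) : IntegrableOn (v : ℝ → ℝ) (Ioo 0 1) :=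
  (Lp.memLp v).integrable (by norm_num)

/-- The pairs `(v, w) ∈ L² × L²` such that `w` is the weak derivative of `v` on `(0, 1)`. -/
def H1Submodule : Submodule ℝ (WithLp 2 (L2I × L2I)) where
  carrier := {z | HasWeakDerivOn (z.fst : ℝ → ℝ) (z.snd : ℝ → ℝ) 0 1}
  add_mem' {z w} hz hw := (HasWeakDerivOn.add hz hw).congr
    (Lp.coeFn_add z.fst w.fst) (Lp.coeFn_add z.snd w.snd)
  zero_mem' := by
    have h0 : HasWeakDerivOn (fun _ => (0 : ℝ)) (fun _ => (0 : ℝ)) 0 1 :=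
      ⟨integrableOn_zero, integrableOn_zero, fun φ _ _ _ => by simp⟩
    exact h0.congr (Lp.coeFn_zero ℝ 2 volI) (Lp.coeFn_zero ℝ 2 volI)
  smul_mem' c z hz := (HasWeakDerivOn.const_mul c hz).congr
    (Lp.coeFn_smul c z.fst) (Lp.coeFn_smul c z.snd)

/-- The Sobolev space `H¹(0, 1)`, realized as the pairs `(v, v_x)` of an `L²` function and its weak
derivative. The inherited norm is `‖v‖₁ = (‖v‖² + ‖v_x‖²)^{1/2}`. -/
abbrev H1 : Type := H1Submodule

/-- The underlying `L²` function of `v ∈ H¹(0, 1)`. -/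
def H1.toL2 (v : H1) : L2I := v.1.fst

/-- The weak derivative `v_x ∈ L²` of `v ∈ H¹(0, 1)`. -/
def H1.dx (v : H1) : L2I := v.1.snd

theorem H1.norm_sq (v : H1) : ‖v‖ ^ 2 = ‖v.toL2‖ ^ 2 + ‖v.dx‖ ^ 2 :=
  WithLp.prod_norm_sq_eq_of_L2 v.1

theorem H1.exists_rep (v : H1) :
    ∃ F : ℝ → ℝ, ContinuousOn F (Icc 0 1) ∧ F =ᵐ[volI] (v.toL2 : ℝ → ℝ) :=
  HasWeakDerivOn.exists_rep zero_lt_one v.2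

/-- The representative of `v ∈ H¹(0, 1)` that is continuous on `[0, 1]`. Its values on `[0, 1]` are
determined by `v`; in particular `v.rep 0` and `v.rep 1` are the boundary values of `v`. -/
def H1.rep (v : H1) : ℝ → ℝ := Classical.choose v.exists_rep

theorem H1.continuousOn_rep (v : H1) : ContinuousOn v.rep (Icc 0 1) :=
  (Classical.choose_spec v.exists_rep).1

theorem H1.rep_ae_eq (v : H1) : v.rep =ᵐ[volI] (v.toL2 : ℝ → ℝ) :=
  (Classical.choose_spec v.exists_rep).2

/-! ### The problem -/

/-- The constants of the problem:
`u_tt - u_xx + u + lam u_t = |u|^{p-2} u` on `(0, 1)`, with boundary conditions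
`u_x(0,t) = -|u(0,t)|^{α-2} u(0,t) + lam0 u_t(0,t) + h1(t) u(1,t) + lamt1 u_t(1,t)` and
`-u_x(1,t) = -|u(1,t)|^{β-2} u(1,t) + lam1 u_t(1,t) + h0(t) u(0,t) + lamt0 u_t(0,t)`. -/
structure Params where
  p : ℝ
  α : ℝ
  β : ℝ
  lam : ℝ
  lam0 : ℝ
  lam1 : ℝ
  lamt0 : ℝ
  lamt1 : ℝ

/-- `p, α, β > 2` and `λ > 0`. -/
def Params.A1 (P : Params) : Prop := 2 < P.p ∧ 2 < P.α ∧ 2 < P.β ∧ 0 < P.lam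

/-- `λ₀, λ₁ > 0` and `|λ̃₀ + λ̃₁| < 2 √(λ₀ λ₁)`. -/
def Params.A2 (P : Params) : Prop :=
  0 < P.lam0 ∧ 0 < P.lam1 ∧ |P.lamt0 + P.lamt1| < 2 * Real.sqrt (P.lam0 * P.lam1)

/-- `h ∈ L^∞(ℝ₊) ∩ L²(ℝ₊)`. -/
def BoundedL2 (h : ℝ → ℝ) : Prop :=
  MemLp h ∞ (volume.restrict (Ioi 0)) ∧ MemLp h 2 (volume.restrict (Ioi 0))

/-- The norm of `h` in `L²(ℝ₊)`. -/
def normL2 (h : ℝ → ℝ) : ℝ := (eLpNorm h 2 (volume.restrict (Ioi 0))).toReal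

/-- The power nonlinearity `|y|^{s-2} y`. -/
def powNL (s y : ℝ) : ℝ := |y| ^ (s - 2) * y

/-- `(u, ut)` is a weak solution on `[0, T]` of the problem with coefficients `h0, h1` and initial
data `(u0, u1)`: `u ∈ C([0,T]; H¹) ∩ C¹([0,T]; L²)` with time derivative `ut`, the traces
`u(0,·), u(1,·)` belong to `H¹(0,T)` (with derivatives `b0, b1`), and for every `v ∈ H¹`
`d/dt ⟨u', v⟩ + ⟨u_x, v_x⟩ + ⟨u, v⟩ + λ ⟨u', v⟩
  + (λ₀ u'(0,t) + h1 u(1,t) + λ̃₁ u'(1,t)) v(0) + (λ₁ u'(1,t) + h0 u(0,t) + λ̃₀ u'(0,t)) v(1)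
  = ⟨|u|^{p-2} u, v⟩ + |u(0,t)|^{α-2} u(0,t) v(0) + |u(1,t)|^{β-2} u(1,t) v(1)`
in the weak sense on `(0, T)`. -/
structure IsWeakSolutionOn (P : Params) (h0 h1 : ℝ → ℝ) (u0 : H1) (u1 : L2I) (T : ℝ)
    (u : ℝ → H1) (ut : ℝ → L2I) : Prop where
  continuousOn_u : ContinuousOn u (Icc 0 T)
  continuousOn_ut : ContinuousOn ut (Icc 0 T)
  hasDeriv : ∀ t ∈ Icc 0 T, HasDerivWithinAt (fun s => (u s).toL2) (ut t) (Icc 0 T) t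
  init_u : u 0 = u0
  init_ut : ut 0 = u1
  weak : ∃ b0 b1 : ℝ → ℝ,
    MemLp b0 2 (volume.restrict (Ioo 0 T)) ∧ MemLp b1 2 (volume.restrict (Ioo 0 T)) ∧
    HasWeakDerivOn (fun t => (u t).rep 0) b0 0 T ∧
    HasWeakDerivOn (fun t => (u t).rep 1) b1 0 T ∧
    ∀ v : H1, HasWeakDerivOn (fun t => inner ℝ (ut t) v.toL2)
      (fun t =>
        (∫ x in (0 : ℝ)..1, powNL P.p ((u t).rep x) * v.rep x)
          + powNL P.α ((u t).rep 0) * v.rep 0 + powNL P.β ((u t).rep 1) * v.rep 1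
          - inner ℝ (u t).dx v.dx - inner ℝ (u t).toL2 v.toL2 - P.lam * inner ℝ (ut t) v.toL2
          - (P.lam0 * b0 t + h1 t * (u t).rep 1 + P.lamt1 * b1 t) * v.rep 0
          - (P.lam1 * b1 t + h0 t * (u t).rep 0 + P.lamt0 * b0 t) * v.rep 1)
      0 T

/-- A global weak solution: a weak solution on `[0, T]` for every `T > 0`. -/
def IsGlobalWeakSolution (P : Params) (h0 h1 : ℝ → ℝ) (u0 : H1) (u1 : L2I)
    (u : ℝ → H1) (ut : ℝ → L2I) : Prop :=
  ∀ T : ℝ, 0 < T → IsWeakSolutionOn P h0 h1 u0 u1 T u ut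

/-! ### Energy and constants -/

/-- `‖v‖_{L^s}^s` for `v ∈ H¹(0, 1)`. -/
def H1.lpPow (s : ℝ) (v : H1) : ℝ := ∫ x in (0 : ℝ)..1, |v.rep x| ^ s

/-- `E = ½‖u'‖² + ½‖u‖₁² - (1/p)‖u‖_{L^p}^p - (1/α)|u(0)|^α - (1/β)|u(1)|^β`. -/
def energy (P : Params) (u : H1) (ut : L2I) : ℝ :=
  1 / 2 * ‖ut‖ ^ 2 + 1 / 2 * ‖u‖ ^ 2 - 1 / P.p * u.lpPow P.p
    - 1 / P.α * |u.rep 0| ^ P.α - 1 / P.β * |u.rep 1| ^ P.β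

/-- `I(u) = ‖u‖₁² - ‖u‖_{L^p}^p - |u(0)|^α - |u(1)|^β`. -/
def functionalI (P : Params) (u : H1) : ℝ :=
  ‖u‖ ^ 2 - u.lpPow P.p - |u.rep 0| ^ P.α - |u.rep 1| ^ P.β

/-- `Cp` satisfies `‖v‖_{L^p} ≤ Cp ‖v‖₁` for all `v ∈ H¹(0, 1)`. -/
def IsEmbeddingConst (P : Params) (Cp : ℝ) : Prop :=
  ∀ v : H1, v.lpPow P.p ^ (1 / P.p) ≤ Cp * ‖v‖

/-- `μ_* = ¼ (4 λ₀ λ₁ - (λ̃₀ + λ̃₁)²) min (1/λ₀) (1/λ₁)`. -/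
def Params.muStar (P : Params) : ℝ :=
  1 / 4 * (-(P.lamt0 + P.lamt1) ^ 2 + 4 * P.lam0 * P.lam1) * min (1 / P.lam0) (1 / P.lam1)

/-- `q = min {p, α, β}`. -/
def Params.q (P : Params) : ℝ := min P.p (min P.α P.β)

/-- `r = exp [4q / (μ_* (q - 2)) (‖h0‖²_{L²(ℝ₊)} + ‖h1‖²_{L²(ℝ₊)})]`. -/
def Params.r (P : Params) (h0 h1 : ℝ → ℝ) : ℝ :=
  Real.exp (4 * P.q / (P.muStar * (P.q - 2)) * (normL2 h0 ^ 2 + normL2 h1 ^ 2))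

/-- `η^* = Cp^p R^{(p-2)/2} + 2^{α/2} R^{(α-2)/2} + 2^{β/2} R^{(β-2)/2}`, where
`R = 2 q r E(0) / (q - 2)`. -/
def etaStar (P : Params) (Cp : ℝ) (h0 h1 : ℝ → ℝ) (E0 : ℝ) : ℝ :=
  Cp ^ P.p * (2 * P.q * P.r h0 h1 / (P.q - 2) * E0) ^ ((P.p - 2) / 2)
    + 2 ^ (P.α / 2) * (2 * P.q * P.r h0 h1 / (P.q - 2) * E0) ^ ((P.α - 2) / 2)
    + 2 ^ (P.β / 2) * (2 * P.q * P.r h0 h1 / (P.q - 2) * E0) ^ ((P.β - 2) / 2)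

end TwoPointWave

end

noncomputable section

set_option linter.unusedSectionVars false

namespace TwoPointWave

open Filter Topology intervalIntegral

/-! ### Steklov averages and limits of inner products in `L²` -/

section

section SteklovAverages

/-! Collect the interior velocity and the two boundary velocities in the Hilbert space `Vel` = L² ×
ℝ². With κ = `traceL` (a function together with its boundary values), π = `interior` and D =
`dampL`, the problem becomes the abstract wave equation u'' + u = κ†(f − D y), y = (κ u)', where f
gathers the nonlinear and nonlocal terms; `IsEvol` is its weak form. The condition on λ̃₀ + λ̃₁
makes the boundary quadratic form positive definite, so D is coercive (`dissip_mul_le`) and the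
energy controls y in L²(0,T; Vel). This gives the traces their H¹ regularity in time and allows
sources with boundary components.

Weak solutions are not regular enough to be tested with their own time derivative. Steklov averages
in time are, and passing to the limit yields the energy identity and the identity for ⟨u', u⟩
(`IsEvol.energy_identity`, `IsEvol.pairing_identity`). The linear problem is solved by Yosida
approximation for data in the domain of the generator, by density for general data, and by step
functions in time for L² sources (`solvable_of_memLp`). Picard iteration handles Lipschitz sources,
and the same estimate gives uniqueness. Truncating the powers at height K makes the source
Lipschitz; a bounded weak solution solves the truncated problem for large K, which transfers
uniqueness (`IsWeakSolutionOn.unique`).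

Global existence is a potential well argument. While ‖u‖² ≤ R = 2qrE(0)/(q−2), the nonlinear terms
are at most η*‖u‖² with η* < 1, so E dominates (q−2)/(2q)·‖u‖². The nonlocal boundary terms are
absorbed by the damping up to (2/μ_*)(h₀² + h₁²)‖u‖², and Grönwall's inequality gives E(t) ≤ rE(0),
hence ‖u(t)‖² < R strictly. By continuity the ball is never left, and a truncation height adapted to
R is never active (`exists_isEvol_bounded`).

For decay, E + ε⟨u', u⟩ is equivalent to the energy norm and satisfies L' ≤ (−γ + b(h₀² + h₁²))L.
The second term is integrable in time and only costs a factor (`exists_decay`). Constants uniform in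
h₀, h₁ require η* to stay below some η < 1; `exists_uniform_smallness` supplies this for small h₀,
h₁, because η* depends on them only through ‖h₀‖² + ‖h₁‖², continuously and monotonically. -/

theorem lintegral_sq_le {α : Type*} [MeasurableSpace α] {μ : Measure α} {f : α → ℝ≥0∞}
    (hf : AEMeasurable f μ) : (∫⁻ x, f x ∂μ) ^ 2 ≤ μ univ * ∫⁻ x, f x ^ 2 ∂μ := by
  have h := ENNReal.lintegral_mul_le_Lp_mul_Lq μ (p := 2) (q := 2) (by constructor <;> norm_num)
    hf (aemeasurable_const (b := (1 : ℝ≥0∞)))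
  simp only [Pi.mul_apply, mul_one, ENNReal.one_rpow, lintegral_one] at h
  calc (∫⁻ x, f x ∂μ) ^ 2 ≤ ((∫⁻ x, f x ^ (2 : ℝ) ∂μ) ^ (1 / (2 : ℝ)) *
        (μ univ) ^ (1 / (2 : ℝ))) ^ 2 := by gcongr
    _ = μ univ * ∫⁻ x, f x ^ 2 ∂μ := by
      rw [mul_pow, ← ENNReal.rpow_natCast, ← ENNReal.rpow_natCast, ← ENNReal.rpow_mul,
        ← ENNReal.rpow_mul]
      norm_num
      rw [mul_comm]

variable {Y : Type*} [NormedAddCommGroup Y]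

theorem eLpNorm_two_sq {α : Type*} [MeasurableSpace α] (μ : Measure α) (f : α → Y) :
    eLpNorm f 2 μ ^ 2 = ∫⁻ x, ‖f x‖ₑ ^ 2 ∂μ := by
  rw [eLpNorm_eq_lintegral_rpow_enorm_toReal (by norm_num) (by norm_num), ← ENNReal.rpow_natCast,
    ← ENNReal.rpow_mul]
  norm_num

/-- Translation is a continuous family of measure preserving maps, and composition with such a
family is continuous in L². -/
theorem tendsto_eLpNorm_translate {g : ℝ → Y} (hg : MemLp g 2 volume) :
    Tendsto (fun σ : ℝ => eLpNorm (fun s => g (s + σ) - g s) 2 volume) (𝓝 0) (𝓝 0) := by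
  let T : C(ℝ, C(ℝ, ℝ)) := (ContinuousMap.mk (fun a : ℝ × ℝ => a.2 + a.1)
    (by fun_prop)).curry
  have hT : ∀ σ, MeasurePreserving (T σ) volume volume := fun σ =>
    measurePreserving_add_right volume σ
  have hc : Continuous (fun σ : ℝ => Lp.compMeasurePreserving (T σ) (hT σ) (hg.toLp g)) :=
    continuous_const.compMeasurePreservingLp T.continuous hT (by simp)
  have h0 := (Lp.tendsto_Lp_iff_tendsto_eLpNorm' _ _).1 (hc.tendsto 0)
  refine h0.congr fun σ => ?_
  refine eLpNorm_congr_ae ?_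
  have e : ∀ σ, (Lp.compMeasurePreserving (T σ) (hT σ) (hg.toLp g) : ℝ → Y)
      =ᵐ[volume] fun s => g (s + σ) := fun σ =>
    (Lp.coeFn_compMeasurePreserving _ (hT σ)).trans
      ((hT σ).quasiMeasurePreserving.ae_eq_comp hg.coeFn_toLp)
  filter_upwards [e σ, e 0] with s h1 h2
  simp only [Pi.sub_apply, h1, h2, add_zero]

variable [NormedSpace ℝ Y]

/-- The Steklov average of `g` over `[s, s + h]`. -/
def steklov (h : ℝ) (g : ℝ → Y) (s : ℝ) : Y := h⁻¹ • ∫ x in s..(s + h), g x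

variable [CompleteSpace Y]

/-- The error of the average at s is the mean of g(s+σ) − g(s) over σ in (0, h]; Cauchy–Schwarz
bounds its square by the mean square. Only translates of g are left, and these can be integrated in
s. -/
theorem enorm_steklov_sub_sq_le {g : ℝ → Y} (hg : LocallyIntegrable g volume) {h : ℝ} (hh : 0 < h)
    (s : ℝ) : ‖steklov h g s - g s‖ₑ ^ 2 ≤
      (ENNReal.ofReal h)⁻¹ * ∫⁻ σ in Ioc 0 h, ‖g (s + σ) - g s‖ₑ ^ 2 := by
  have hi : IntervalIntegrable (fun σ => g (s + σ)) volume 0 h := by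
    have h1 : IntervalIntegrable g volume s (s + h) :=
      (hg.integrableOn_isCompact isCompact_uIcc).intervalIntegrable
    have := h1.comp_add_left s
    simpa using this
  have e : steklov h g s - g s = h⁻¹ • ∫ σ in Ioc 0 h, (g (s + σ) - g s) := by
    rw [← intervalIntegral.integral_of_le hh.le, intervalIntegral.integral_sub hi (by simp),
      intervalIntegral.integral_const, smul_sub, sub_zero, smul_smul, inv_mul_cancel₀ hh.ne',
      one_smul, steklov]
    congr 2
    rw [intervalIntegral.integral_comp_add_left (fun x => g x) s, add_zero]
  have hh0 : ENNReal.ofReal h ≠ 0 := by simpa using hh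
  have hm : AEMeasurable (fun σ => ‖g (s + σ) - g s‖ₑ) (volume.restrict (Ioc 0 h)) :=
    (((intervalIntegrable_iff_integrableOn_Ioc_of_le hh.le).1 hi).aestronglyMeasurable.sub
      aestronglyMeasurable_const).enorm
  have h2 := lintegral_sq_le hm
  rw [Measure.restrict_apply_univ, Real.volume_Ioc, sub_zero] at h2
  rw [e, enorm_smul, mul_pow]
  have e3 : ‖h⁻¹‖ₑ = (ENNReal.ofReal h)⁻¹ := by
    rw [Real.enorm_eq_ofReal (inv_nonneg.2 hh.le), ENNReal.ofReal_inv_of_pos hh]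
  rw [e3]
  calc _ ≤ (ENNReal.ofReal h)⁻¹ ^ 2 * (ENNReal.ofReal h *
        ∫⁻ σ in Ioc 0 h, ‖g (s + σ) - g s‖ₑ ^ 2) := by
        gcongr
        exact (pow_le_pow_left' (enorm_integral_le_lintegral_enorm _) 2).trans h2
    _ = _ := by
        rw [sq, ← mul_assoc, mul_assoc _ _ (ENNReal.ofReal h),
          ENNReal.inv_mul_cancel hh0 ENNReal.ofReal_ne_top, mul_one]

/-- By Tonelli, the squared L² error of averaging is at most the mean over σ in (0, h] of the
squared L² translation errors, each of which is at most ε² once h < δ. -/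
theorem tendsto_eLpNorm_steklov {g : ℝ → Y} (hg : MemLp g 2 volume) :
    Tendsto (fun h : ℝ => eLpNorm (steklov h g - g) 2 volume) (𝓝[>] 0) (𝓝 0) := by
  rw [ENNReal.tendsto_nhds_zero]
  intro ε hε
  have h0 := (ENNReal.tendsto_nhds_zero.1 (tendsto_eLpNorm_translate hg)) ε hε
  obtain ⟨δ, hδ, hb⟩ := Metric.eventually_nhds_iff.1 h0
  have hlt : ∀ᶠ h : ℝ in 𝓝[>] 0, h < δ := (eventually_lt_nhds hδ).filter_mono nhdsWithin_le_nhds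
  filter_upwards [self_mem_nhdsWithin, hlt] with h hh hhδ
  rw [mem_Ioi] at hh
  have hli : LocallyIntegrable g volume := hg.locallyIntegrable (by norm_num)
  have hh0 : ENNReal.ofReal h ≠ 0 := by simpa using hh
  -- Exchanging the integrals needs joint measurability. Addition is a measure preserving shear
  -- followed by a projection, so it pulls null sets back to null sets.
  have hsm : AEStronglyMeasurable (fun z : ℝ × ℝ => g (z.1 + z.2) - g z.1)
      (volume.prod (volume.restrict (Ioc 0 h))) := by
    refine AEStronglyMeasurable.sub ?_ ?_
    · refine hg.1.comp_quasiMeasurePreserving ?_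
      have h1 : Measure.QuasiMeasurePreserving (fun z : ℝ × ℝ => z.1 + z.2)
          (volume.prod volume) volume := by
        refine (Measure.quasiMeasurePreserving_fst (μ := (volume : Measure ℝ))
          (ν := (volume : Measure ℝ))).comp
          (measurePreserving_add_prod (volume : Measure ℝ) (volume : Measure ℝ)).quasiMeasurePreserving
      refine h1.mono_left ?_
      exact Measure.AbsolutelyContinuous.prod Measure.AbsolutelyContinuous.rfl
        Measure.restrict_le_self.absolutelyContinuous
    · exact hg.1.comp_quasiMeasurePreserving Measure.quasiMeasurePreserving_fst
  have key : eLpNorm (steklov h g - g) 2 volume ^ 2 ≤ ε ^ 2 := by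
    rw [eLpNorm_two_sq]
    calc ∫⁻ s, ‖(steklov h g - g) s‖ₑ ^ 2
        ≤ ∫⁻ s, (ENNReal.ofReal h)⁻¹ * ∫⁻ σ in Ioc 0 h, ‖g (s + σ) - g s‖ₑ ^ 2 :=
          lintegral_mono fun s => enorm_steklov_sub_sq_le hli hh s
      _ = (ENNReal.ofReal h)⁻¹ * ∫⁻ s, ∫⁻ σ in Ioc 0 h, ‖g (s + σ) - g s‖ₑ ^ 2 :=
          lintegral_const_mul' _ _ (by simpa using hh)
      _ = (ENNReal.ofReal h)⁻¹ * ∫⁻ σ in Ioc 0 h, ∫⁻ s, ‖g (s + σ) - g s‖ₑ ^ 2 := by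
          rw [lintegral_lintegral_swap]
          exact hsm.enorm.pow_const 2
      _ ≤ (ENNReal.ofReal h)⁻¹ * ∫⁻ σ in Ioc 0 h, ε ^ 2 := by
          gcongr 1
          refine setLIntegral_mono' measurableSet_Ioc fun σ hσ => ?_
          rw [← eLpNorm_two_sq volume (fun s => g (s + σ) - g s)]
          gcongr
          refine hb ?_
          rw [Real.dist_0_eq_abs, abs_of_pos hσ.1]
          exact hσ.2.trans_lt hhδ
      _ = ε ^ 2 := by
          rw [setLIntegral_const, Real.volume_Ioc, sub_zero, mul_comm (ε ^ 2), ← mul_assoc,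
            ENNReal.inv_mul_cancel hh0 ENNReal.ofReal_ne_top, one_mul]
  exact (ENNReal.pow_le_pow_left_iff (by norm_num)).1 key

theorem continuous_steklov {g : ℝ → Y} (hg : LocallyIntegrable g volume) (h : ℝ) :
    Continuous (steklov h g) := by
  have hi : ∀ a b, IntervalIntegrable g volume a b := fun a b =>
    (hg.integrableOn_isCompact isCompact_uIcc).intervalIntegrable
  have hc := intervalIntegral.continuous_primitive hi 0
  have e : steklov h g = fun s => h⁻¹ • ((∫ x in (0 : ℝ)..(s + h), g x) - ∫ x in (0 : ℝ)..s, g x) := by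
    funext s
    rw [steklov, intervalIntegral.integral_interval_sub_left (hi _ _) (hi _ _)]
  rw [e]
  have h2 : Continuous fun s : ℝ => ∫ x in (0 : ℝ)..(s + h), g x :=
    hc.comp (continuous_id.add continuous_const)
  exact (h2.sub hc).const_smul _

theorem eventually_memLp_steklov {g : ℝ → Y} (hg : MemLp g 2 volume) :
    ∀ᶠ h in 𝓝[>] (0 : ℝ), MemLp (steklov h g) 2 volume := by
  have h1 := (tendsto_eLpNorm_steklov hg).eventually (gt_mem_nhds ENNReal.zero_lt_top)
  filter_upwards [h1] with h hh
  have hm : MemLp (steklov h g - g) 2 volume :=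
    ⟨(continuous_steklov (hg.locallyIntegrable (by norm_num)) h).aestronglyMeasurable.sub hg.1, hh⟩
  simpa using hm.add hg

theorem tendsto_steklov_apply {g : ℝ → Y} (hg : Continuous g) (s : ℝ) :
    Tendsto (fun h => steklov h g s) (𝓝[>] 0) (𝓝 (g s)) := by
  have hd : HasDerivAt (fun x => ∫ t in s..x, g t) (g s) s :=
    intervalIntegral.integral_hasDerivAt_right (hg.intervalIntegrable _ _)
      (hg.stronglyMeasurableAtFilter _ _) hg.continuousAt
  have h1 := hd.tendsto_slope_zero_right
  simpa [steklov] using h1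

/-- The derivative is a difference quotient of g and needs only continuity, so averaged trajectories
are differentiable in the strong space of g. -/
theorem hasDerivAt_steklov {g : ℝ → Y} (hg : Continuous g) (h s : ℝ) :
    HasDerivAt (steklov h g) (h⁻¹ • (g (s + h) - g s)) s := by
  have hd : ∀ s, HasDerivAt (fun x => ∫ t in (0 : ℝ)..x, g t) (g s) s := fun s =>
    intervalIntegral.integral_hasDerivAt_right (hg.intervalIntegrable _ _)
      (hg.stronglyMeasurableAtFilter _ _) hg.continuousAt
  have e : steklov h g = fun s => h⁻¹ • ((∫ x in (0 : ℝ)..(s + h), g x) - ∫ x in (0 : ℝ)..s, g x) := by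
    funext s
    rw [steklov, intervalIntegral.integral_interval_sub_left (hg.intervalIntegrable _ _)
      (hg.intervalIntegrable _ _)]
  rw [e]
  have h1 := (hd (s + h)).comp_add_const s h
  exact (h1.sub (hd s)).const_smul _

end SteklovAverages

section InnerLimits

variable {α Y : Type*} [MeasurableSpace α] {μ : Measure α} [NormedAddCommGroup Y]
  [InnerProductSpace ℝ Y]

theorem integrable_inner_of_memLp {f g : α → Y} (hf : MemLp f 2 μ) (hg : MemLp g 2 μ) :
    Integrable (fun x => inner ℝ (f x) (g x)) μ := by
  refine (L2.integrable_inner (𝕜 := ℝ) (hf.toLp f) (hg.toLp g)).congr ?_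
  filter_upwards [hf.coeFn_toLp, hg.coeFn_toLp] with x h1 h2
  rw [h1, h2]

theorem inner_toLp {f g : α → Y} (hf : MemLp f 2 μ) (hg : MemLp g 2 μ) :
    inner ℝ (hf.toLp f) (hg.toLp g) = ∫ x, inner ℝ (f x) (g x) ∂μ := by
  rw [L2.inner_def]
  refine integral_congr_ae ?_
  filter_upwards [hf.coeFn_toLp, hg.coeFn_toLp] with x h1 h2
  rw [h1, h2]

theorem norm_toLp_sq {f : α → Y} (hf : MemLp f 2 μ) :
    ‖hf.toLp f‖ ^ 2 = ∫ x, ‖f x‖ ^ 2 ∂μ := by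
  rw [← real_inner_self_eq_norm_sq, inner_toLp]
  simp

theorem tendsto_integral_inner {ι : Type*} {l : Filter ι} {F G : ι → α → Y} {f g : α → Y}
    (hF : ∀ᶠ n in l, MemLp (F n) 2 μ) (hG : ∀ᶠ n in l, MemLp (G n) 2 μ) (hf : MemLp f 2 μ)
    (hg : MemLp g 2 μ)
    (hFf : Tendsto (fun n => eLpNorm (F n - f) 2 μ) l (𝓝 0))
    (hGg : Tendsto (fun n => eLpNorm (G n - g) 2 μ) l (𝓝 0)) :
    Tendsto (fun n => ∫ x, inner ℝ (F n x) (G n x) ∂μ) l (𝓝 (∫ x, inner ℝ (f x) (g x) ∂μ)) := by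
  classical
  -- Membership in L² holds only eventually. Elsewhere the limit itself is substituted, so that
  -- `MemLp.toLp` makes sense for every index.
  let F' : ι → α → Y := fun n => if MemLp (F n) 2 μ then F n else f
  let G' : ι → α → Y := fun n => if MemLp (G n) 2 μ then G n else g
  have hF' : ∀ n, MemLp (F' n) 2 μ := fun n => by
    by_cases h : MemLp (F n) 2 μ <;> simp [F', h, hf]
  have hG' : ∀ n, MemLp (G' n) 2 μ := fun n => by
    by_cases h : MemLp (G n) 2 μ <;> simp [G', h, hg]
  have eF : ∀ᶠ n in l, F' n = F n := hF.mono fun n h => by simp [F', h]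
  have eG : ∀ᶠ n in l, G' n = G n := hG.mono fun n h => by simp [G', h]
  have t1 := (Lp.tendsto_Lp_iff_tendsto_eLpNorm'' F' hF' f hf).2
    (hFf.congr' (eF.mono fun n h => by simp only [h]))
  have t2 := (Lp.tendsto_Lp_iff_tendsto_eLpNorm'' G' hG' g hg).2
    (hGg.congr' (eG.mono fun n h => by simp only [h]))
  have t3 := t1.inner (𝕜 := ℝ) t2
  simp only [inner_toLp] at t3
  refine t3.congr' ?_
  filter_upwards [eF, eG] with n h1 h2
  rw [h1, h2]

end InnerLimits

end

/-! ### Abstract weak evolutions: energy and pairing identities -/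

section

variable {V H Y : Type*} [NormedAddCommGroup V] [InnerProductSpace ℝ V] [CompleteSpace V]
  [NormedAddCommGroup H] [InnerProductSpace ℝ H] [CompleteSpace H]
  [NormedAddCommGroup Y] [InnerProductSpace ℝ Y] [CompleteSpace Y]

/-- Weak solutions `u : [0, T] → V` of the abstract wave equation `u'' + u = κ† f`, where
`w = u'` takes values in `H`, `y = (κ u)'` is square integrable with values in `Y`, and the pivot
embedding `V → H` is `π ∘ κ`. -/
structure IsEvol (κ : V →L[ℝ] Y) (π : Y →L[ℝ] H) (T : ℝ) (f : ℝ → Y) (u : ℝ → V) (w : ℝ → H)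
    (y : ℝ → Y) : Prop where
  contU : ContinuousOn u (Icc 0 T)
  contW : ContinuousOn w (Icc 0 T)
  memY : MemLp y 2 (volume.restrict (Ioc 0 T))
  memF : MemLp f 2 (volume.restrict (Ioc 0 T))
  pi_y : ∀ᵐ t ∂(volume.restrict (Ioc 0 T)), π (y t) = w t
  eqU : ∀ t ∈ Icc 0 T, κ (u t) = κ (u 0) + ∫ s in (0 : ℝ)..t, y s
  eqW : ∀ t ∈ Icc 0 T, ∀ v : V, inner ℝ (w t) (π (κ v)) = inner ℝ (w 0) (π (κ v)) +
    ∫ s in (0 : ℝ)..t, (inner ℝ (f s) (κ v) - inner ℝ (u s) v)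

theorem MemLp.intervalIntegrable_of_le {T a b : ℝ} {f : ℝ → Y}
    (hf : MemLp f 2 (volume.restrict (Ioc 0 T))) (ha : 0 ≤ a) (hab : a ≤ b) (hb : b ≤ T) :
    IntervalIntegrable f volume a b := by
  have h1 : IntegrableOn f (Ioc 0 T) := hf.integrable (by norm_num)
  rw [intervalIntegrable_iff_integrableOn_Ioc_of_le hab]
  exact h1.mono_set (Ioc_subset_Ioc ha hb)

theorem ContinuousOn.memLp_two {T : ℝ} {f : ℝ → Y} (hf : ContinuousOn f (Icc 0 T)) :
    MemLp f 2 (volume.restrict (Ioc 0 T)) := by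
  have hm : AEStronglyMeasurable f (volume.restrict (Ioc 0 T)) :=
    (hf.mono Ioc_subset_Icc_self).aestronglyMeasurable measurableSet_Ioc
  obtain ⟨C, hC⟩ := isCompact_Icc.exists_bound_of_continuousOn hf
  refine MemLp.of_bound hm C ?_
  filter_upwards [ae_restrict_mem measurableSet_Ioc] with x hx
  exact hC x (Ioc_subset_Icc_self hx)

namespace IsEvol

variable {κ : V →L[ℝ] Y} {π : Y →L[ℝ] H} {T : ℝ} {f : ℝ → Y} {u : ℝ → V} {w : ℝ → H} {y : ℝ → Y}

theorem integrand_intervalIntegrable (hE : IsEvol κ π T f u w y) {a b : ℝ} (ha : 0 ≤ a)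
    (hab : a ≤ b) (hb : b ≤ T) (v : V) :
    IntervalIntegrable (fun s => inner ℝ (f s) (κ v)) volume a b ∧
    IntervalIntegrable (fun s => inner ℝ (u s) v) volume a b := by
  constructor
  · have h1 := MemLp.intervalIntegrable_of_le hE.memF ha hab hb
    rw [intervalIntegrable_iff_integrableOn_Ioc_of_le hab] at h1 ⊢
    exact h1.inner_const _
  · refine ContinuousOn.intervalIntegrable ?_
    rw [uIcc_of_le hab]
    exact ((hE.contU.mono (Icc_subset_Icc ha hb)).inner continuousOn_const)

theorem eqU_sub (hE : IsEvol κ π T f u w y) {a b : ℝ} (ha : 0 ≤ a) (hab : a ≤ b) (hb : b ≤ T) :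
    κ (u b - u a) = ∫ s in a..b, y s := by
  rw [map_sub, hE.eqU b ⟨ha.trans hab, hb⟩, hE.eqU a ⟨ha, hab.trans hb⟩, add_sub_add_left_eq_sub,
    intervalIntegral.integral_interval_sub_left]
  · exact MemLp.intervalIntegrable_of_le hE.memY le_rfl (ha.trans hab) hb
  · exact MemLp.intervalIntegrable_of_le hE.memY le_rfl ha (hab.trans hb)

theorem eqW_sub (hE : IsEvol κ π T f u w y) {a b : ℝ} (ha : 0 ≤ a) (hab : a ≤ b) (hb : b ≤ T)
    (v : V) : inner ℝ (w b - w a) (π (κ v)) =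
      inner ℝ (∫ s in a..b, f s) (κ v) - inner ℝ (∫ s in a..b, u s) v := by
  have i1 := hE.integrand_intervalIntegrable le_rfl (ha.trans hab) hb v
  have i2 := hE.integrand_intervalIntegrable le_rfl ha (hab.trans hb) v
  have i3 := hE.integrand_intervalIntegrable ha hab hb v
  have hfi := MemLp.intervalIntegrable_of_le hE.memF ha hab hb
  have hui : IntervalIntegrable u volume a b := by
    refine ContinuousOn.intervalIntegrable ?_
    rw [uIcc_of_le hab]
    exact hE.contU.mono (Icc_subset_Icc ha hb)
  rw [intervalIntegrable_iff_integrableOn_Ioc_of_le hab] at hfi hui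
  rw [inner_sub_left, hE.eqW b ⟨ha.trans hab, hb⟩, hE.eqW a ⟨ha, hab.trans hb⟩,
    add_sub_add_left_eq_sub, intervalIntegral.integral_interval_sub_left (i1.1.sub i1.2)
    (i2.1.sub i2.2), intervalIntegral.integral_sub i3.1 i3.2]
  simp only [intervalIntegral.integral_of_le hab]
  congr 1
  · rw [real_inner_comm, ← integral_inner hfi]
    simp only [real_inner_comm]
  · rw [real_inner_comm, ← integral_inner hui]
    simp only [real_inner_comm]

theorem pi_integral (hE : IsEvol κ π T f u w y) {a b : ℝ} (ha : 0 ≤ a) (hab : a ≤ b) (hb : b ≤ T) :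
    π (∫ s in a..b, y s) = ∫ s in a..b, w s := by
  have h1 := MemLp.intervalIntegrable_of_le hE.memY ha hab hb
  rw [← π.intervalIntegral_comp_comm h1]
  refine intervalIntegral.integral_congr_ae ?_
  have := (ae_restrict_iff' measurableSet_Ioc).1 hE.pi_y
  filter_upwards [this] with x hx hxm
  rw [uIoc_of_le hab] at hxm
  exact hx ⟨ha.trans_lt hxm.1, hxm.2.trans hb⟩

theorem mono (hE : IsEvol κ π T f u w y) {T' : ℝ} (h : T' ≤ T) : IsEvol κ π T' f u w y := by
  have hs : Icc 0 T' ⊆ Icc 0 T := Icc_subset_Icc_right h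
  have hr : volume.restrict (Ioc 0 T') ≤ volume.restrict (Ioc 0 T) :=
    Measure.restrict_mono (Ioc_subset_Ioc_right h) le_rfl
  exact ⟨hE.contU.mono hs, hE.contW.mono hs, hE.memY.mono_measure hr, hE.memF.mono_measure hr,
    ae_mono hr hE.pi_y, fun t ht => hE.eqU t (hs ht), fun t ht => hE.eqW t (hs ht)⟩

theorem add {f' : ℝ → Y} {u' : ℝ → V} {w' : ℝ → H} {y' : ℝ → Y} (hE : IsEvol κ π T f u w y)
    (hE' : IsEvol κ π T f' u' w' y') : IsEvol κ π T (fun t => f t + f' t) (fun t => u t + u' t)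
      (fun t => w t + w' t) (fun t => y t + y' t) := by
  refine ⟨hE.contU.add hE'.contU, hE.contW.add hE'.contW, hE.memY.add hE'.memY,
    hE.memF.add hE'.memF, ?_, ?_, ?_⟩
  · filter_upwards [hE.pi_y, hE'.pi_y] with t h1 h2
    rw [map_add, h1, h2]
  · intro t ht
    rw [intervalIntegral.integral_add (MemLp.intervalIntegrable_of_le hE.memY le_rfl ht.1 ht.2)
      (MemLp.intervalIntegrable_of_le hE'.memY le_rfl ht.1 ht.2), map_add, map_add, hE.eqU t ht,
      hE'.eqU t ht]
    abel
  · intro t ht v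
    have i1 := hE.integrand_intervalIntegrable le_rfl ht.1 ht.2 v
    have i2 := hE'.integrand_intervalIntegrable le_rfl ht.1 ht.2 v
    rw [inner_add_left, inner_add_left, hE.eqW t ht v, hE'.eqW t ht v, add_add_add_comm,
      ← intervalIntegral.integral_add (i1.1.sub i1.2) (i2.1.sub i2.2)]
    congr 1
    refine intervalIntegral.integral_congr fun s _ => ?_
    simp only [inner_add_left]
    ring

theorem const_smul (hE : IsEvol κ π T f u w y) (c : ℝ) : IsEvol κ π T (fun t => c • f t)
    (fun t => c • u t) (fun t => c • w t) (fun t => c • y t) := by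
  refine ⟨hE.contU.const_smul c, hE.contW.const_smul c, hE.memY.const_smul c,
    hE.memF.const_smul c, ?_, ?_, ?_⟩
  · filter_upwards [hE.pi_y] with t h1
    rw [map_smul, h1]
  · intro t ht
    rw [intervalIntegral.integral_smul, map_smul, map_smul, hE.eqU t ht, smul_add]
  · intro t ht v
    rw [real_inner_smul_left, real_inner_smul_left, hE.eqW t ht v, mul_add,
      ← intervalIntegral.integral_const_mul]
    congr 1
    refine intervalIntegral.integral_congr fun s _ => ?_
    simp only [real_inner_smul_left]
    ring

theorem sub {f' : ℝ → Y} {u' : ℝ → V} {w' : ℝ → H} {y' : ℝ → Y} (hE : IsEvol κ π T f u w y)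
    (hE' : IsEvol κ π T f' u' w' y') : IsEvol κ π T (fun t => f t - f' t) (fun t => u t - u' t)
      (fun t => w t - w' t) (fun t => y t - y' t) := by
  simpa only [neg_one_smul, ← sub_eq_add_neg] using hE.add (hE'.const_smul (-1))

/-- The regularized energy and pairing identities, before passing to the limit. -/
theorem hasDerivAt_steklov_energy (hE : IsEvol κ π T f u w y) {s h : ℝ} (hs : 0 ≤ s)
    (hh : 0 < h) (hsh : s + h ≤ T) {ue : ℝ → V} {we : ℝ → H} (cue : Continuous ue)
    (cwe : Continuous we) (hue : EqOn ue u (Icc 0 T)) (hwe : EqOn we w (Icc 0 T)) :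
    HasDerivAt (fun s => 1 / 2 * ‖steklov h ue s‖ ^ 2 + 1 / 2 * ‖steklov h we s‖ ^ 2)
      (inner ℝ (steklov h f s) (steklov h y s)) s ∧
    HasDerivAt (fun s => inner ℝ (steklov h we s) (π (κ (steklov h ue s))))
      (inner ℝ (steklov h f s) (κ (steklov h ue s)) - inner ℝ (steklov h ue s) (steklov h ue s)
        + inner ℝ (steklov h we s) (steklov h we s)) s := by
  have m1 : s ∈ Icc 0 T := ⟨hs, by linarith⟩
  have m2 : s + h ∈ Icc 0 T := ⟨by linarith, hsh⟩
  have hss : s ≤ s + h := by linarith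
  have isub : uIcc s (s + h) ⊆ Icc 0 T := by
    rw [uIcc_of_le hss]; exact Icc_subset_Icc hs hsh
  have eu : ∫ x in s..s + h, ue x = ∫ x in s..s + h, u x :=
    intervalIntegral.integral_congr fun x hx => hue (isub hx)
  have ew : ∫ x in s..s + h, we x = ∫ x in s..s + h, w x :=
    intervalIntegral.integral_congr fun x hx => hwe (isub hx)
  have dU := hasDerivAt_steklov cue h s
  have dW := hasDerivAt_steklov cwe h s
  set U' := h⁻¹ • (ue (s + h) - ue s) with hU'
  set W' := h⁻¹ • (we (s + h) - we s) with hW'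
  have a1 : κ U' = steklov h y s := by
    rw [hU', map_smul, hue m1, hue m2, hE.eqU_sub hs hss hsh, steklov]
  have b1 : π (κ U') = steklov h we s := by
    rw [a1, steklov, map_smul, hE.pi_integral hs hss hsh, steklov, ew]
  -- Averaging turns the integrated weak equation into a pointwise one, valid for all test vectors
  -- at once. It may therefore be tested with the averaged velocity U', which lies in V, and with
  -- the average of u.
  have c1 : ∀ v, inner ℝ W' (π (κ v)) = inner ℝ (steklov h f s) (κ v) -
      inner ℝ (steklov h ue s) v := by
    intro v
    rw [hW', hwe m1, hwe m2, real_inner_smul_left, hE.eqW_sub hs hss hsh, steklov, steklov, eu,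
      real_inner_smul_left, real_inner_smul_left]
    ring
  constructor
  · have := ((dU.norm_sq).const_mul (1 / 2)).add ((dW.norm_sq).const_mul (1 / 2))
    refine this.congr_deriv ?_
    have := c1 U'
    rw [b1, a1] at this
    rw [real_inner_comm W', this]
    ring
  · have := dW.inner ℝ (((π.comp κ).hasFDerivAt).comp_hasDerivAt s dU)
    refine this.congr_deriv ?_
    have := c1 (steklov h ue s)
    simp only [ContinuousLinearMap.comp_apply, Function.comp_def]
    rw [b1, this]
    ring

/-- Extension by zero places f and y in L²(ℝ), where averages converge. A window contained in [0, T]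
does not see the extension. -/
theorem steklov_indicator {E : Type*} [NormedAddCommGroup E] [NormedSpace ℝ E] {T s h : ℝ}
    (g : ℝ → E) (hs : 0 ≤ s) (hh : 0 < h) (hsh : s + h ≤ T) :
    steklov h ((Ioc 0 T).indicator g) s = steklov h g s := by
  rw [steklov, steklov]
  congr 1
  refine intervalIntegral.integral_congr_ae (Eventually.of_forall fun x hx => ?_)
  rw [uIoc_of_le (by linarith)] at hx
  exact indicator_of_mem (show x ∈ Ioc 0 T from ⟨hs.trans_lt hx.1, hx.2.trans hsh⟩) _

/-- The strict inequality t < T leaves room for the forward window [s, s+h] once h < T − t; the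
endpoint T is recovered later by continuity. -/
theorem tendsto_integral_inner_steklov {E : Type*} [NormedAddCommGroup E] [InnerProductSpace ℝ E]
    [CompleteSpace E] {T t : ℝ} {F G : ℝ → E} (ht0 : 0 ≤ t) (ht : t < T)
    (hF : MemLp F 2 (volume.restrict (Ioc 0 T))) (hG : MemLp G 2 (volume.restrict (Ioc 0 T))) :
    Tendsto (fun h => ∫ s in (0 : ℝ)..t, inner ℝ (steklov h F s) (steklov h G s)) (𝓝[>] 0)
      (𝓝 (∫ s in (0 : ℝ)..t, inner ℝ (F s) (G s))) := by
  have hF' := (memLp_indicator_iff_restrict (s := Ioc 0 T) measurableSet_Ioc).2 hF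
  have hG' := (memLp_indicator_iff_restrict (s := Ioc 0 T) measurableSet_Ioc).2 hG
  have hres : volume.restrict (Ioc 0 t) ≤ (volume : Measure ℝ) := Measure.restrict_le_self
  have lim : ∀ g : ℝ → E, MemLp g 2 volume →
      Tendsto (fun h => eLpNorm (steklov h g - g) 2 (volume.restrict (Ioc 0 t))) (𝓝[>] 0) (𝓝 0) :=
    fun g hg => tendsto_of_tendsto_of_tendsto_of_le_of_le tendsto_const_nhds
      (tendsto_eLpNorm_steklov hg) (fun _ => zero_le) (fun _ => eLpNorm_mono_measure _ hres)
  have key := tendsto_integral_inner (μ := volume.restrict (Ioc 0 t))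
    ((eventually_memLp_steklov hF').mono fun h hh => hh.mono_measure hres)
    ((eventually_memLp_steklov hG').mono fun h hh => hh.mono_measure hres)
    (hF'.mono_measure hres) (hG'.mono_measure hres) (lim _ hF') (lim _ hG')
  have e0 : ∫ s in (0 : ℝ)..t, inner ℝ (F s) (G s) =
      ∫ s in Ioc 0 t, inner ℝ ((Ioc 0 T).indicator F s) ((Ioc 0 T).indicator G s) := by
    rw [intervalIntegral.integral_of_le ht0]
    refine setIntegral_congr_fun measurableSet_Ioc fun s hs => ?_
    have : s ∈ Ioc 0 T := ⟨hs.1, hs.2.trans ht.le⟩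
    simp only [indicator_of_mem this]
  rw [e0]
  refine key.congr' ?_
  have hlt : ∀ᶠ h : ℝ in 𝓝[>] 0, h < T - t :=
    (eventually_lt_nhds (sub_pos.2 ht)).filter_mono nhdsWithin_le_nhds
  filter_upwards [self_mem_nhdsWithin, hlt] with h hh hhT
  rw [intervalIntegral.integral_of_le ht0]
  refine setIntegral_congr_fun measurableSet_Ioc fun s hs => ?_
  simp only [steklov_indicator _ hs.1.le hh (show s + h ≤ T by linarith [hs.2])]

theorem tendsto_steklov_of_continuousOn {E : Type*} [NormedAddCommGroup E] [NormedSpace ℝ E]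
    [CompleteSpace E] {T s : ℝ} {g ge : ℝ → E} (cg : Continuous ge) (hg : EqOn ge g (Icc 0 T))
    (hs : s ∈ Icc 0 T) : Tendsto (fun h => steklov h ge s) (𝓝[>] 0) (𝓝 (g s)) := by
  rw [← hg hs]
  exact tendsto_steklov_apply cg s

theorem exists_continuous_extension {E : Type*} [NormedAddCommGroup E] {T : ℝ} (hT : 0 ≤ T)
    {g : ℝ → E} (hg : ContinuousOn g (Icc 0 T)) :
    ∃ ge : ℝ → E, Continuous ge ∧ EqOn ge g (Icc 0 T) :=
  ⟨IccExtend hT ((Icc 0 T).domRestrict g), (continuousOn_iff_continuous_domRestrict.1 hg).Icc_extend',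
    fun x hx => by rw [IccExtend_of_mem hT _ hx]; rfl⟩

/-- A function continuous on `[0, T]` that vanishes on `[0, T)` and at `0` vanishes on `[0, T]`. -/
theorem eqOn_Icc_of_eqOn_Ico {E : Type*} [NormedAddCommGroup E] {T : ℝ} {a b : ℝ → E}
    (ha : ContinuousOn a (Icc 0 T)) (hb : ContinuousOn b (Icc 0 T)) (h0 : a 0 = b 0)
    (h : ∀ t, 0 ≤ t → t < T → a t = b t) : ∀ t ∈ Icc 0 T, a t = b t := by
  intro t ht
  rcases ht.2.lt_or_eq with h1 | h1
  · exact h t ht.1 h1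
  rcases ht.1.eq_or_lt with h2 | h2
  · rw [← h2, h0]
  · have hT : (0 : ℝ) < T := h1 ▸ h2
    have : EqOn a b (Icc 0 T) := by
      refine EqOn.of_subset_closure (s := Ico 0 T) (fun s hs => h s hs.1 hs.2) ha hb
        Ico_subset_Icc_self ?_
      rw [closure_Ico hT.ne]
    exact this ht

theorem continuousOn_primitive_of_integrableOn {E : Type*} [NormedAddCommGroup E]
    [NormedSpace ℝ E] {T : ℝ} {g : ℝ → E} (hg : IntegrableOn g (Ioc 0 T)) :
    ContinuousOn (fun t => ∫ s in (0 : ℝ)..t, g s) (Icc 0 T) := by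
  rcases le_or_gt 0 T with h | h
  · rw [← uIcc_of_le h]
    refine intervalIntegral.continuousOn_primitive_interval ?_
    rwa [uIcc_of_le h, integrableOn_Icc_iff_integrableOn_Ioc]
  · rw [Icc_eq_empty (not_le.2 h)]
    exact continuousOn_empty _

/-- Formally the equation is tested with u', which is not V-valued. The identity holds exactly for
Steklov averages; the averages of u and w converge pointwise, those of f and y in L², and both sides
are continuous up to T. -/
theorem energy_identity (hE : IsEvol κ π T f u w y) : ∀ t ∈ Icc 0 T,
    1 / 2 * ‖u t‖ ^ 2 + 1 / 2 * ‖w t‖ ^ 2 = 1 / 2 * ‖u 0‖ ^ 2 + 1 / 2 * ‖w 0‖ ^ 2 +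
      ∫ s in (0 : ℝ)..t, inner ℝ (f s) (y s) := by
  refine eqOn_Icc_of_eqOn_Ico ?_ ?_ (by simp) fun t ht0 ht => ?_
  · exact ((hE.contU.norm.pow 2).const_smul (1 / 2 : ℝ)).add
      ((hE.contW.norm.pow 2).const_smul (1 / 2 : ℝ))
  · exact continuousOn_const.add (continuousOn_primitive_of_integrableOn
      (integrable_inner_of_memLp hE.memF hE.memY))
  have hT : 0 ≤ T := ht0.trans ht.le
  obtain ⟨ue, cue, hue⟩ := exists_continuous_extension hT hE.contU
  obtain ⟨we, cwe, hwe⟩ := exists_continuous_extension hT hE.contW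
  have l1 := tendsto_integral_inner_steklov ht0 ht hE.memF hE.memY
  have lu := fun s hs => ((tendsto_steklov_of_continuousOn cue hue (s := s) hs).norm.pow 2).const_mul
    (1 / 2)
  have lw := fun s hs => ((tendsto_steklov_of_continuousOn cwe hwe (s := s) hs).norm.pow 2).const_mul
    (1 / 2)
  have m0 : (0 : ℝ) ∈ Icc 0 T := ⟨le_rfl, hT⟩
  have mt : t ∈ Icc 0 T := ⟨ht0, ht.le⟩
  have l2 := ((lu t mt).add (lw t mt)).sub ((lu 0 m0).add (lw 0 m0))
  rw [← sub_eq_iff_eq_add']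
  refine tendsto_nhds_unique (l2.congr' ?_) l1
  have hlt : ∀ᶠ h : ℝ in 𝓝[>] 0, h < T - t :=
    (eventually_lt_nhds (sub_pos.2 ht)).filter_mono nhdsWithin_le_nhds
  filter_upwards [self_mem_nhdsWithin, hlt] with h hh hhT
  rw [mem_Ioi] at hh
  -- With f and y extended by zero the averaged derivative is continuous on all of ℝ, hence
  -- integrable, and it is unchanged on [0, t].
  have hd : ∀ s ∈ uIcc 0 t, HasDerivAt
      (fun s => 1 / 2 * ‖steklov h ue s‖ ^ 2 + 1 / 2 * ‖steklov h we s‖ ^ 2)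
      (inner ℝ (steklov h ((Ioc 0 T).indicator f) s) (steklov h ((Ioc 0 T).indicator y) s)) s := by
    intro s hs
    rw [uIcc_of_le ht0] at hs
    have hsT : s + h ≤ T := by linarith [hs.2]
    rw [steklov_indicator f hs.1 hh hsT, steklov_indicator y hs.1 hh hsT]
    exact (hE.hasDerivAt_steklov_energy hs.1 hh hsT cue cwe hue hwe).1
  have hF := ((memLp_indicator_iff_restrict (s := Ioc 0 T) measurableSet_Ioc).2
    hE.memF).locallyIntegrable (by norm_num)
  have hY := ((memLp_indicator_iff_restrict (s := Ioc 0 T) measurableSet_Ioc).2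
    hE.memY).locallyIntegrable (by norm_num)
  rw [← intervalIntegral.integral_eq_sub_of_hasDerivAt hd
    (((continuous_steklov hF h).inner (continuous_steklov hY h)).intervalIntegrable _ _)]
  refine intervalIntegral.integral_congr fun s hs => ?_
  rw [uIcc_of_le ht0] at hs
  have hsT : s + h ≤ T := by linarith [hs.2]
  simp only [steklov_indicator f hs.1 hh hsT, steklov_indicator y hs.1 hh hsT]

/-- The equation tested with u itself, by the same averaging. It brings −‖u‖² into the derivative of
⟨u', u⟩, which the energy identity alone does not provide. -/
theorem pairing_identity (hE : IsEvol κ π T f u w y) : ∀ t ∈ Icc 0 T,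
    inner ℝ (w t) (π (κ (u t))) = inner ℝ (w 0) (π (κ (u 0))) +
      ((∫ s in (0 : ℝ)..t, inner ℝ (f s) (κ (u s))) - (∫ s in (0 : ℝ)..t, inner ℝ (u s) (u s))
        + ∫ s in (0 : ℝ)..t, inner ℝ (w s) (w s)) := by
  have cκ : ContinuousOn (fun t => κ (u t)) (Icc 0 T) := κ.continuous.comp_continuousOn hE.contU
  have cπ : ContinuousOn (fun t => π (κ (u t))) (Icc 0 T) := π.continuous.comp_continuousOn cκ
  have mU := ContinuousOn.memLp_two hE.contU
  have mW := ContinuousOn.memLp_two hE.contW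
  have mK := ContinuousOn.memLp_two cκ
  refine eqOn_Icc_of_eqOn_Ico (hE.contW.inner cπ) ?_ (by simp) fun t ht0 ht => ?_
  · exact continuousOn_const.add (((continuousOn_primitive_of_integrableOn
      (integrable_inner_of_memLp hE.memF mK)).sub (continuousOn_primitive_of_integrableOn
      (integrable_inner_of_memLp mU mU))).add (continuousOn_primitive_of_integrableOn
      (integrable_inner_of_memLp mW mW)))
  have hT : 0 ≤ T := ht0.trans ht.le
  obtain ⟨ue, cue, hue⟩ := exists_continuous_extension hT hE.contU
  obtain ⟨we, cwe, hwe⟩ := exists_continuous_extension hT hE.contW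
  have l1 := ((tendsto_integral_inner_steklov ht0 ht hE.memF mK).sub
    (tendsto_integral_inner_steklov ht0 ht mU mU)).add
    (tendsto_integral_inner_steklov ht0 ht mW mW)
  have lw := fun s hs => (tendsto_steklov_of_continuousOn cwe hwe (s := s) hs).inner (𝕜 := ℝ)
    (((π.comp κ).continuous.tendsto _).comp (tendsto_steklov_of_continuousOn cue hue (s := s) hs))
  have m0 : (0 : ℝ) ∈ Icc 0 T := ⟨le_rfl, hT⟩
  have mt : t ∈ Icc 0 T := ⟨ht0, ht.le⟩
  have l2 := (lw t mt).sub (lw 0 m0)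
  simp only [ContinuousLinearMap.comp_apply, Function.comp_def] at l2
  rw [← sub_eq_iff_eq_add']
  refine tendsto_nhds_unique (l2.congr' ?_) l1
  have hlt : ∀ᶠ h : ℝ in 𝓝[>] 0, h < T - t :=
    (eventually_lt_nhds (sub_pos.2 ht)).filter_mono nhdsWithin_le_nhds
  filter_upwards [self_mem_nhdsWithin, hlt] with h hh hhT
  rw [mem_Ioi] at hh
  have hF := ((memLp_indicator_iff_restrict (s := Ioc 0 T) measurableSet_Ioc).2
    hE.memF).locallyIntegrable (by norm_num)
  have cF := continuous_steklov hF h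
  have cU := continuous_steklov cue.locallyIntegrable h
  have cW := continuous_steklov cwe.locallyIntegrable h
  have hd : ∀ s ∈ uIcc 0 t, HasDerivAt
      (fun s => inner ℝ (steklov h we s) (π (κ (steklov h ue s))))
      (inner ℝ (steklov h ((Ioc 0 T).indicator f) s) (κ (steklov h ue s))
        - inner ℝ (steklov h ue s) (steklov h ue s)
        + inner ℝ (steklov h we s) (steklov h we s)) s := by
    intro s hs
    rw [uIcc_of_le ht0] at hs
    have hsT : s + h ≤ T := by linarith [hs.2]
    rw [steklov_indicator f hs.1 hh hsT]
    exact (hE.hasDerivAt_steklov_energy hs.1 hh hsT cue cwe hue hwe).2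
  have i1 := (cF.inner (𝕜 := ℝ) (κ.continuous.comp cU)).intervalIntegrable (μ := volume) 0 t
  simp only [Function.comp_apply] at i1
  have i2 := (cU.inner (𝕜 := ℝ) cU).intervalIntegrable (μ := volume) 0 t
  have i3 := (cW.inner (𝕜 := ℝ) cW).intervalIntegrable (μ := volume) 0 t
  rw [← intervalIntegral.integral_eq_sub_of_hasDerivAt hd ((i1.sub i2).add i3),
    intervalIntegral.integral_add (i1.sub i2) i3, intervalIntegral.integral_sub i1 i2]
  have eU : ∀ s ∈ uIcc 0 t, steklov h ue s = steklov h u s := by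
    intro s hs
    rw [uIcc_of_le ht0] at hs
    rw [steklov, steklov]
    congr 1
    refine intervalIntegral.integral_congr fun x hx => hue ?_
    rw [uIcc_of_le (by linarith)] at hx
    exact ⟨hs.1.trans hx.1, by linarith [hx.2, hs.2]⟩
  have eW : ∀ s ∈ uIcc 0 t, steklov h we s = steklov h w s := by
    intro s hs
    rw [uIcc_of_le ht0] at hs
    rw [steklov, steklov]
    congr 1
    refine intervalIntegral.integral_congr fun x hx => hwe ?_
    rw [uIcc_of_le (by linarith)] at hx
    exact ⟨hs.1.trans hx.1, by linarith [hx.2, hs.2]⟩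
  have eK : ∀ s ∈ uIcc 0 t, κ (steklov h u s) = steklov h (fun x => κ (u x)) s := by
    intro s hs
    rw [uIcc_of_le ht0] at hs
    have hui : IntervalIntegrable u volume s (s + h) := by
      refine ContinuousOn.intervalIntegrable ?_
      rw [uIcc_of_le (by linarith)]
      exact hE.contU.mono (Icc_subset_Icc hs.1 (by linarith [hs.2]))
    rw [steklov, steklov, map_smul, κ.intervalIntegral_comp_comm hui]
  have eF : ∀ s ∈ uIcc 0 t, steklov h ((Ioc 0 T).indicator f) s = steklov h f s := by
    intro s hs
    rw [uIcc_of_le ht0] at hs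
    exact steklov_indicator f hs.1 hh (by linarith [hs.2])
  congr 1
  · congr 1
    · exact intervalIntegral.integral_congr fun s hs => by
        simp only [eU s hs, eK s hs, eF s hs]
    · exact intervalIntegral.integral_congr fun s hs => by simp only [eU s hs]
  · exact intervalIntegral.integral_congr fun s hs => by simp only [eW s hs]

end IsEvol

end

/-! ### Limits of weak evolutions -/

section

variable {V H Y : Type*} [NormedAddCommGroup V] [InnerProductSpace ℝ V] [CompleteSpace V]
  [NormedAddCommGroup H] [InnerProductSpace ℝ H] [CompleteSpace H]
  [NormedAddCommGroup Y] [InnerProductSpace ℝ Y] [CompleteSpace Y]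

theorem exists_tendstoUniformlyOn {T : ℝ} {F : ℕ → ℝ → V} {b : ℕ → ℝ}
    (hb : Tendsto b atTop (𝓝 0))
    (h : ∀ n m, ∀ t ∈ Icc 0 T, ‖F n t - F m t‖ ^ 2 ≤ b n + b m) :
    ∃ g, TendstoUniformlyOn F g atTop (Icc 0 T) := by
  have hc : UniformCauchySeqOn F atTop (Icc 0 T) := by
    rw [Metric.uniformCauchySeqOn_iff]
    intro ε hε
    obtain ⟨N, hN⟩ := (hb.eventually (gt_mem_nhds (show 0 < ε ^ 2 / 2 by positivity))).exists_forall_of_atTop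
    refine ⟨N, fun m hm n hn t ht => ?_⟩
    rw [dist_eq_norm]
    refine lt_of_pow_lt_pow_left₀ 2 hε.le ((h m n t ht).trans_lt ?_)
    linarith [hN m hm, hN n hn]
  have hl : ∀ t : ℝ, ∃ y, t ∈ Icc 0 T → Tendsto (fun n => F n t) atTop (𝓝 y) := by
    intro t
    by_cases ht : t ∈ Icc 0 T
    · obtain ⟨y, hy⟩ := cauchySeq_tendsto_of_complete (hc.cauchySeq ht)
      exact ⟨y, fun _ => hy⟩
    · exact ⟨0, fun h => absurd h ht⟩
  choose g hg using hl
  exact ⟨g, hc.tendstoUniformlyOn_of_tendsto fun t ht => hg t ht⟩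

theorem exists_tendsto_eLpNorm {α : Type*} [MeasurableSpace α] {μ : Measure α} {F : ℕ → α → Y}
    {b : ℕ → ℝ} (hF : ∀ n, MemLp (F n) 2 μ) (hb : Tendsto b atTop (𝓝 0))
    (h : ∀ n m, ∫ t, ‖F n t - F m t‖ ^ 2 ∂μ ≤ b n + b m) :
    ∃ g, MemLp g 2 μ ∧ Tendsto (fun n => eLpNorm (F n - g) 2 μ) atTop (𝓝 0) := by
  have hc : CauchySeq fun n => (hF n).toLp (F n) := by
    rw [Metric.cauchySeq_iff]
    intro ε hε
    obtain ⟨N, hN⟩ := (hb.eventually (gt_mem_nhds (show 0 < ε ^ 2 / 2 by positivity))).exists_forall_of_atTop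
    refine ⟨N, fun m hm n hn => ?_⟩
    rw [dist_eq_norm, ← MemLp.toLp_sub (hF m) (hF n)]
    refine lt_of_pow_lt_pow_left₀ 2 hε.le ?_
    rw [norm_toLp_sq]
    refine (h m n).trans_lt ?_
    linarith [hN m hm, hN n hn]
  obtain ⟨G, hG⟩ := cauchySeq_tendsto_of_complete hc
  refine ⟨G, Lp.memLp G, ?_⟩
  have := (Lp.tendsto_Lp_iff_tendsto_eLpNorm'' F hF G (Lp.memLp G)).1 (by rwa [Lp.toLp_coeFn])
  exact this

theorem tendsto_eLpNorm_of_tendstoUniformlyOn {T : ℝ} {F : ℕ → ℝ → V} {g : ℝ → V}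
    (h : TendstoUniformlyOn F g atTop (Icc 0 T)) :
    Tendsto (fun n => eLpNorm (F n - g) 2 (volume.restrict (Ioc 0 T))) atTop (𝓝 0) := by
  have hb : ∀ ε : ℝ, 0 < ε → ∀ᶠ n in atTop, eLpNorm (F n - g) 2 (volume.restrict (Ioc 0 T)) ≤
      volume.restrict (Ioc 0 T) univ ^ (2 : ℝ≥0∞).toReal⁻¹ * ENNReal.ofReal ε := by
    intro ε hε
    filter_upwards [(Metric.tendstoUniformlyOn_iff.1 h) ε hε] with n hn
    refine eLpNorm_le_of_ae_bound ?_
    filter_upwards [ae_restrict_mem measurableSet_Ioc] with x hx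
    have := hn x (Ioc_subset_Icc_self hx)
    rw [dist_comm, dist_eq_norm] at this
    exact this.le
  set C := volume.restrict (Ioc 0 T) (univ : Set ℝ) ^ (2 : ℝ≥0∞).toReal⁻¹ with hC
  have hCt : C ≠ ⊤ := ENNReal.rpow_ne_top_of_nonneg (by positivity) (by simp)
  have h0 : Tendsto (fun ε : ℝ => C * ENNReal.ofReal ε) (𝓝[>] 0) (𝓝 0) := by
    have h1 : Tendsto (fun ε : ℝ => ENNReal.ofReal ε) (𝓝[>] 0) (𝓝 0) := by
      have := (ENNReal.continuous_ofReal.tendsto 0).mono_left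
        (nhdsWithin_le_nhds (a := (0 : ℝ)) (s := Ioi 0))
      simpa using this
    have := ENNReal.Tendsto.const_mul (a := C) h1 (Or.inr hCt)
    simpa using this
  rw [ENNReal.tendsto_nhds_zero]
  intro δ hδ
  obtain ⟨ε, hε, hε0⟩ := (((ENNReal.tendsto_nhds_zero.1 h0) δ hδ).and self_mem_nhdsWithin).exists
  exact (hb ε hε0).mono fun n hn => hn.trans hε

theorem tendsto_interval_integral_inner_const {T t : ℝ} (h0 : 0 ≤ t) (ht : t ≤ T) {F : ℕ → ℝ → V}
    {g : ℝ → V} (hF : ∀ n, MemLp (F n) 2 (volume.restrict (Ioc 0 T)))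
    (hg : MemLp g 2 (volume.restrict (Ioc 0 T)))
    (h : Tendsto (fun n => eLpNorm (F n - g) 2 (volume.restrict (Ioc 0 T))) atTop (𝓝 0)) (v : V) :
    Tendsto (fun n => ∫ s in (0 : ℝ)..t, inner ℝ (F n s) v) atTop
      (𝓝 (∫ s in (0 : ℝ)..t, inner ℝ (g s) v)) := by
  have hr : volume.restrict (Ioc 0 t) ≤ volume.restrict (Ioc 0 T) :=
    Measure.restrict_mono (Ioc_subset_Ioc_right ht) le_rfl
  have := tendsto_integral_inner (μ := volume.restrict (Ioc 0 t)) (F := F) (G := fun _ _ => v)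
    (f := g) (g := fun _ => v) (l := atTop)
    (Eventually.of_forall fun n => (hF n).mono_measure hr)
    (Eventually.of_forall fun n => memLp_const v) (hg.mono_measure hr) (memLp_const v)
    (tendsto_of_tendsto_of_tendsto_of_le_of_le tendsto_const_nhds h (fun _ => zero_le)
      (fun _ => eLpNorm_mono_measure _ hr)) (by simp)
  simpa only [intervalIntegral.integral_of_le h0] using this

theorem intervalIntegrable_inner_const {T t : ℝ} (h0 : 0 ≤ t) (ht : t ≤ T) {g : ℝ → V}
    (hg : MemLp g 2 (volume.restrict (Ioc 0 T))) (v : V) :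
    IntervalIntegrable (fun s => inner ℝ (g s) v) volume 0 t := by
  rw [intervalIntegrable_iff_integrableOn_Ioc_of_le h0]
  exact integrable_inner_of_memLp (hg.mono_measure
    (Measure.restrict_mono (Ioc_subset_Ioc_right ht) le_rfl)) (memLp_const v)

theorem norm_sub_sq_le (x y z : V) : ‖x - y‖ ^ 2 ≤ 2 * ‖x - z‖ ^ 2 + 2 * ‖y - z‖ ^ 2 := by
  have h1 : ‖x - y‖ ≤ ‖x - z‖ + ‖y - z‖ := by
    rw [norm_sub_rev y z]; exact norm_sub_le_norm_sub_add_norm_sub x z y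
  have h2 := norm_nonneg (x - y)
  nlinarith [sq_nonneg (‖x - z‖ - ‖y - z‖)]

theorem inner_intervalIntegral {T t : ℝ} (h0 : 0 ≤ t) (ht : t ≤ T) {g : ℝ → V}
    (hg : MemLp g 2 (volume.restrict (Ioc 0 T))) (v : V) :
    inner ℝ (∫ s in (0 : ℝ)..t, g s) v = ∫ s in (0 : ℝ)..t, inner ℝ (g s) v := by
  have h1 := MemLp.intervalIntegrable_of_le hg le_rfl h0 ht
  rw [intervalIntegrable_iff_integrableOn_Ioc_of_le h0] at h1
  rw [intervalIntegral.integral_of_le h0, intervalIntegral.integral_of_le h0, real_inner_comm,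
    ← integral_inner h1]
  simp only [real_inner_comm]

namespace IsEvol

variable {κ : V →L[ℝ] Y} {π : Y →L[ℝ] H} {T : ℝ} {f : ℝ → Y} {u : ℝ → V} {w : ℝ → H} {y : ℝ → Y}

/-- Two approximating sequences for u and two for w are allowed, because in the Yosida scheme the
elliptic term and the relation π y = w hold at the resolvent point x + εAx rather than at x. Each
pair has the same uniform limit. -/
theorem of_tendsto {us vs : ℕ → ℝ → V} {ws xs : ℕ → ℝ → H} {ys fs : ℕ → ℝ → Y}
    (cv : ∀ n, ContinuousOn (vs n) (Icc 0 T))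
    (hu : TendstoUniformlyOn us u atTop (Icc 0 T)) (hv : TendstoUniformlyOn vs u atTop (Icc 0 T))
    (hw : TendstoUniformlyOn ws w atTop (Icc 0 T)) (hx : TendstoUniformlyOn xs w atTop (Icc 0 T))
    (cu : ContinuousOn u (Icc 0 T)) (cw : ContinuousOn w (Icc 0 T))
    (my : MemLp y 2 (volume.restrict (Ioc 0 T))) (mf : MemLp f 2 (volume.restrict (Ioc 0 T)))
    (mys : ∀ n, MemLp (ys n) 2 (volume.restrict (Ioc 0 T)))
    (mfs : ∀ n, MemLp (fs n) 2 (volume.restrict (Ioc 0 T)))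
    (ly : Tendsto (fun n => eLpNorm (ys n - y) 2 (volume.restrict (Ioc 0 T))) atTop (𝓝 0))
    (lf : Tendsto (fun n => eLpNorm (fs n - f) 2 (volume.restrict (Ioc 0 T))) atTop (𝓝 0))
    (hπ : ∀ n, ∀ᵐ t ∂(volume.restrict (Ioc 0 T)), π (ys n t) = xs n t)
    (eU : ∀ n, ∀ t ∈ Icc 0 T, κ (us n t) = κ (us n 0) + ∫ s in (0 : ℝ)..t, ys n s)
    (eW : ∀ n, ∀ t ∈ Icc 0 T, ∀ v : V, inner ℝ (ws n t) (π (κ v)) = inner ℝ (ws n 0) (π (κ v)) +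
      ∫ s in (0 : ℝ)..t, (inner ℝ (fs n s) (κ v) - inner ℝ (vs n s) v)) :
    IsEvol κ π T f u w y := by
  refine ⟨cu, cw, my, mf, ?_, ?_, ?_⟩
  · have m1 : AEStronglyMeasurable (fun t => π (y t) - w t) (volume.restrict (Ioc 0 T)) :=
      (π.continuous.comp_aestronglyMeasurable my.1).sub (ContinuousOn.memLp_two cw).1
    have hz : eLpNorm (fun t => π (y t) - w t) 2 (volume.restrict (Ioc 0 T)) = 0 := by
      have hle : ∀ n, eLpNorm (fun t => π (y t) - w t) 2 (volume.restrict (Ioc 0 T)) ≤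
          ENNReal.ofReal ‖π‖ * eLpNorm (ys n - y) 2 (volume.restrict (Ioc 0 T)) +
            eLpNorm (xs n - w) 2 (volume.restrict (Ioc 0 T)) := by
        intro n
        have e1 : eLpNorm (fun t => π (y t) - w t) 2 (volume.restrict (Ioc 0 T)) =
            eLpNorm ((fun t => π (y t) - π (ys n t)) + fun t => π (ys n t) - w t) 2
              (volume.restrict (Ioc 0 T)) := by
          congr 1; funext t; simp
        have e2 : eLpNorm (fun t => π (ys n t) - w t) 2 (volume.restrict (Ioc 0 T)) =
            eLpNorm (xs n - w) 2 (volume.restrict (Ioc 0 T)) := by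
          refine eLpNorm_congr_ae ?_
          filter_upwards [hπ n] with t ht
          simp [ht]
        rw [e1, ← e2]
        refine (eLpNorm_add_le ?_ ?_ (by norm_num)).trans (add_le_add ?_ le_rfl)
        · exact (π.continuous.comp_aestronglyMeasurable my.1).sub
            (π.continuous.comp_aestronglyMeasurable (mys n).1)
        · exact (π.continuous.comp_aestronglyMeasurable (mys n).1).sub
            (ContinuousOn.memLp_two cw).1
        · refine eLpNorm_le_mul_eLpNorm_of_ae_le_mul (Eventually.of_forall fun t => ?_) _
          rw [← map_sub, Pi.sub_apply, norm_sub_rev (ys n t)]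
          exact π.le_opNorm _
      have ht := (ENNReal.Tendsto.const_mul (a := ENNReal.ofReal ‖π‖) ly
        (Or.inr ENNReal.ofReal_ne_top)).add (tendsto_eLpNorm_of_tendstoUniformlyOn hx)
      rw [mul_zero, add_zero] at ht
      exact le_antisymm (ge_of_tendsto' ht hle) zero_le
    rw [eLpNorm_eq_zero_iff m1 (by norm_num)] at hz
    filter_upwards [hz] with t ht
    exact sub_eq_zero.1 ht
  · intro t ht
    refine ext_inner_right ℝ fun e => ?_
    have h0 : (0 : ℝ) ∈ Icc 0 T := ⟨le_rfl, ht.1.trans ht.2⟩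
    have l1 := ((κ.continuous.tendsto _).comp (hu.tendsto_at ht)).inner (𝕜 := ℝ)
      (tendsto_const_nhds (x := e))
    have l2 := ((κ.continuous.tendsto _).comp (hu.tendsto_at h0)).inner (𝕜 := ℝ)
      (tendsto_const_nhds (x := e))
    have l3 := l2.add (tendsto_interval_integral_inner_const ht.1 ht.2 mys my ly e)
    rw [inner_add_left, inner_intervalIntegral ht.1 ht.2 my]
    refine tendsto_nhds_unique (l1.congr fun n => ?_) l3
    simp only [Function.comp_apply]
    rw [eU n t ht, inner_add_left, inner_intervalIntegral ht.1 ht.2 (mys n)]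
  · intro t ht v
    have h0 : (0 : ℝ) ∈ Icc 0 T := ⟨le_rfl, ht.1.trans ht.2⟩
    have mu := ContinuousOn.memLp_two cu
    have mv := fun n => ContinuousOn.memLp_two (cv n)
    have l1 := (hw.tendsto_at ht).inner (𝕜 := ℝ) (tendsto_const_nhds (x := π (κ v)))
    have l2 := (hw.tendsto_at h0).inner (𝕜 := ℝ) (tendsto_const_nhds (x := π (κ v)))
    have l3 := tendsto_interval_integral_inner_const ht.1 ht.2 mfs mf lf (κ v)
    have l4 := tendsto_interval_integral_inner_const ht.1 ht.2 mv mu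
      (tendsto_eLpNorm_of_tendstoUniformlyOn hv) v
    have ii := fun {g} h => intervalIntegrable_inner_const (V := Y) (g := g) ht.1 ht.2 h (κ v)
    have jj := fun {g} h => intervalIntegrable_inner_const (V := V) (g := g) ht.1 ht.2 h v
    rw [intervalIntegral.integral_sub (ii mf) (jj mu)]
    refine tendsto_nhds_unique (l1.congr fun n => ?_) (l2.add (l3.sub l4))
    rw [eW n t ht v, intervalIntegral.integral_sub (ii (mfs n)) (jj (mv n))]

/-- The energy estimate for damped evolutions. -/
theorem energy_estimate {D : Y →L[ℝ] Y} {c : ℝ} (hc : 0 < c)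
    (hD : ∀ y, c * ‖y‖ ^ 2 ≤ inner ℝ (D y) y)
    (hE : IsEvol κ π T (fun t => f t - D (y t)) u w y) : ∀ t ∈ Icc 0 T,
    ‖u t‖ ^ 2 + ‖w t‖ ^ 2 + c * ∫ s in (0 : ℝ)..t, ‖y s‖ ^ 2 ≤ ‖u 0‖ ^ 2 + ‖w 0‖ ^ 2 +
      c⁻¹ * ∫ s in (0 : ℝ)..t, ‖f s‖ ^ 2 := by
  intro t ht
  have mf : MemLp f 2 (volume.restrict (Ioc 0 T)) := by
    have := hE.memF.add (D.comp_memLp' hE.memY)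
    refine this.ae_eq (Eventually.of_forall fun s => ?_)
    simp
  have hr : volume.restrict (Ioc 0 t) ≤ volume.restrict (Ioc 0 T) :=
    Measure.restrict_mono (Ioc_subset_Ioc_right ht.2) le_rfl
  have iy : IntervalIntegrable (fun s => ‖y s‖ ^ 2) volume 0 t := by
    rw [intervalIntegrable_iff_integrableOn_Ioc_of_le ht.1]
    exact (hE.memY.mono_measure hr).integrable_norm_pow (by norm_num)
  have if' : IntervalIntegrable (fun s => ‖f s‖ ^ 2) volume 0 t := by
    rw [intervalIntegrable_iff_integrableOn_Ioc_of_le ht.1]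
    exact (mf.mono_measure hr).integrable_norm_pow (by norm_num)
  have ie : IntervalIntegrable (fun s => inner ℝ (f s - D (y s)) (y s)) volume 0 t := by
    rw [intervalIntegrable_iff_integrableOn_Ioc_of_le ht.1]
    exact integrable_inner_of_memLp (hE.memF.mono_measure hr) (hE.memY.mono_measure hr)
  have h1 : ∫ s in (0 : ℝ)..t, inner ℝ (f s - D (y s)) (y s) ≤
      ∫ s in (0 : ℝ)..t, (c⁻¹ / 2 * ‖f s‖ ^ 2 - c / 2 * ‖y s‖ ^ 2) := by
    refine intervalIntegral.integral_mono_on ht.1 ie ((if'.const_mul _).sub (iy.const_mul _))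
      fun s _ => ?_
    rw [inner_sub_left]
    have e1 := real_inner_le_norm (f s) (y s)
    have e2 := hD (y s)
    -- Young's inequality with this weight uses half of the dissipation c‖y‖² and leaves the other
    -- half on the left.
    have e3 : ‖f s‖ * ‖y s‖ ≤ c⁻¹ / 2 * ‖f s‖ ^ 2 + c / 2 * ‖y s‖ ^ 2 := by
      have : c⁻¹ / 2 * ‖f s‖ ^ 2 + c / 2 * ‖y s‖ ^ 2 - ‖f s‖ * ‖y s‖ =
          c⁻¹ / 2 * (‖f s‖ - c * ‖y s‖) ^ 2 := by field_simp; ring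
      have h2 : 0 ≤ c⁻¹ / 2 * (‖f s‖ - c * ‖y s‖) ^ 2 := by positivity
      linarith
    linarith
  rw [intervalIntegral.integral_sub (if'.const_mul _) (iy.const_mul _),
    intervalIntegral.integral_const_mul, intervalIntegral.integral_const_mul] at h1
  have h2 := hE.energy_identity t ht
  linarith

end IsEvol

/-- Solvability on `[0, T]` of the damped linear problem with source `f` and initial data `(a, b)`. -/
def Solvable (κ : V →L[ℝ] Y) (π : Y →L[ℝ] H) (D : Y →L[ℝ] Y) (T : ℝ) (f : ℝ → Y) (a : V) (b : H) :
    Prop :=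
  ∃ u w y, IsEvol κ π T (fun t => f t - D (y t)) u w y ∧ u 0 = a ∧ w 0 = b

/-- Differences of solutions are solutions, so the energy estimate makes the approximations Cauchy:
u and w uniformly in time, y in L². The limit of the equations is then immediate. -/
theorem Solvable.of_tendsto {κ : V →L[ℝ] Y} {π : Y →L[ℝ] H} {D : Y →L[ℝ] Y} {c T : ℝ} (hT : 0 ≤ T)
    (hc : 0 < c) (hD : ∀ y, c * ‖y‖ ^ 2 ≤ inner ℝ (D y) y) {fs : ℕ → ℝ → Y} {f : ℝ → Y}
    {as : ℕ → V} {a : V} {bs : ℕ → H} {b : H} (h : ∀ n, Solvable κ π D T (fs n) (as n) (bs n))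
    (ha : Tendsto as atTop (𝓝 a)) (hb : Tendsto bs atTop (𝓝 b))
    (mfs : ∀ n, MemLp (fs n) 2 (volume.restrict (Ioc 0 T)))
    (mf : MemLp f 2 (volume.restrict (Ioc 0 T)))
    (hf : Tendsto (fun n => eLpNorm (fs n - f) 2 (volume.restrict (Ioc 0 T))) atTop (𝓝 0)) :
    Solvable κ π D T f a b := by
  choose us ws ys hE hu0 hw0 using h
  have hF := (Lp.tendsto_Lp_iff_tendsto_eLpNorm'' fs mfs f mf).2 hf
  set Fs := fun n => (mfs n).toLp (fs n) with hFs
  set F := mf.toLp f with hFdef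
  let β : ℕ → ℝ := fun n => 2 * ‖as n - a‖ ^ 2 + 2 * ‖bs n - b‖ ^ 2 + c⁻¹ * (2 * ‖Fs n - F‖ ^ 2)
  have hβ0 : ∀ n, 0 ≤ β n := fun n => by positivity
  have hβ : Tendsto β atTop (𝓝 0) := by
    have h1 := (tendsto_iff_norm_sub_tendsto_zero.1 ha).pow 2
    have h2 := (tendsto_iff_norm_sub_tendsto_zero.1 hb).pow 2
    have h3 := (tendsto_iff_norm_sub_tendsto_zero.1 hF).pow 2
    have := ((h1.const_mul 2).add (h2.const_mul 2)).add ((h3.const_mul 2).const_mul c⁻¹)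
    simpa using this
  have est : ∀ n m, ∀ t ∈ Icc 0 T, ‖us n t - us m t‖ ^ 2 + ‖ws n t - ws m t‖ ^ 2 +
      c * ∫ s in (0 : ℝ)..t, ‖ys n s - ys m s‖ ^ 2 ≤ β n + β m := by
    intro n m t ht
    have hd : IsEvol κ π T (fun t => (fs n t - fs m t) - D (ys n t - ys m t))
        (fun t => us n t - us m t) (fun t => ws n t - ws m t) (fun t => ys n t - ys m t) := by
      convert (hE n).sub (hE m) using 2 with t
      rw [map_sub]; abel
    refine (hd.energy_estimate hc hD t ht).trans ?_
    simp only [hu0, hw0]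
    have e1 : ∫ s in (0 : ℝ)..t, ‖fs n s - fs m s‖ ^ 2 ≤ ‖Fs n - Fs m‖ ^ 2 := by
      rw [hFs]
      simp only
      rw [← MemLp.toLp_sub (mfs n) (mfs m), norm_toLp_sq, intervalIntegral.integral_of_le ht.1]
      refine setIntegral_mono_set (((mfs n).sub (mfs m)).integrable_norm_pow (by norm_num))
        (Eventually.of_forall fun s => by positivity) ?_
      exact (Ioc_subset_Ioc_right ht.2).eventuallyLE
    have e2 := norm_sub_sq_le (as n) (as m) a
    have e3 := norm_sub_sq_le (bs n) (bs m) b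
    have e4 := norm_sub_sq_le (Fs n) (Fs m) F
    have e5 : c⁻¹ * ∫ s in (0 : ℝ)..t, ‖fs n s - fs m s‖ ^ 2 ≤
        c⁻¹ * (2 * ‖Fs n - F‖ ^ 2 + 2 * ‖Fs m - F‖ ^ 2) := by
      have := e1.trans e4
      gcongr
    simp only [β]
    linarith
  have yn : ∀ n m t, 0 ≤ t → 0 ≤ c * ∫ s in (0 : ℝ)..t, ‖ys n s - ys m s‖ ^ 2 := fun n m t ht =>
    mul_nonneg hc.le (intervalIntegral.integral_nonneg ht fun s _ => by positivity)
  obtain ⟨u, hu⟩ := exists_tendstoUniformlyOn (F := us) hβ fun n m t ht => by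
    nlinarith [est n m t ht, yn n m t ht.1, sq_nonneg ‖ws n t - ws m t‖]
  obtain ⟨w, hw⟩ := exists_tendstoUniformlyOn (F := ws) hβ fun n m t ht => by
    nlinarith [est n m t ht, yn n m t ht.1, sq_nonneg ‖us n t - us m t‖]
  have hβ' : Tendsto (fun n => c⁻¹ * β n) atTop (𝓝 0) := by simpa using hβ.const_mul c⁻¹
  obtain ⟨y, my, hy⟩ := exists_tendsto_eLpNorm (fun n => (hE n).memY) hβ' fun n m => by
    have h1 := est n m T ⟨hT, le_rfl⟩
    rw [intervalIntegral.integral_of_le hT] at h1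
    rw [← mul_add, le_inv_mul_iff₀ hc]
    nlinarith [sq_nonneg ‖us n T - us m T‖, sq_nonneg ‖ws n T - ws m T‖]
  have h0 : (0 : ℝ) ∈ Icc 0 T := ⟨le_rfl, hT⟩
  refine ⟨u, w, y, ?_, ?_, ?_⟩
  · refine IsEvol.of_tendsto (us := us) (vs := us) (ws := ws) (xs := ws) (ys := ys)
      (fs := fun n t => fs n t - D (ys n t)) (fun n => (hE n).contU) hu hu hw hw
      (hu.continuousOn (Frequently.of_forall fun n => (hE n).contU))
      (hw.continuousOn (Frequently.of_forall fun n => (hE n).contW)) my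
      (mf.sub (D.comp_memLp' my)) (fun n => (hE n).memY) (fun n => (hE n).memF) hy ?_
      (fun n => (hE n).pi_y) (fun n => (hE n).eqU) (fun n => (hE n).eqW)
    have ht := hf.add (ENNReal.Tendsto.const_mul (a := ENNReal.ofReal ‖D‖) hy
        (Or.inr ENNReal.ofReal_ne_top))
    rw [mul_zero, add_zero] at ht
    refine tendsto_of_tendsto_of_tendsto_of_le_of_le tendsto_const_nhds ht (fun _ => zero_le)
      fun n => ?_
    have e1 : ((fun t => fs n t - D (ys n t)) - fun t => f t - D (y t)) =
        (fs n - f) - fun t => D (ys n t) - D (y t) := by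
      funext t; simp only [Pi.sub_apply]; abel
    simp only
    rw [e1]
    refine (eLpNorm_sub_le ((mfs n).sub mf).1
      ((D.comp_memLp' (hE n).memY).sub (D.comp_memLp' my)).1 (by norm_num)).trans
      (add_le_add le_rfl ?_)
    refine eLpNorm_le_mul_eLpNorm_of_ae_le_mul (Eventually.of_forall fun t => ?_) _
    simp only [Pi.sub_apply, Function.comp_apply, ← map_sub]
    exact D.le_opNorm _
  · exact tendsto_nhds_unique (hu.tendsto_at h0) (by simpa only [hu0] using ha)
  · exact tendsto_nhds_unique (hw.tendsto_at h0) (by simpa only [hw0] using hb)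

end

/-! ### The homogeneous damped problem: Yosida approximation -/

section

variable {V H Y : Type*} [NormedAddCommGroup V] [InnerProductSpace ℝ V] [CompleteSpace V]
  [NormedAddCommGroup H] [InnerProductSpace ℝ H] [CompleteSpace H]
  [NormedAddCommGroup Y] [InnerProductSpace ℝ Y] [CompleteSpace Y]
  {X : Type*} [NormedAddCommGroup X] [InnerProductSpace ℝ X] [CompleteSpace X]

/-- A linear flow with dissipative bounded generator. -/
theorem exists_flow (A : X →L[ℝ] X) (hA : ∀ x, inner ℝ (A x) x ≤ 0) (z : X) :
    ∃ x : ℝ → X, x 0 = z ∧ (∀ t, HasDerivAt x (A (x t)) t) ∧ ∀ t, 0 ≤ t → ‖A (x t)‖ ≤ ‖A z‖ := by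
  have hd : ∀ z t, HasDerivAt (fun t : ℝ => NormedSpace.exp (t • A) z)
      (A (NormedSpace.exp (t • A) z)) t := fun z t =>
    ((ContinuousLinearMap.apply ℝ X z).hasFDerivAt).comp_hasDerivAt t
      (hasDerivAt_exp_smul_const' (𝕂 := ℝ) A t)
  refine ⟨fun t => NormedSpace.exp (t • A) z, by simp, hd z, fun t ht => ?_⟩
  -- The generator commutes with its flow, so the speed A x(t) is itself a trajectory; dissipativity
  -- makes its norm nonincreasing.
  have hcomm : A (NormedSpace.exp (t • A) z) = NormedSpace.exp (t • A) (A z) := by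
    have h : Commute A (NormedSpace.exp (t • A)) := ((Commute.refl A).smul_right t).exp_right
    exact congrArg (fun B : X →L[ℝ] X => B z) h.eq
  have hn := fun t => (hd (A z) t).norm_sq
  have hanti : Antitone fun t : ℝ => ‖NormedSpace.exp (t • A) (A z)‖ ^ 2 := by
    refine antitone_of_deriv_nonpos (fun t => (hn t).differentiableAt) fun t => ?_
    rw [(hn t).deriv, real_inner_comm]
    linarith [hA (NormedSpace.exp (t • A) (A z))]
  have h := hanti ht
  simp only [zero_smul, NormedSpace.exp_zero, one_apply_eq_self] at h
  rw [hcomm]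
  exact le_of_sq_le_sq h (norm_nonneg _)

/-- The graph of the generator of the damped evolution: `a = (v, m)` is the image of `z = (u, ι v)`
if `⟪m, ι φ⟫ = - ⟪u, φ⟫ - ⟪D κ v, κ φ⟫` for all `φ`. -/
def GenGraph (e : X ≃L[ℝ] V × H) (κ : V →L[ℝ] Y) (π : Y →L[ℝ] H) (D : Y →L[ℝ] Y) (z a : X) : Prop :=
  π (κ (e a).1) = (e z).2 ∧
    ∀ φ : V, inner ℝ (e a).2 (π (κ φ)) = - inner ℝ (e z).1 φ - inner ℝ (D (κ (e a).1)) (κ φ)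

namespace GenGraph

variable {e : X ≃L[ℝ] V × H} {κ : V →L[ℝ] Y} {π : Y →L[ℝ] H} {D : Y →L[ℝ] Y} {c : ℝ}

theorem sub {z a z' a' : X} (h : GenGraph e κ π D z a) (h' : GenGraph e κ π D z' a') :
    GenGraph e κ π D (z - z') (a - a') := by
  refine ⟨?_, fun φ => ?_⟩
  · simp only [map_sub, Prod.fst_sub, Prod.snd_sub, h.1, h'.1]
  · simp only [map_sub, Prod.fst_sub, Prod.snd_sub, inner_sub_left, h.2, h'.2]
    ring

theorem add {z a z' a' : X} (h : GenGraph e κ π D z a) (h' : GenGraph e κ π D z' a') :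
    GenGraph e κ π D (z + z') (a + a') := by
  refine ⟨?_, fun φ => ?_⟩
  · simp only [map_add, Prod.fst_add, Prod.snd_add, h.1, h'.1]
  · simp only [map_add, Prod.fst_add, Prod.snd_add, inner_add_left, h.2, h'.2]
    ring

theorem smul {z a : X} (r : ℝ) (h : GenGraph e κ π D z a) : GenGraph e κ π D (r • z) (r • a) := by
  refine ⟨?_, fun φ => ?_⟩
  · simp only [map_smul, Prod.smul_fst, Prod.smul_snd, h.1]
  · simp only [map_smul, Prod.smul_fst, Prod.smul_snd, real_inner_smul_left, h.2]
    ring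

/-- Testing the defining relation with the first component of a cancels the skew coupling between
position and velocity, and only the damping remains. -/
theorem dissipative (he : ∀ x y, inner ℝ x y = inner ℝ (e x).1 (e y).1 + inner ℝ (e x).2 (e y).2)
    (hD : ∀ y, c * ‖y‖ ^ 2 ≤ inner ℝ (D y) y) {z a : X}
    (h : GenGraph e κ π D z a) : inner ℝ a z ≤ - (c * ‖κ (e a).1‖ ^ 2) := by
  have h1 := h.2 (e a).1
  rw [h.1] at h1
  rw [he, h1, real_inner_comm (e z).1]
  linarith [hD (κ (e a).1)]

end GenGraph

variable (e : X ≃L[ℝ] V × H) (κ : V →L[ℝ] Y) (π : Y →L[ℝ] H) (D : Y →L[ℝ] Y)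

/-- A x is the generator evaluated at the resolvent point x + εAx. Writing A x = (v, m) and
eliminating m through εm = ιv − x₂ leaves ⟨ιv, ιφ⟩ + ε²⟨v, φ⟩ + ε⟨Dκv, κφ⟩ = ⟨x₂, ιφ⟩ − ε⟨x₁, φ⟩.
This form is coercive with constant ε², so the Lax–Milgram theorem applies. -/
theorem exists_yosida {c : ℝ} (hc : 0 < c) (hD : ∀ y, c * ‖y‖ ^ 2 ≤ inner ℝ (D y) y) {ε : ℝ}
    (hε : 0 < ε) : ∃ A : X →L[ℝ] X,
      ∀ x, GenGraph e κ π D (x + ε • A x) (A x) := by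
  let ι : V →L[ℝ] H := π.comp κ
  let S : V →L[ℝ] V := ι.adjoint.comp ι + (ε ^ 2) • ContinuousLinearMap.id ℝ V +
    ε • (κ.adjoint.comp (D.comp κ))
  have hS : ∀ v φ, inner ℝ (S v) φ = inner ℝ (ι v) (ι φ) + ε ^ 2 * inner ℝ v φ +
      ε * inner ℝ (D (κ v)) (κ φ) := by
    intro v φ
    simp only [S, add_apply, smul_apply,
      ContinuousLinearMap.comp_apply, ContinuousLinearMap.id_apply, inner_add_left,
      real_inner_smul_left, ContinuousLinearMap.adjoint_inner_left]
  let B : V →L[ℝ] V →L[ℝ] ℝ := (innerSL ℝ).comp S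
  have hB : ∀ v φ, B v φ = inner ℝ (S v) φ := fun v φ => rfl
  have hco : IsCoercive B := by
    refine ⟨ε ^ 2, by positivity, fun v => ?_⟩
    rw [hB, hS, real_inner_self_eq_norm_sq, real_inner_self_eq_norm_sq]
    have h1 : 0 ≤ ε * inner ℝ (D (κ v)) (κ v) :=
      mul_nonneg hε.le (le_trans (by positivity) (hD (κ v)))
    nlinarith [sq_nonneg ‖ι v‖]
  let G := hco.continuousLinearEquivOfBilin.symm
  have hG : ∀ x φ, inner ℝ (S (G x)) φ = inner ℝ x φ := by
    intro x φ
    rw [← hB, ← hco.continuousLinearEquivOfBilin_apply]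
    simp [G]
  let q1 : X →L[ℝ] V := (ContinuousLinearMap.fst ℝ V H).comp e.toContinuousLinearMap
  let q2 : X →L[ℝ] H := (ContinuousLinearMap.snd ℝ V H).comp e.toContinuousLinearMap
  let v : X →L[ℝ] V :=
    G.toContinuousLinearMap.comp (ι.adjoint.comp q2 - ε • q1)
  let m : X →L[ℝ] H := ε⁻¹ • (ι.comp v - q2)
  refine ⟨e.symm.toContinuousLinearMap.comp (v.prod m), fun x => ?_⟩
  set a := (e.symm.toContinuousLinearMap.comp (v.prod m)) x with ha
  have a1 : (e a).1 = v x := by simp [ha]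
  have a2 : (e a).2 = m x := by simp [ha]
  have am : ε • m x = ι (v x) - (e x).2 := by
    have : m x = ε⁻¹ • (ι (v x) - (e x).2) := rfl
    rw [this, smul_smul, mul_inv_cancel₀ hε.ne', one_smul]
  refine ⟨?_, fun φ => ?_⟩
  · rw [map_add, map_smul, Prod.snd_add, Prod.smul_snd, a1, a2, am]
    simp [ι]
  · have h1 := hG (ι.adjoint (e x).2 - ε • (e x).1) φ
    have h2 : G (ι.adjoint (e x).2 - ε • (e x).1) = v x := rfl
    rw [h2, hS, inner_sub_left, ContinuousLinearMap.adjoint_inner_left, real_inner_smul_left] at h1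
    have h3 : ε * inner ℝ (m x) (ι φ) = inner ℝ (ι (v x)) (ι φ) - inner ℝ (e x).2 (ι φ) := by
      rw [← real_inner_smul_left, am, inner_sub_left]
    have h4 : π (κ φ) = ι φ := rfl
    rw [map_add, map_smul, Prod.fst_add, Prod.smul_fst, a1, a2, h4, inner_add_left, real_inner_smul_left]
    refine mul_left_cancel₀ hε.ne' ?_
    linarith

/-! ### Estimates along the Yosida trajectories, uniform in the regularization parameter. -/

section Trajectory

variable {e κ π D}
variable {A : X →L[ℝ] X}

theorem inner_yosida_nonpos {ε c : ℝ} (he : ∀ x y, inner ℝ x y = inner ℝ (e x).1 (e y).1 + inner ℝ (e x).2 (e y).2)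
    (hε : 0 < ε) (hc : 0 < c) (hD : ∀ y, c * ‖y‖ ^ 2 ≤ inner ℝ (D y) y)
    (hA : ∀ x, GenGraph e κ π D (x + ε • A x) (A x)) (z : X) : inner ℝ (A z) z ≤ 0 := by
  have h1 := (hA z).dissipative he hD
  rw [inner_add_right, real_inner_smul_right, real_inner_self_eq_norm_sq] at h1
  have h2 : 0 ≤ ε * ‖A z‖ ^ 2 := by positivity
  have h3 : 0 ≤ c * ‖κ (e (A z)).1‖ ^ 2 := by positivity
  linarith

/-- Subtracting the graph pairs (z, a) and (z + εAz, Az) leaves −εAz in the first slot, so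
dissipativity reads ⟨a − Az, Az⟩ ≥ 0. Hence on the domain the regularized speed is bounded
independently of ε. -/
theorem norm_yosida_le (he : ∀ x y, inner ℝ x y = inner ℝ (e x).1 (e y).1 + inner ℝ (e x).2 (e y).2)
    {ε c : ℝ} (hε : 0 < ε) (hc : 0 < c)
    (hD : ∀ y, c * ‖y‖ ^ 2 ≤ inner ℝ (D y) y)
    (hA : ∀ x, GenGraph e κ π D (x + ε • A x) (A x)) {z a : X}
    (h : GenGraph e κ π D z a) : ‖A z‖ ≤ ‖a‖ := by
  have h1 := (h.sub (hA z)).dissipative he hD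
  rw [sub_add_cancel_left, inner_neg_right, real_inner_smul_right, inner_sub_left,
    real_inner_self_eq_norm_sq] at h1
  have h3 : 0 ≤ c * ‖κ (e (a - A z)).1‖ ^ 2 := by positivity
  have h4 : 0 ≤ inner ℝ a (A z) - ‖A z‖ ^ 2 := by
    have : 0 ≤ ε * (inner ℝ a (A z) - ‖A z‖ ^ 2) := by linarith
    exact nonneg_of_mul_nonneg_right this hε
  have h5 := real_inner_le_norm a (A z)
  by_contra hlt
  push Not at hlt
  have h6 := norm_nonneg a
  nlinarith

/-- Dissipativity applies to the resolvent points, which differ from the trajectories by εAx and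
ε'A'x'. This mismatch costs at most (2K)·(ε + ε')K in the inner product, and the coercivity of D
also controls the difference of the velocities. -/
theorem yosida_difference (he : ∀ x y, inner ℝ x y = inner ℝ (e x).1 (e y).1 + inner ℝ (e x).2 (e y).2)
    {A' : X →L[ℝ] X} {ε ε' c : ℝ} (hε : 0 < ε)
    (hε' : 0 < ε') (hD : ∀ y, c * ‖y‖ ^ 2 ≤ inner ℝ (D y) y)
    (hA : ∀ x, GenGraph e κ π D (x + ε • A x) (A x)) (hA' : ∀ x, GenGraph e κ π D (x + ε' • A' x) (A' x))
    {x x' : ℝ → X} (h0 : x 0 = x' 0) (dx : ∀ t, HasDerivAt x (A (x t)) t)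
    (dx' : ∀ t, HasDerivAt x' (A' (x' t)) t) {K : ℝ} (bx : ∀ t, 0 ≤ t → ‖A (x t)‖ ≤ K)
    (bx' : ∀ t, 0 ≤ t → ‖A' (x' t)‖ ≤ K) {t : ℝ} (ht : 0 ≤ t) :
    ‖x t - x' t‖ ^ 2 + 2 * c * ∫ s in (0 : ℝ)..t, ‖κ (e (A (x s))).1 - κ (e (A' (x' s))).1‖ ^ 2 ≤
      4 * K ^ 2 * (ε + ε') * t := by
  have hK : 0 ≤ K := (norm_nonneg _).trans (bx 0 le_rfl)
  have cx : Continuous x := continuous_iff_continuousAt.2 fun t => (dx t).continuousAt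
  have cx' : Continuous x' := continuous_iff_continuousAt.2 fun t => (dx' t).continuousAt
  have dd := fun t => ((dx t).sub (dx' t)).norm_sq
  have cd : Continuous fun s => 2 * inner ℝ (x s - x' s) (A (x s) - A' (x' s)) := by
    exact continuous_const.mul ((cx.sub cx').inner
      ((A.continuous.comp cx).sub (A'.continuous.comp cx')))
  have cy : Continuous fun s => ‖κ (e (A (x s))).1 - κ (e (A' (x' s))).1‖ ^ 2 := by
    have h1 : Continuous fun s => κ (e (A (x s))).1 :=
      κ.continuous.comp (e.continuous.comp (A.continuous.comp cx)).fst
    have h2 : Continuous fun s => κ (e (A' (x' s))).1 :=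
      κ.continuous.comp (e.continuous.comp (A'.continuous.comp cx')).fst
    exact (h1.sub h2).norm.pow 2
  have ftc := intervalIntegral.integral_eq_sub_of_hasDerivAt (a := 0) (b := t)
    (fun s _ => dd s) (cd.intervalIntegrable _ _)
  have x0 : x 0 - x' 0 = 0 := by rw [h0, sub_self]
  simp only [Pi.sub_apply] at ftc
  rw [x0, norm_zero] at ftc
  have hle : ∫ s in (0 : ℝ)..t, 2 * inner ℝ (x s - x' s) (A (x s) - A' (x' s)) ≤
      ∫ s in (0 : ℝ)..t, (4 * K ^ 2 * (ε + ε') -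
        2 * c * ‖κ (e (A (x s))).1 - κ (e (A' (x' s))).1‖ ^ 2) := by
    refine intervalIntegral.integral_mono_on ht (cd.intervalIntegrable _ _)
      ((continuous_const.sub (continuous_const.mul cy)).intervalIntegrable _ _) fun s hs => ?_
    have h1 := ((hA (x s)).sub (hA' (x' s))).dissipative he hD
    rw [map_sub, Prod.fst_sub, map_sub] at h1
    have e : x s + ε • A (x s) - (x' s + ε' • A' (x' s)) =
        (x s - x' s) + (ε • A (x s) - ε' • A' (x' s)) := by abel
    rw [e, inner_add_right] at h1
    have h2 : |inner ℝ (A (x s) - A' (x' s)) (ε • A (x s) - ε' • A' (x' s))| ≤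
        (2 * K) * ((ε + ε') * K) := by
      refine (abs_real_inner_le_norm _ _).trans (mul_le_mul ?_ ?_ (norm_nonneg _) (by positivity))
      · linarith [norm_sub_le (A (x s)) (A' (x' s)), bx s hs.1, bx' s hs.1]
      · refine (norm_sub_le _ _).trans ?_
        rw [norm_smul, norm_smul, Real.norm_of_nonneg hε.le, Real.norm_of_nonneg hε'.le, add_mul]
        exact add_le_add (mul_le_mul_of_nonneg_left (bx s hs.1) hε.le)
          (mul_le_mul_of_nonneg_left (bx' s hs.1) hε'.le)
    have h3 := neg_le_of_abs_le h2
    rw [real_inner_comm]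
    nlinarith
  have h9 : ‖x t - x' t‖ ^ 2 =
      ∫ s in (0 : ℝ)..t, 2 * inner ℝ (x s - x' s) (A (x s) - A' (x' s)) := by
    rw [ftc]; simp
  have iy : IntervalIntegrable (fun s => 2 * c * ‖κ (e (A (x s))).1 - κ (e (A' (x' s))).1‖ ^ 2)
      volume 0 t := (continuous_const.mul cy).intervalIntegrable _ _
  rw [← h9, intervalIntegral.integral_sub (by simp) iy, intervalIntegral.integral_const, intervalIntegral.integral_const_mul, smul_eq_mul] at hle
  linarith

end Trajectory

variable {e κ π D}

/-- For initial data in the domain all speeds are bounded by ‖a‖, so the Yosida trajectories are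
Cauchy with squared error O(ε n + ε m), and their velocities are Cauchy in L². -/
theorem GenGraph.solvable (he : ∀ x y, inner ℝ x y = inner ℝ (e x).1 (e y).1 + inner ℝ (e x).2 (e y).2)
    {c T : ℝ} (hT : 0 ≤ T) (hc : 0 < c)
    (hD : ∀ y, c * ‖y‖ ^ 2 ≤ inner ℝ (D y) y) {z a : X} (h : GenGraph e κ π D z a) :
    Solvable κ π D T (fun _ => 0) (e z).1 (e z).2 := by
  let ε : ℕ → ℝ := fun n => 1 / ((n : ℝ) + 1)
  have hε : ∀ n, 0 < ε n := fun n => by positivity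
  have hε0 : Tendsto ε atTop (𝓝 0) := tendsto_one_div_add_atTop_nhds_zero_nat
  choose A hA using fun n => exists_yosida e κ π D hc hD (hε n)
  choose x x0 dx bx0 using fun n =>
    exists_flow (A n) (inner_yosida_nonpos he (hε n) hc hD (hA n)) z
  let ys : ℕ → ℝ → Y := fun n t => κ (e (A n (x n t))).1
  have cx : ∀ n, Continuous (x n) := fun n =>
    continuous_iff_continuousAt.2 fun t => (dx n t).continuousAt
  have cA : ∀ n, Continuous fun t => A n (x n t) := fun n => (A n).continuous.comp (cx n)
  have cf : ∀ {g : ℝ → X}, Continuous g → Continuous fun t => (e (g t)).1 :=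
    fun hg => (e.continuous.comp hg).fst
  have cs : ∀ {g : ℝ → X}, Continuous g → Continuous fun t => (e (g t)).2 :=
    fun hg => (e.continuous.comp hg).snd
  have cys : ∀ n, Continuous (ys n) := fun n => κ.continuous.comp (cf (cA n))
  have bx : ∀ n s, 0 ≤ s → ‖A n (x n s)‖ ≤ ‖a‖ := fun n s hs =>
    (bx0 n s hs).trans (norm_yosida_le he (hε n) hc hD (hA n) h)
  have hsq : ∀ g, ‖g‖ ^ 2 = ‖(e g).1‖ ^ 2 + ‖(e g).2‖ ^ 2 := fun g => by
    rw [← real_inner_self_eq_norm_sq, he, real_inner_self_eq_norm_sq, real_inner_self_eq_norm_sq]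
  have nf : ∀ g : X, ‖(e g).1‖ ^ 2 ≤ ‖g‖ ^ 2 := fun g => by
    rw [hsq]; nlinarith [sq_nonneg ‖(e g).2‖]
  have ns : ∀ g : X, ‖(e g).2‖ ^ 2 ≤ ‖g‖ ^ 2 := fun g => by
    rw [hsq]; nlinarith [sq_nonneg ‖(e g).1‖]
  let b : ℕ → ℝ := fun n => 4 * ‖a‖ ^ 2 * T * ε n
  have hb : Tendsto b atTop (𝓝 0) := by simpa using hε0.const_mul (4 * ‖a‖ ^ 2 * T)
  have diff : ∀ n m, ∀ t ∈ Icc 0 T, ‖x n t - x m t‖ ^ 2 +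
      2 * c * ∫ s in (0 : ℝ)..t, ‖ys n s - ys m s‖ ^ 2 ≤ b n + b m := by
    intro n m t ht
    refine (yosida_difference he (hε n) (hε m) hD (hA n) (hA m)
      ((x0 n).trans (x0 m).symm) (dx n) (dx m) (bx n) (bx m) ht.1).trans ?_
    have : 4 * ‖a‖ ^ 2 * (ε n + ε m) * t ≤ 4 * ‖a‖ ^ 2 * (ε n + ε m) * T :=
      mul_le_mul_of_nonneg_left ht.2 (by have := hε n; have := hε m; positivity)
    simp only [b]
    linarith
  have yn : ∀ n m t, 0 ≤ t → 0 ≤ 2 * c * ∫ s in (0 : ℝ)..t, ‖ys n s - ys m s‖ ^ 2 :=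
    fun n m t ht => mul_nonneg (by positivity)
      (intervalIntegral.integral_nonneg ht fun s _ => by positivity)
  obtain ⟨u, hu⟩ := exists_tendstoUniformlyOn (F := fun n t => (e (x n t)).1) hb fun n m t ht => by
    have := nf (x n t - x m t)
    rw [map_sub, Prod.fst_sub] at this
    linarith [diff n m t ht, yn n m t ht.1]
  obtain ⟨w, hw⟩ := exists_tendstoUniformlyOn (F := fun n t => (e (x n t)).2) hb fun n m t ht => by
    have := ns (x n t - x m t)
    rw [map_sub, Prod.snd_sub] at this
    linarith [diff n m t ht, yn n m t ht.1]
  have mys : ∀ n, MemLp (ys n) 2 (volume.restrict (Ioc 0 T)) := fun n =>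
    ContinuousOn.memLp_two (cys n).continuousOn
  have hb' : Tendsto (fun n => (2 * c)⁻¹ * b n) atTop (𝓝 0) := by simpa using hb.const_mul (2 * c)⁻¹
  obtain ⟨y, my, hy⟩ := exists_tendsto_eLpNorm mys hb' fun n m => by
    have h1 := diff n m T ⟨hT, le_rfl⟩
    rw [intervalIntegral.integral_of_le hT] at h1
    rw [← mul_add, le_inv_mul_iff₀ (by positivity)]
    nlinarith [sq_nonneg ‖x n T - x m T‖]
  -- The resolvent point differs from the trajectory by at most ε n · ‖a‖, so it has the same
  -- uniform limit.
  have hv : TendstoUniformlyOn (fun n t => (e (x n t + ε n • A n (x n t))).1) u atTop (Icc 0 T) := by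
    have h1 : TendstoUniformlyOn (fun n t => ε n • (e (A n (x n t))).1) (fun _ => (0 : V)) atTop
        (Icc 0 T) := by
      rw [Metric.tendstoUniformlyOn_iff]
      intro δ hδ
      have := (hε0.mul_const ‖a‖)
      rw [zero_mul] at this
      filter_upwards [this.eventually (gt_mem_nhds hδ)] with n hn t ht
      rw [dist_zero_left, norm_smul, Real.norm_of_nonneg (hε n).le]
      refine (mul_le_mul_of_nonneg_left ?_ (hε n).le).trans_lt hn
      exact (le_of_sq_le_sq (nf _) (norm_nonneg _)).trans (bx n t ht.1)
    refine (hu.add h1).congr_right (fun t _ => by simp) |>.congr (Eventually.of_forall fun n t _ => ?_)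
    simp
  have hxs : TendstoUniformlyOn (fun n t => (e (x n t + ε n • A n (x n t))).2) w atTop (Icc 0 T) := by
    have h1 : TendstoUniformlyOn (fun n t => ε n • (e (A n (x n t))).2) (fun _ => (0 : H)) atTop
        (Icc 0 T) := by
      rw [Metric.tendstoUniformlyOn_iff]
      intro δ hδ
      have := (hε0.mul_const ‖a‖)
      rw [zero_mul] at this
      filter_upwards [this.eventually (gt_mem_nhds hδ)] with n hn t ht
      rw [dist_zero_left, norm_smul, Real.norm_of_nonneg (hε n).le]
      refine (mul_le_mul_of_nonneg_left ?_ (hε n).le).trans_lt hn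
      exact (le_of_sq_le_sq (ns _) (norm_nonneg _)).trans (bx n t ht.1)
    refine (hw.add h1).congr_right (fun t _ => by simp) |>.congr (Eventually.of_forall fun n t _ => ?_)
    simp
  have h0 : (0 : ℝ) ∈ Icc 0 T := ⟨le_rfl, hT⟩
  let q1 : X →L[ℝ] V := (ContinuousLinearMap.fst ℝ V H).comp e.toContinuousLinearMap
  let q2 : X →L[ℝ] H := (ContinuousLinearMap.snd ℝ V H).comp e.toContinuousLinearMap
  refine ⟨u, w, y, ?_, ?_, ?_⟩
  · refine IsEvol.of_tendsto (us := fun n t => (e (x n t)).1)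
      (vs := fun n t => (e (x n t + ε n • A n (x n t))).1) (ws := fun n t => (e (x n t)).2)
      (xs := fun n t => (e (x n t + ε n • A n (x n t))).2) (ys := ys) (fs := fun n t => 0 - D (ys n t))
      (fun n => (cf ((cx n).add ((cA n).const_smul _))).continuousOn) hu hv hw hxs
      (hu.continuousOn (Frequently.of_forall fun n => (cf (cx n)).continuousOn))
      (hw.continuousOn (Frequently.of_forall fun n => (cs (cx n)).continuousOn)) my
      ((memLp_const 0).sub (D.comp_memLp' my)) mys
      (fun n => (memLp_const 0).sub (D.comp_memLp' (mys n))) hy ?_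
      (fun n => Eventually.of_forall fun t => (hA n (x n t)).1) (fun n t ht => ?_)
      (fun n t ht φ => ?_)
    · have ht := (ENNReal.Tendsto.const_mul (a := ENNReal.ofReal ‖D‖) hy
        (Or.inr ENNReal.ofReal_ne_top))
      rw [mul_zero] at ht
      refine tendsto_of_tendsto_of_tendsto_of_le_of_le tendsto_const_nhds ht (fun _ => zero_le)
        fun n => ?_
      refine eLpNorm_le_mul_eLpNorm_of_ae_le_mul (Eventually.of_forall fun t => ?_) _
      simp only [Pi.sub_apply, zero_sub, neg_sub_neg, ← map_sub]
      rw [norm_sub_rev (ys n t)]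
      exact D.le_opNorm _
    · have hd : ∀ s ∈ uIcc 0 t, HasDerivAt (fun s => κ (e (x n s)).1) (ys n s) s := fun s _ =>
        ((κ.comp q1).hasFDerivAt).comp_hasDerivAt s (dx n s)
      rw [intervalIntegral.integral_eq_sub_of_hasDerivAt hd ((cys n).intervalIntegrable _ _)]
      abel
    · have hd : ∀ s ∈ uIcc 0 t, HasDerivAt (fun s => inner ℝ (e (x n s)).2 (π (κ φ)))
          (inner ℝ (0 - D (ys n s)) (κ φ) - inner ℝ (e (x n s + ε n • A n (x n s))).1 φ) s := by
        intro s _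
        have h1 : HasDerivAt (fun s => (e (x n s)).2) (e (A n (x n s))).2 s :=
          q2.hasFDerivAt.comp_hasDerivAt s (dx n s)
        have h2 := h1.inner ℝ (hasDerivAt_const s (π (κ φ)))
        refine h2.congr_deriv ?_
        rw [inner_zero_right, zero_add, (hA n (x n s)).2, zero_sub, inner_neg_left]
        ring
      have hc' : Continuous fun s => inner ℝ (0 - D (ys n s)) (κ φ) -
          inner ℝ (e (x n s + ε n • A n (x n s))).1 φ :=
        ((continuous_const.sub (D.continuous.comp (cys n))).inner continuous_const).sub
          ((cf ((cx n).add ((cA n).const_smul _))).inner continuous_const)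
      rw [intervalIntegral.integral_eq_sub_of_hasDerivAt hd (hc'.intervalIntegrable _ _)]
      abel
  · exact tendsto_nhds_unique (hu.tendsto_at h0) (by simp only [x0]; exact tendsto_const_nhds)
  · exact tendsto_nhds_unique (hw.tendsto_at h0) (by simp only [x0]; exact tendsto_const_nhds)

/-- If x is orthogonal to the domain, the resolvent point z = x + Ax with ε = 1 satisfies ‖z‖² = ⟨z,
x⟩ + ⟨Ax, z⟩ ≤ 0, so z = 0. Then Ax lies over 0 in the graph: its first component vanishes by
injectivity of π ∘ κ, its second by density of the range, and x = 0 follows. -/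
theorem dense_genGraph_domain (he : ∀ x y, inner ℝ x y = inner ℝ (e x).1 (e y).1 + inner ℝ (e x).2 (e y).2)
    {c : ℝ} (hc : 0 < c) (hD : ∀ y, c * ‖y‖ ^ 2 ≤ inner ℝ (D y) y)
    (hinj : ∀ v, π (κ v) = 0 → v = 0) (hdense : ∀ k : H, (∀ v, inner ℝ k (π (κ v)) = 0) → k = 0) :
    Dense {z | ∃ a, GenGraph e κ π D z a} := by
  let 𝒟 : Submodule ℝ (X) :=
    { carrier := {z | ∃ a, GenGraph e κ π D z a}
      add_mem' := fun ⟨a, ha⟩ ⟨a', ha'⟩ => ⟨a + a', ha.add ha'⟩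
      zero_mem' := ⟨0, by simp, fun φ => by simp⟩
      smul_mem' := fun r _ ⟨a, ha⟩ => ⟨r • a, ha.smul r⟩ }
  have h : 𝒟.topologicalClosure = ⊤ := by
    rw [Submodule.topologicalClosure_eq_top_iff, Submodule.eq_bot_iff]
    intro x hx
    obtain ⟨A, hA⟩ := exists_yosida e κ π D hc hD one_pos
    have hg := hA x
    rw [one_smul] at hg
    have h1 : inner ℝ (x + A x) x = 0 := (Submodule.mem_orthogonal _ _).1 hx _ ⟨_, hg⟩
    have h2 := hg.dissipative he hD
    have h3 : ‖x + A x‖ ^ 2 = inner ℝ (x + A x) x + inner ℝ (A x) (x + A x) := by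
      rw [← real_inner_self_eq_norm_sq, real_inner_comm (x + A x) (A x), ← inner_add_right]
    have h4 : 0 ≤ c * ‖κ (e (A x)).1‖ ^ 2 := by positivity
    have h5 : x + A x = 0 := by
      have : ‖x + A x‖ ^ 2 ≤ 0 := by linarith
      exact norm_eq_zero.1 (pow_eq_zero_iff two_ne_zero |>.1 (le_antisymm this (by positivity)))
    rw [h5] at hg
    have a1 : (e (A x)).1 = 0 := hinj _ (by rw [hg.1, map_zero]; rfl)
    have a2 : (e (A x)).2 = 0 := hdense _ fun v => by rw [hg.2 v, a1, map_zero]; simp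
    have a0 : A x = 0 := by
      have : ‖A x‖ ^ 2 = 0 := by
        rw [← real_inner_self_eq_norm_sq, he, a1, a2]; simp
      exact norm_eq_zero.1 (pow_eq_zero_iff two_ne_zero |>.1 this)
    rwa [a0, add_zero] at h5
  have := (Submodule.dense_iff_topologicalClosure_eq_top (s := 𝒟)).2 h
  exact this

theorem solvable_homogeneous {c T : ℝ} (hT : 0 ≤ T) (hc : 0 < c)
    (hD : ∀ y, c * ‖y‖ ^ 2 ≤ inner ℝ (D y) y) (hinj : ∀ v, π (κ v) = 0 → v = 0)
    (hdense : ∀ k : H, (∀ v, inner ℝ k (π (κ v)) = 0) → k = 0) (a : V) (b : H) :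
    Solvable κ π D T (fun _ => 0) a b := by
  let e := WithLp.prodContinuousLinearEquiv 2 ℝ V H
  have he : ∀ x y, inner ℝ x y = inner ℝ (e x).1 (e y).1 + inner ℝ (e x).2 (e y).2 :=
    fun x y => WithLp.prod_inner_apply x y
  have hd := dense_genGraph_domain he hc hD hinj hdense
  obtain ⟨zs, hz, hlim⟩ := mem_closure_iff_seq_limit.1 (hd (e.symm (a, b)))
  choose as has using hz
  have hl := (e.continuous.tendsto (e.symm (a, b))).comp hlim
  rw [e.apply_symm_apply] at hl
  exact Solvable.of_tendsto hT hc hD (fun n => (has n).solvable he hT hc hD)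
    ((continuous_fst.tendsto _).comp hl) ((continuous_snd.tendsto _).comp hl)
    (fun _ => memLp_const 0) (memLp_const 0) (by simp)

end

/-! ### The inhomogeneous damped problem -/

section

variable {V H Y : Type*} [NormedAddCommGroup V] [InnerProductSpace ℝ V] [CompleteSpace V]
  [NormedAddCommGroup H] [InnerProductSpace ℝ H] [CompleteSpace H]
  [NormedAddCommGroup Y] [InnerProductSpace ℝ Y] [CompleteSpace Y]
  {κ : V →L[ℝ] Y} {π : Y →L[ℝ] H} {D : Y →L[ℝ] Y} {T : ℝ}

theorem IsEvol.congr_source {f f' : ℝ → Y} {u : ℝ → V} {w : ℝ → H} {y : ℝ → Y}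
    (h : IsEvol κ π T f u w y) (hf : f' =ᵐ[volume.restrict (Ioc 0 T)] f) :
    IsEvol κ π T f' u w y := by
  refine ⟨h.contU, h.contW, h.memY, h.memF.ae_eq hf.symm, h.pi_y, h.eqU, fun t ht v => ?_⟩
  rw [h.eqW t ht v]
  congr 1
  refine intervalIntegral.integral_congr_ae ?_
  filter_upwards [(ae_restrict_iff' measurableSet_Ioc).1 hf] with s hs hst
  rw [uIoc_of_le ht.1] at hst
  rw [hs ⟨hst.1, hst.2.trans ht.2⟩]

theorem Solvable.add {f f' : ℝ → Y} {a a' : V} {b b' : H} (h : Solvable κ π D T f a b)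
    (h' : Solvable κ π D T f' a' b') :
    Solvable κ π D T (fun t => f t + f' t) (a + a') (b + b') := by
  obtain ⟨u, w, y, hE, rfl, rfl⟩ := h
  obtain ⟨u', w', y', hE', rfl, rfl⟩ := h'
  refine ⟨_, _, _, (hE.add hE').congr_source (Eventually.of_forall fun t => ?_), rfl, rfl⟩
  simp only [map_add]
  abel

theorem Solvable.const_smul {f : ℝ → Y} {a : V} {b : H} (h : Solvable κ π D T f a b) (r : ℝ) :
    Solvable κ π D T (fun t => r • f t) (r • a) (r • b) := by
  obtain ⟨u, w, y, hE, rfl, rfl⟩ := h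
  refine ⟨_, _, _, (hE.const_smul r).congr_source (Eventually.of_forall fun t => ?_), rfl, rfl⟩
  simp only [map_smul, smul_sub]

theorem Solvable.congr {f f' : ℝ → Y} {a : V} {b : H} (h : Solvable κ π D T f a b)
    (hf : f' =ᵐ[volume.restrict (Ioc 0 T)] f) : Solvable κ π D T f' a b := by
  obtain ⟨u, w, y, hE, h1, h2⟩ := h
  exact ⟨u, w, y, hE.congr_source (hf.mono fun t ht => by simp only [ht]), h1, h2⟩

/-- The stationary solution with a constant source. -/
theorem solvable_stationary (k : Y) :
    Solvable κ π D T (fun _ => k) (κ.adjoint k) 0 := by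
  refine ⟨fun _ => κ.adjoint k, fun _ => 0, fun _ => 0, ⟨continuousOn_const, continuousOn_const,
    memLp_const 0, by simpa using memLp_const k, by simp, by simp, fun t _ v => ?_⟩, rfl, rfl⟩
  simp [ContinuousLinearMap.adjoint_inner_left]

theorem integral_delay {E : Type*} [NormedAddCommGroup E] [NormedSpace ℝ E] {a t : ℝ} (ha : 0 ≤ a)
    (g : ℝ → E) : ∫ s in (0 : ℝ)..t, (Ioi a).indicator (fun s => g (s - a)) s =
      if a < t then ∫ s in (0 : ℝ)..(t - a), g s else
        ∫ s in (0 : ℝ)..t, (Ioi a).indicator (fun s => g (s - a)) s := by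
  split_ifs with h
  · rw [intervalIntegral.integral_of_le (ha.trans h.le), setIntegral_indicator measurableSet_Ioi]
    have : Ioc 0 t ∩ Ioi a = Ioc a t := by
      ext s; simp only [mem_inter_iff, mem_Ioc, mem_Ioi]; constructor
      · rintro ⟨⟨_, h2⟩, h3⟩; exact ⟨h3, h2⟩
      · rintro ⟨h1, h2⟩; exact ⟨⟨ha.trans_lt h1, h2⟩, h1⟩
    rw [this, ← intervalIntegral.integral_of_le h.le, intervalIntegral.integral_comp_sub_right,
      sub_self]
  · rfl

theorem integral_delay_max {E : Type*} [NormedAddCommGroup E] [NormedSpace ℝ E] {a t : ℝ}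
    (ha : 0 ≤ a) (ht : 0 ≤ t) (g : ℝ → E) :
    ∫ s in (0 : ℝ)..t, (Ioi a).indicator (fun s => g (s - a)) s =
      ∫ s in (0 : ℝ)..(max (t - a) 0), g s := by
  rcases lt_or_ge a t with h | h
  · rw [integral_delay ha, if_pos h, max_eq_left (by linarith)]
  · rw [max_eq_right (by linarith), intervalIntegral.integral_same]
    refine intervalIntegral.integral_zero_ae (Eventually.of_forall fun s hs => ?_)
    rw [uIoc_of_le ht] at hs
    exact indicator_of_notMem (by simp only [mem_Ioi, not_lt]; exact hs.2.trans h) _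

theorem memLp_delay {g : ℝ → Y} (hg : MemLp g 2 (volume.restrict (Ioc 0 T))) {a : ℝ} (ha : 0 ≤ a) :
    MemLp ((Ioi a).indicator fun s => g (s - a)) 2 (volume.restrict (Ioc 0 T)) := by
  have h1 := (memLp_indicator_iff_restrict (s := Ioc 0 T) measurableSet_Ioc).2 hg
  have h2 := (h1.comp_measurePreserving (measurePreserving_sub_right volume a)).restrict (Ioc 0 T)
  refine h2.ae_eq ?_
  filter_upwards [ae_restrict_mem measurableSet_Ioc] with s hs
  by_cases h : a < s
  · rw [indicator_of_mem (show s ∈ Ioi a from h), Function.comp_apply,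
      indicator_of_mem (show s - a ∈ Ioc 0 T from ⟨by linarith, by linarith [hs.2]⟩)]
  · rw [indicator_of_notMem (show s ∉ Ioi a from h), Function.comp_apply,
      indicator_of_notMem (fun h' => h (by linarith [h'.1]))]

/-- A solution starting at rest may be held at zero until time a; the clamp max (t − a) 0 describes
the waiting and the moving phase together. -/
theorem IsEvol.delay {f : ℝ → Y} {u : ℝ → V} {w : ℝ → H} {y : ℝ → Y}
    (h : IsEvol κ π T f u w y) (hu : u 0 = 0) (hw : w 0 = 0) {a : ℝ} (ha : 0 ≤ a) :
    IsEvol κ π T ((Ioi a).indicator fun t => f (t - a)) (fun t => u (max (t - a) 0))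
      (fun t => w (max (t - a) 0)) ((Ioi a).indicator fun t => y (t - a)) := by
  have hmaps : MapsTo (fun t : ℝ => max (t - a) 0) (Icc 0 T) (Icc 0 T) := fun t ht =>
    ⟨le_max_right _ _, max_le (by linarith [ht.2]) (ht.1.trans ht.2)⟩
  have hc : ContinuousOn (fun t : ℝ => max (t - a) 0) (Icc 0 T) :=
    ((continuous_id.sub continuous_const).max continuous_const).continuousOn
  have h0 : max (0 - a) 0 = 0 := max_eq_right (by linarith)
  refine ⟨h.contU.comp hc hmaps, h.contW.comp hc hmaps, memLp_delay h.memY ha, memLp_delay h.memF ha,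
    ?_, fun t ht => ?_, fun t ht v => ?_⟩
  · have h1 := (ae_restrict_iff' measurableSet_Ioc).1 h.pi_y
    have h2 := (measurePreserving_sub_right (volume : Measure ℝ) a).quasiMeasurePreserving.ae h1
    rw [ae_restrict_iff' measurableSet_Ioc]
    filter_upwards [h2] with s hs hsT
    by_cases hsa : a < s
    · rw [indicator_of_mem (show s ∈ Ioi a from hsa), max_eq_left (by linarith)]
      exact hs ⟨by linarith, by linarith [hsT.2]⟩
    · rw [indicator_of_notMem (show s ∉ Ioi a from hsa), max_eq_right (by linarith), hw, map_zero]
  · rw [integral_delay_max ha ht.1, h0]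
    exact h.eqU _ (hmaps ht)
  · rw [h0, h.eqW _ (hmaps ht) v, ← integral_delay_max ha ht.1]
    congr 1
    refine intervalIntegral.integral_congr fun s _ => ?_
    by_cases hsa : a < s
    · simp only [indicator_of_mem (show s ∈ Ioi a from hsa)]
      rw [max_eq_left (by linarith)]
    · simp only [indicator_of_notMem (show s ∉ Ioi a from hsa)]
      rw [max_eq_right (by linarith), hu]
      simp

/-- Lebesgue differentiation of a primitive that vanishes identically. -/
theorem ae_eq_zero_of_integral_tail_eq_zero {φ : ℝ → Y} (hT : 0 ≤ T) (hφ : IntegrableOn φ (Ioc 0 T))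
    (h : ∀ a ∈ Icc 0 T, ∫ s in a..T, φ s = 0) : φ =ᵐ[volume.restrict (Ioc 0 T)] 0 := by
  have hi : IntervalIntegrable φ volume 0 T :=
    (intervalIntegrable_iff_integrableOn_Ioc_of_le hT).2 hφ
  rw [← restrict_Ioo_eq_restrict_Ioc]
  rw [EventuallyEq, ae_restrict_iff' measurableSet_Ioo]
  filter_upwards [hi.ae_hasDerivAt_integral] with x hx hxT
  have hxI : x ∈ uIcc 0 T := by rw [uIcc_of_le hT]; exact Ioo_subset_Icc_self hxT
  have hd := hx hxI T right_mem_uIcc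
  have he : (fun x => ∫ t in T..x, φ t) =ᶠ[𝓝 x] fun _ => 0 := by
    filter_upwards [isOpen_Ioo.mem_nhds hxT] with z hz
    rw [intervalIntegral.integral_symm, h z (Ioo_subset_Icc_self hz), neg_zero]
  exact hd.unique ((hasDerivAt_const x (0 : Y)).congr_of_eventuallyEq he)

variable {c : ℝ}

/-- The stationary state κ†k plus the free evolution issued from −κ†k starts at rest and carries the
constant source k. Delaying it by a gives the step source. -/
theorem solvable_step (hT : 0 ≤ T) (hc : 0 < c) (hD : ∀ y, c * ‖y‖ ^ 2 ≤ inner ℝ (D y) y)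
    (hinj : ∀ v, π (κ v) = 0 → v = 0) (hdense : ∀ k : H, (∀ v, inner ℝ k (π (κ v)) = 0) → k = 0)
    (k : Y) {a : ℝ} (ha : 0 ≤ a) :
    Solvable κ π D T ((Ioi a).indicator fun _ => k) 0 0 := by
  have h1 := (solvable_homogeneous hT hc hD hinj hdense (-(κ.adjoint k)) 0).add
    (solvable_stationary (κ := κ) (π := π) (D := D) (T := T) k)
  simp only [zero_add, neg_add_cancel] at h1
  obtain ⟨u, w, y, hE, hu, hw⟩ := h1
  have h2 := hE.delay hu hw ha
  have h0 : max (0 - a) 0 = 0 := max_eq_right (by linarith)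
  refine ⟨_, _, _, h2.congr_source (Eventually.of_forall fun t => ?_), by rw [h0, hu],
    by rw [h0, hw]⟩
  by_cases hta : a < t
  · simp only [indicator_of_mem (show t ∈ Ioi a from hta)]
  · simp only [indicator_of_notMem (show t ∉ Ioi a from hta), map_zero, sub_zero]

/-- Existence for the damped linear problem with square integrable source. -/
theorem solvable_of_memLp (hT : 0 ≤ T) (hc : 0 < c) (hD : ∀ y, c * ‖y‖ ^ 2 ≤ inner ℝ (D y) y)
    (hinj : ∀ v, π (κ v) = 0 → v = 0) (hdense : ∀ k : H, (∀ v, inner ℝ k (π (κ v)) = 0) → k = 0)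
    {f : ℝ → Y} (hf : MemLp f 2 (volume.restrict (Ioc 0 T))) (a : V) (b : H) :
    Solvable κ π D T f a b := by
  -- Sources solvable from rest form a linear subspace, closed by the energy estimate. It is the
  -- whole of L² as soon as its orthogonal complement is trivial.
  let S : Submodule ℝ (Lp Y 2 (volume.restrict (Ioc 0 T))) :=
    { carrier := {F | Solvable κ π D T F 0 0}
      add_mem' := fun {F G} hF hG => by
        have := Solvable.add hF hG
        rw [add_zero, add_zero] at this
        exact this.congr (Lp.coeFn_add F G)
      zero_mem' := (solvable_homogeneous hT hc hD hinj hdense 0 0).congr (Lp.coeFn_zero _ _ _)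
      smul_mem' := fun r F hF => by
        have := Solvable.const_smul hF r
        rw [smul_zero, smul_zero] at this
        exact this.congr (Lp.coeFn_smul r F) }
  have hcl : IsClosed (S : Set (Lp Y 2 (volume.restrict (Ioc 0 T)))) := by
    refine IsSeqClosed.isClosed fun Fs F hFs hlim => ?_
    exact Solvable.of_tendsto hT hc hD hFs tendsto_const_nhds tendsto_const_nhds
      (fun n => Lp.memLp (Fs n)) (Lp.memLp F) ((Lp.tendsto_Lp_iff_tendsto_eLpNorm' Fs F).1 hlim)
  -- S contains every step source, so an orthogonal φ has vanishing integral over each interval (s,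
  -- T].
  have horth : Sᗮ = ⊥ := by
    rw [Submodule.eq_bot_iff]
    intro φ hφ
    have hint : IntegrableOn φ (Ioc 0 T) := (Lp.memLp φ).integrable (by norm_num)
    refine Lp.eq_zero_iff_ae_eq_zero.2 (ae_eq_zero_of_integral_tail_eq_zero hT hint fun s hs => ?_)
    refine ext_inner_left ℝ fun k => ?_
    have m1 : MemLp ((Ioi s).indicator fun _ => k) 2 (volume.restrict (Ioc 0 T)) :=
      (memLp_const k).indicator measurableSet_Ioi
    have hmem : m1.toLp _ ∈ S :=
      (solvable_step hT hc hD hinj hdense k hs.1).congr m1.coeFn_toLp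
    have h1 := (Submodule.mem_orthogonal _ _).1 hφ _ hmem
    have h2 := inner_toLp m1 (Lp.memLp φ)
    rw [Lp.toLp_coeFn, h1] at h2
    have hset : Ioc 0 T ∩ Ioi s = Ioc s T := by
      ext x; simp only [mem_inter_iff, mem_Ioc, mem_Ioi]; constructor
      · rintro ⟨⟨_, h2⟩, h3⟩; exact ⟨h3, h2⟩
      · rintro ⟨h1, h2⟩; exact ⟨⟨hs.1.trans_lt h1, h2⟩, h1⟩
    have e : ∀ g : ℝ → Y, (fun x => inner ℝ ((Ioi s).indicator (fun _ => k) x) (g x)) =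
        (Ioi s).indicator fun x => inner ℝ k (g x) := by
      intro g
      funext x
      by_cases hx : x ∈ Ioi s
      · simp only [indicator_of_mem hx]
      · simp only [indicator_of_notMem hx, inner_zero_left]
    have e2 : ∀ g : ℝ → Y, IntegrableOn g (Ioc 0 T) →
        (∫ x in Ioc 0 T, inner ℝ ((Ioi s).indicator (fun _ => k) x) (g x)) =
          inner ℝ k (∫ x in s..T, g x) := by
      intro g hg
      rw [e, setIntegral_indicator measurableSet_Ioi, hset, intervalIntegral.integral_of_le hs.2,
        ← integral_inner (hg.mono_set (Ioc_subset_Ioc_left hs.1))]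
    rw [inner_zero_right, ← e2 _ hint]
    exact h2.symm
  have htop : S = ⊤ := by
    rw [← Submodule.topologicalClosure_eq_top_iff] at horth
    rwa [hcl.submodule_topologicalClosure_eq] at horth
  have hmem : hf.toLp f ∈ S := by rw [htop]; trivial
  have h1 : Solvable κ π D T f 0 0 := Solvable.congr hmem hf.coeFn_toLp.symm
  simpa using h1.add (solvable_homogeneous hT hc hD hinj hdense a b)

end

/-! ### Lipschitz sources -/

section

variable {V H Y : Type*} [NormedAddCommGroup V] [InnerProductSpace ℝ V] [CompleteSpace V]
  [NormedAddCommGroup H] [InnerProductSpace ℝ H] [CompleteSpace H]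
  [NormedAddCommGroup Y] [InnerProductSpace ℝ Y] [CompleteSpace Y]

theorem le_pow_div_factorial_of_le_integral {T K M : ℝ} (hK : 0 ≤ K) {g : ℕ → ℝ → ℝ}
    (hc : ∀ n, ContinuousOn (g n) (Icc 0 T)) (h0 : ∀ t ∈ Icc 0 T, g 0 t ≤ M)
    (hs : ∀ n, ∀ t ∈ Icc 0 T, g (n + 1) t ≤ K * ∫ s in (0 : ℝ)..t, g n s) (n : ℕ) :
    ∀ t ∈ Icc 0 T, g n t ≤ M * ((K * t) ^ n / n.factorial) := by
  induction n with
  | zero => simpa using h0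
  | succ n ih =>
    intro t ht
    refine (hs n t ht).trans ?_
    have h1 : ∫ s in (0 : ℝ)..t, g n s ≤ ∫ s in (0 : ℝ)..t, M * ((K * s) ^ n / n.factorial) := by
      refine intervalIntegral.integral_mono_on ht.1 ?_ ?_ fun s hs => ih s ⟨hs.1, hs.2.trans ht.2⟩
      · refine ContinuousOn.intervalIntegrable ?_
        rw [uIcc_of_le ht.1]
        exact (hc n).mono (Icc_subset_Icc_right ht.2)
      · exact Continuous.intervalIntegrable (by fun_prop) _ _
    refine (mul_le_mul_of_nonneg_left h1 hK).trans (le_of_eq ?_)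
    have h2 : ∀ s : ℝ, M * ((K * s) ^ n / n.factorial) = M * K ^ n / n.factorial * s ^ n := by
      intro s; rw [mul_pow]; ring
    simp only [h2]
    rw [intervalIntegral.integral_const_mul, integral_pow, Nat.factorial_succ]
    push_cast
    have : (n.factorial : ℝ) ≠ 0 := by positivity
    field_simp
    ring

theorem eq_zero_of_le_integral {T K : ℝ} (hK : 0 ≤ K) {g : ℝ → ℝ}
    (hc : ContinuousOn g (Icc 0 T)) (hg : ∀ t ∈ Icc 0 T, 0 ≤ g t)
    (hs : ∀ t ∈ Icc 0 T, g t ≤ K * ∫ s in (0 : ℝ)..t, g s) : ∀ t ∈ Icc 0 T, g t = 0 := by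
  intro t ht
  obtain ⟨M, hM⟩ := isCompact_Icc.exists_bound_of_continuousOn hc
  -- The iteration lemma is applied to a constant sequence: g is below M(Kt)ⁿ/n! for every n, which
  -- is Grönwall's lemma with zero initial value.
  have h1 := fun n => le_pow_div_factorial_of_le_integral (M := M) (g := fun _ => g) hK (fun _ => hc)
    (fun t ht => (le_abs_self _).trans (hM t ht)) (fun _ => hs) n t ht
  have h2 := (FloorSemiring.tendsto_pow_div_factorial_atTop (K * t)).const_mul M
  rw [mul_zero] at h2
  exact le_antisymm (ge_of_tendsto' h2 h1) (hg t ht)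

/-- Time dependent maps `V → Y` that are uniformly Lipschitz on `[0, T]` and vanish at `0`. -/
structure IsLipSource (Φ : ℝ → V → Y) (L T : ℝ) : Prop where
  meas : ∀ u : ℝ → V, ContinuousOn u (Icc 0 T) →
    AEStronglyMeasurable (fun t => Φ t (u t)) (volume.restrict (Ioc 0 T))
  lip : ∀ᵐ t ∂(volume.restrict (Ioc 0 T)), ∀ u v, ‖Φ t u - Φ t v‖ ≤ L * ‖u - v‖
  zero : ∀ t, Φ t 0 = 0

variable {κ : V →L[ℝ] Y} {π : Y →L[ℝ] H} {D : Y →L[ℝ] Y} {T c L : ℝ} {Φ : ℝ → V → Y}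

theorem IsLipSource.memLp (hΦ : IsLipSource Φ L T) {u : ℝ → V} (hu : ContinuousOn u (Icc 0 T)) :
    MemLp (fun t => Φ t (u t)) 2 (volume.restrict (Ioc 0 T)) := by
  refine MemLp.of_le_mul (ContinuousOn.memLp_two hu) (hΦ.meas u hu) (c := L) ?_
  filter_upwards [hΦ.lip] with t ht
  simpa [hΦ.zero] using ht (u t) 0

/-- The inputs v₁, v₂ are kept distinct from the outputs u₁, u₂, so that one estimate serves both
the Picard iteration and, with v = u, uniqueness. -/
theorem IsLipSource.difference (hΦ : IsLipSource Φ L T) (hc : 0 < c)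
    (hD : ∀ y, c * ‖y‖ ^ 2 ≤ inner ℝ (D y) y) {u1 u2 v1 v2 : ℝ → V} {w1 w2 : ℝ → H}
    {y1 y2 : ℝ → Y} (h1 : IsEvol κ π T (fun t => Φ t (v1 t) - D (y1 t)) u1 w1 y1)
    (h2 : IsEvol κ π T (fun t => Φ t (v2 t) - D (y2 t)) u2 w2 y2)
    (hv1 : ContinuousOn v1 (Icc 0 T)) (hv2 : ContinuousOn v2 (Icc 0 T))
    (hu : u1 0 = u2 0) (hw : w1 0 = w2 0) {t : ℝ} (ht : t ∈ Icc 0 T) :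
    ‖u1 t - u2 t‖ ^ 2 + ‖w1 t - w2 t‖ ^ 2 ≤
      c⁻¹ * L ^ 2 * ∫ s in (0 : ℝ)..t, ‖v1 s - v2 s‖ ^ 2 := by
  have h3 := (h1.sub h2).congr_source (f' := fun t => (Φ t (v1 t) - Φ t (v2 t)) - D (y1 t - y2 t))
    (Eventually.of_forall fun t => by simp only [map_sub]; abel)
  have hm := (hΦ.memLp hv1).sub (hΦ.memLp hv2)
  have h4 := h3.energy_estimate hc hD t ht
  simp only [hu, hw, sub_self, norm_zero] at h4
  have h5 : ∫ s in (0 : ℝ)..t, ‖Φ s (v1 s) - Φ s (v2 s)‖ ^ 2 ≤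
      ∫ s in (0 : ℝ)..t, L ^ 2 * ‖v1 s - v2 s‖ ^ 2 := by
    have i1 : IntegrableOn (fun s => ‖Φ s (v1 s) - Φ s (v2 s)‖ ^ 2) (Ioc 0 T) :=
      hm.integrable_norm_pow (by norm_num)
    have i2 : IntegrableOn (fun s => ‖v1 s - v2 s‖ ^ 2) (Ioc 0 T) :=
      (ContinuousOn.memLp_two (hv1.sub hv2)).integrable_norm_pow (by norm_num)
    have hsub : Ioc 0 t ⊆ Ioc 0 T := Ioc_subset_Ioc_right ht.2
    rw [intervalIntegral.integral_of_le ht.1, intervalIntegral.integral_of_le ht.1]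
    refine setIntegral_mono_ae_restrict (i1.mono_set hsub) ((i2.mono_set hsub).const_mul _) ?_
    filter_upwards [ae_restrict_of_ae_restrict_of_subset hsub hΦ.lip] with s hs
    rw [← mul_pow]
    exact pow_le_pow_left₀ (norm_nonneg _) (hs _ _) 2
  rw [intervalIntegral.integral_const_mul] at h5
  have h6 : 0 ≤ ∫ s in (0 : ℝ)..t, ‖(y1 s - y2 s)‖ ^ 2 :=
    intervalIntegral.integral_nonneg ht.1 fun s _ => by positivity
  have h7 := mul_le_mul_of_nonneg_left h5 (inv_nonneg.2 hc.le)
  have h8 := mul_nonneg hc.le h6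
  rw [mul_assoc]
  linarith

theorem IsLipSource.unique (hΦ : IsLipSource Φ L T) (hc : 0 < c)
    (hD : ∀ y, c * ‖y‖ ^ 2 ≤ inner ℝ (D y) y) {u1 u2 : ℝ → V} {w1 w2 : ℝ → H}
    {y1 y2 : ℝ → Y} (h1 : IsEvol κ π T (fun t => Φ t (u1 t) - D (y1 t)) u1 w1 y1)
    (h2 : IsEvol κ π T (fun t => Φ t (u2 t) - D (y2 t)) u2 w2 y2)
    (hu : u1 0 = u2 0) (hw : w1 0 = w2 0) : ∀ t ∈ Icc 0 T, u1 t = u2 t ∧ w1 t = w2 t := by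
  have hcu := h1.contU.sub h2.contU
  have hcw := h1.contW.sub h2.contW
  have hcg : ContinuousOn (fun t => ‖u1 t - u2 t‖ ^ 2 + ‖w1 t - w2 t‖ ^ 2) (Icc 0 T) :=
    (hcu.norm.pow 2).add (hcw.norm.pow 2)
  have key := eq_zero_of_le_integral (K := c⁻¹ * L ^ 2) (by positivity) hcg
    (fun t _ => by positivity) fun t ht => by
      refine (hΦ.difference hc hD h1 h2 h1.contU h2.contU hu hw ht).trans ?_
      refine mul_le_mul_of_nonneg_left ?_ (by positivity)
      have hsub : uIcc 0 t ⊆ Icc 0 T := by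
        rw [uIcc_of_le ht.1]; exact Icc_subset_Icc_right ht.2
      refine intervalIntegral.integral_mono_on ht.1
        (ContinuousOn.intervalIntegrable ((hcu.norm.pow 2).mono hsub))
        (ContinuousOn.intervalIntegrable (hcg.mono hsub)) fun s _ => ?_
      have : 0 ≤ ‖w1 s - w2 s‖ ^ 2 := by positivity
      linarith
  intro t ht
  have h3 := key t ht
  have h4 : ‖u1 t - u2 t‖ ^ 2 = 0 ∧ ‖w1 t - w2 t‖ ^ 2 = 0 :=
    (add_eq_zero_iff_of_nonneg (by positivity) (by positivity)).1 h3
  exact ⟨by simpa [sub_eq_zero] using h4.1, by simpa [sub_eq_zero] using h4.2⟩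

/-- Λ freezes the source at the input curve and solves the linear problem. The Volterra form of the
difference estimate bounds its n-th iterate by (KT)ⁿ/n! in squared distance, so some iterate is a
contraction, without restriction on T. -/
theorem IsLipSource.exists_isEvol (hΦ : IsLipSource Φ L T) (hT : 0 ≤ T) (hc : 0 < c)
    (hD : ∀ y, c * ‖y‖ ^ 2 ≤ inner ℝ (D y) y)
    (hinj : ∀ v, π (κ v) = 0 → v = 0) (hdense : ∀ k : H, (∀ v, inner ℝ k (π (κ v)) = 0) → k = 0)
    (a : V) (b : H) :
    ∃ u w y, IsEvol κ π T (fun t => Φ t (u t) - D (y t)) u w y ∧ u 0 = a ∧ w 0 = b := by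
  have hext : ∀ U : C(Icc 0 T, V), ContinuousOn (IccExtend hT U) (Icc 0 T) := fun U =>
    (U.continuous.Icc_extend' (h := hT)).continuousOn
  have hsol := fun U : C(Icc 0 T, V) =>
    solvable_of_memLp (π := π) hT hc hD hinj hdense (hΦ.memLp (hext U)) a b
  choose us ws ys hE hu0 hw0 using hsol
  let Λ : C(Icc 0 T, V) → C(Icc 0 T, V) := fun U => ⟨(Icc 0 T).domRestrict (us U), (hE U).contU.domRestrict⟩
  have hΛ : ∀ U, ∀ t ∈ Icc 0 T, IccExtend hT (Λ U) t = us U t := fun U t ht => by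
    rw [IccExtend_of_mem _ _ ht]; rfl
  set K := c⁻¹ * L ^ 2 with hK
  have hstep : ∀ U1 U2, ∀ t ∈ Icc 0 T, ‖IccExtend hT (Λ U1) t - IccExtend hT (Λ U2) t‖ ^ 2 ≤
      K * ∫ s in (0 : ℝ)..t, ‖IccExtend hT U1 s - IccExtend hT U2 s‖ ^ 2 := fun U1 U2 t ht => by
    rw [hΛ _ t ht, hΛ _ t ht]
    have := hΦ.difference hc hD (hE U1) (hE U2) (hext U1) (hext U2) (by rw [hu0, hu0])
      (by rw [hw0, hw0]) ht
    have h2 : 0 ≤ ‖ws U1 t - ws U2 t‖ ^ 2 := by positivity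
    linarith
  have hiter : ∀ U1 U2 n, ∀ t ∈ Icc 0 T,
      ‖IccExtend hT (Λ^[n] U1) t - IccExtend hT (Λ^[n] U2) t‖ ^ 2 ≤
      dist U1 U2 ^ 2 * ((K * t) ^ n / n.factorial) := fun U1 U2 n t ht => by
    refine le_pow_div_factorial_of_le_integral
      (g := fun n t => ‖IccExtend hT (Λ^[n] U1) t - IccExtend hT (Λ^[n] U2) t‖ ^ 2)
      (by positivity) (fun n => ((hext _).sub (hext _)).norm.pow 2) ?_ ?_ n t ht
    · intro t ht
      simp only [Function.iterate_zero, id]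
      rw [IccExtend_of_mem _ _ ht, IccExtend_of_mem _ _ ht, ← dist_eq_norm]
      exact pow_le_pow_left₀ dist_nonneg (ContinuousMap.dist_apply_le_dist _) 2
    · intro n t ht
      simp only [Function.iterate_succ_apply']
      exact hstep _ _ t ht
  -- The estimate concerns squared distances, so 1/4 here is contraction factor 1/2 below.
  obtain ⟨n, hn⟩ : ∃ n : ℕ, (K * T) ^ n / n.factorial < 1 / 4 :=
    ((FloorSemiring.tendsto_pow_div_factorial_atTop (K * T)).eventually_lt_const
      (by norm_num)).exists
  have hcontr : ContractingWith (1 / 2) (Λ^[n]) := by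
    refine ⟨by rw [← NNReal.coe_lt_coe]; norm_num, LipschitzWith.of_dist_le_mul fun U1 U2 => ?_⟩
    have hd : (0 : ℝ) ≤ ((1 / 2 : NNReal) : ℝ) * dist U1 U2 := by positivity
    rw [ContinuousMap.dist_le hd]
    intro t
    have h1 := hiter U1 U2 n t t.2
    rw [IccExtend_of_mem _ _ t.2, IccExtend_of_mem _ _ t.2] at h1
    refine abs_le_of_sq_le_sq' ?_ hd |>.2
    rw [dist_eq_norm]
    refine h1.trans ?_
    have h2 : (K * t) ^ n / n.factorial ≤ 1 / 4 := by
      refine le_trans ?_ hn.le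
      have hK0 : 0 ≤ K := by positivity
      have := mul_nonneg hK0 t.2.1
      have h3 := t.2.2
      gcongr
    have h3 := mul_le_mul_of_nonneg_left h2 (sq_nonneg (dist U1 U2))
    push_cast
    nlinarith
  have : Nonempty C(Icc 0 T, V) := ⟨0⟩
  set U := hcontr.fixedPoint with hU
  -- Λ commutes with its iterate, hence preserves the unique fixed point of that iterate.
  have hfix : Λ U = U := hcontr.isFixedPt_fixedPoint_iterate
  refine ⟨us U, ws U, ys U, (hE U).congr_source ?_, hu0 U, hw0 U⟩
  filter_upwards [ae_restrict_mem measurableSet_Ioc] with t ht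
  have := hΛ U t (Ioc_subset_Icc_self ht)
  rw [hfix] at this
  rw [this]

end

/-! ### Weak derivatives of continuous functions -/

section

/-- The function minus a primitive of its weak derivative has zero weak derivative, so it is almost
everywhere constant; continuity makes this exact, endpoints included. -/
theorem HasWeakDerivOn.eq_add_integral {f g : ℝ → ℝ} {a b : ℝ} (hab : a < b)
    (h : HasWeakDerivOn f g a b) (hf : ContinuousOn f (Icc a b)) :
    ∀ t ∈ Icc a b, f t = f a + ∫ s in a..t, g s := by
  have hp := hasWeakDerivOn_primitive hab h.2.1
  have hd := h.add (hp.const_mul (-1))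
  obtain ⟨c, hc⟩ := (hd.congr (Filter.EventuallyEq.refl _ _)
    (Filter.Eventually.of_forall fun x => by simp :
      (fun _ => (0 : ℝ)) =ᵐ[volume.restrict (Ioo a b)] fun x => g x + -1 * g x)).ae_const hab
  have hac : AbsolutelyContinuousOnInterval (fun x => ∫ t in a..x, g t) a b :=
    ((intervalIntegrable_iff_integrableOn_Ioo_of_le hab.le).2
      h.2.1).absolutelyContinuousOnInterval_intervalIntegral (by simp)
  have hcont := hac.continuousOn
  rw [uIcc_of_le hab.le] at hcont
  rw [restrict_Ioo_eq_restrict_Icc] at hc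
  have h1 := Measure.eqOn_Icc_of_ae_eq volume hab.ne hc (hf.add (continuousOn_const.mul hcont))
    continuousOn_const
  intro t ht
  have h2 := h1 ht
  have h3 := h1 (left_mem_Icc.2 hab.le)
  simp only [intervalIntegral.integral_same] at h2 h3
  linarith

theorem hasWeakDerivOn_of_eq_add_integral {f g : ℝ → ℝ} {a b : ℝ} (hab : a < b)
    (hg : IntegrableOn g (Ioo a b)) (h : ∀ t ∈ Icc a b, f t = f a + ∫ s in a..t, g s) :
    HasWeakDerivOn f g a b := by
  have h0 : HasWeakDerivOn (fun _ => f a) (fun _ => (0 : ℝ)) a b := by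
    refine ⟨integrableOn_const (by simp), integrableOn_zero, fun φ h1 h2 h3 => ?_⟩
    have hb : φ b = 0 := image_eq_zero_of_notMem_tsupport fun h => (h3 h).2.ne rfl
    have ha : φ a = 0 := image_eq_zero_of_notMem_tsupport fun h => (h3 h).1.ne rfl
    have hd : ∫ x in a..b, deriv φ x = φ b - φ a :=
      intervalIntegral.integral_deriv_eq_sub (fun x _ => (h1.differentiable (by simp)) x)
        ((h1.continuous_deriv (by simp)).intervalIntegrable _ _)
    rw [MeasureTheory.integral_const_mul, ← integral_Ioc_eq_integral_Ioo, ← intervalIntegral.integral_of_le hab.le,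
      hd, ha, hb]
    simp
  refine (h0.add (hasWeakDerivOn_primitive hab hg)).congr ?_ (Eventually.of_forall fun x => by simp)
  filter_upwards [ae_restrict_mem measurableSet_Ioo] with t ht
  exact h t (Ioo_subset_Icc_self ht)

/-! ### The space `H¹(0, 1)` -/

theorem integral_mul_eq_inner {φ : ℝ → ℝ} (hφ : MemLp φ 2 volI) (f : L2I) :
    ∫ x in Ioo 0 1, f x * φ x = inner ℝ (hφ.toLp φ) f := by
  rw [L2.inner_def]
  refine integral_congr_ae ?_
  filter_upwards [hφ.coeFn_toLp] with x hx
  rw [hx]; rfl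

theorem memLp_volI_of_continuous {φ : ℝ → ℝ} (hφ : Continuous φ) : MemLp φ 2 volI := by
  have := ContinuousOn.memLp_two (T := 1) hφ.continuousOn
  rwa [← restrict_Ioo_eq_restrict_Ioc] at this

/-- Each test function imposes one closed linear condition on a pair in L² × L²; the integrability
requirements are automatic on a bounded interval. -/
theorem isClosed_H1Submodule : IsClosed (H1Submodule : Set (WithLp 2 (L2I × L2I))) := by
  have h : (H1Submodule : Set (WithLp 2 (L2I × L2I))) =
      ⋂ (φ : ℝ → ℝ) (h1 : ContDiff ℝ ∞ φ) (_ : HasCompactSupport φ) (_ : tsupport φ ⊆ Ioo 0 1),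
        {z | inner ℝ ((memLp_volI_of_continuous (h1.continuous_deriv (by simp))).toLp (deriv φ)) z.fst =
          - inner ℝ ((memLp_volI_of_continuous h1.continuous).toLp φ) z.snd} := by
    ext z
    simp only [mem_iInter, mem_ofPred_eq, ← integral_mul_eq_inner]
    exact ⟨fun h => h.2.2, fun h => ⟨L2I.integrableOn _, L2I.integrableOn _, h⟩⟩
  rw [h]
  refine isClosed_iInter fun φ => isClosed_iInter fun h1 => isClosed_iInter fun h2 =>
    isClosed_iInter fun h3 => ?_
  exact isClosed_eq (continuous_const.inner (WithLp.fstL 2 ℝ L2I L2I).continuous)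
    (continuous_const.inner (WithLp.sndL 2 ℝ L2I L2I).continuous).neg

instance : CompleteSpace H1 := isClosed_H1Submodule.completeSpace_coe

namespace H1

theorem hasWeakDerivOn_rep (v : H1) : HasWeakDerivOn v.rep v.dx 0 1 :=
  HasWeakDerivOn.congr v.2 v.rep_ae_eq (EventuallyEq.refl _ _)

theorem intervalIntegrable_coe (g : L2I) {x y : ℝ} (hx : x ∈ Icc (0 : ℝ) 1)
    (hy : y ∈ Icc (0 : ℝ) 1) : IntervalIntegrable (g : ℝ → ℝ) volume x y := by
  have : IntervalIntegrable (g : ℝ → ℝ) volume 0 1 :=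
    (intervalIntegrable_iff_integrableOn_Ioo_of_le zero_le_one).2 (L2I.integrableOn g)
  refine this.mono_set ?_
  rw [uIcc_of_le zero_le_one]
  exact uIcc_subset_Icc hx hy

theorem rep_sub_rep (v : H1) {x y : ℝ} (hx : x ∈ Icc (0 : ℝ) 1) (hy : y ∈ Icc (0 : ℝ) 1) :
    v.rep y - v.rep x = ∫ s in x..y, v.dx s := by
  have h := v.hasWeakDerivOn_rep.eq_add_integral zero_lt_one v.continuousOn_rep
  rw [h x hx, h y hy, ← intervalIntegral.integral_interval_sub_left
    (intervalIntegrable_coe _ (left_mem_Icc.2 zero_le_one) hy)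
    (intervalIntegrable_coe _ (left_mem_Icc.2 zero_le_one) hx)]
  ring

/-- Continuous functions that agree almost everywhere agree on the closed interval. This makes the
chosen representative linear in v and its boundary values meaningful. -/
theorem eqOn_rep {v : H1} {F : ℝ → ℝ} (hF : ContinuousOn F (Icc 0 1))
    (h : F =ᵐ[volI] (v.toL2 : ℝ → ℝ)) : EqOn F v.rep (Icc 0 1) := by
  have h1 := h.trans v.rep_ae_eq.symm
  rw [volI, restrict_Ioo_eq_restrict_Icc] at h1
  exact Measure.eqOn_Icc_of_ae_eq volume zero_ne_one h1 hF v.continuousOn_rep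

theorem rep_add (v w : H1) {x : ℝ} (hx : x ∈ Icc (0 : ℝ) 1) :
    (v + w).rep x = v.rep x + w.rep x := by
  refine (eqOn_rep (F := fun x => v.rep x + w.rep x)
    (v.continuousOn_rep.add w.continuousOn_rep) ?_ hx).symm
  filter_upwards [v.rep_ae_eq, w.rep_ae_eq, Lp.coeFn_add v.toL2 w.toL2] with x h1 h2 h3
  rw [h1, h2]; exact h3.symm

theorem rep_smul (c : ℝ) (v : H1) {x : ℝ} (hx : x ∈ Icc (0 : ℝ) 1) :
    (c • v).rep x = c * v.rep x := by
  refine (eqOn_rep (F := fun x => c * v.rep x) (continuousOn_const.mul v.continuousOn_rep) ?_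
    hx).symm
  filter_upwards [v.rep_ae_eq, Lp.coeFn_smul c v.toL2] with x h1 h2
  rw [h1]; exact h2.symm

theorem integral_abs_le_norm (g : L2I) : ∫ x in Ioo 0 1, |g x| ≤ ‖g‖ := by
  have h1 : MemLp (fun x => |g x|) 2 volI := (Lp.memLp g).norm
  have h2 := integral_mul_eq_inner (memLp_const (μ := volI) (p := 2) (1 : ℝ)) (h1.toLp _)
  have h3 : ∫ x in Ioo 0 1, |g x| = ∫ x in Ioo 0 1, (h1.toLp _) x * 1 := by
    refine integral_congr_ae ?_
    filter_upwards [h1.coeFn_toLp] with x hx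
    rw [hx, mul_one]
  rw [h3, h2]
  refine (real_inner_le_norm _ _).trans ?_
  have h4 : ‖(memLp_const (μ := volI) (p := 2) (1 : ℝ)).toLp _‖ = 1 := by
    have := norm_toLp_sq (memLp_const (μ := volI) (p := 2) (1 : ℝ))
    simp at this
    rcases this with h | h
    · exact h
    · have := norm_nonneg ((Lp.const 2 volI) (1 : ℝ))
      linarith
  have h5 : ‖h1.toLp _‖ = ‖g‖ := by
    rw [Lp.norm_toLp, Lp.norm_def]
    congr 1
    exact eLpNorm_congr_norm_ae (Eventually.of_forall fun x => by simp)
  rw [h4, h5, one_mul]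

/-- Averaging |v(x)| ≤ |v(y)| + ‖v_x‖ over y gives |v(x)| ≤ ‖v‖ + ‖v_x‖, both norms in L². The
constant 2 obtained by squaring is the source of the factors 2^{α/2} and 2^{β/2} in η*. -/
theorem rep_sq_le (v : H1) {x : ℝ} (hx : x ∈ Icc (0 : ℝ) 1) : v.rep x ^ 2 ≤ 2 * ‖v‖ ^ 2 := by
  have h1 : ∀ y ∈ Icc (0 : ℝ) 1, |v.rep x| ≤ |v.rep y| + ‖v.dx‖ := by
    intro y hy
    have h2 := v.rep_sub_rep hy hx
    have h3 : |∫ s in y..x, v.dx s| ≤ ‖v.dx‖ := by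
      rw [← Real.norm_eq_abs]
      refine (intervalIntegral.norm_integral_le_integral_norm_uIoc).trans
        (le_trans ?_ (integral_abs_le_norm v.dx))
      rw [← integral_Ioc_eq_integral_Ioo]
      refine setIntegral_mono_set ?_ (Eventually.of_forall fun s => abs_nonneg _) ?_
      · exact Integrable.abs ((integrableOn_Ioc_iff_integrableOn_Ioo).2 (L2I.integrableOn v.dx))
      · refine LE.le.eventuallyLE ?_
        exact Ioc_subset_Ioc (le_min hy.1 hx.1) (max_le hy.2 hx.2)
    have h4 : v.rep x = v.rep y + ∫ s in y..x, v.dx s := by linarith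
    rw [h4]
    exact (abs_add_le _ _).trans (by linarith)
  have h2 : |v.rep x| ≤ ‖v.toL2‖ + ‖v.dx‖ := by
    have hi : IntegrableOn (fun y => |v.rep y|) (Ioo 0 1) :=
      ((v.continuousOn_rep.abs).integrableOn_Icc).mono_set Ioo_subset_Icc_self
    have h3 : ∫ y in Ioo (0 : ℝ) 1, |v.rep x| ≤ ∫ y in Ioo (0 : ℝ) 1, (|v.rep y| + ‖v.dx‖) := by
      refine setIntegral_mono_on (integrableOn_const (by simp))
        (hi.add (integrableOn_const (by simp))) measurableSet_Ioo fun y hy =>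
        h1 y (Ioo_subset_Icc_self hy)
    rw [integral_add hi (integrableOn_const (by simp))] at h3
    have h4 : ∫ y in Ioo (0 : ℝ) 1, |v.rep y| = ∫ y in Ioo (0 : ℝ) 1, |v.toL2 y| := by
      refine integral_congr_ae ?_
      filter_upwards [v.rep_ae_eq] with y hy
      rw [hy]
    have h5 := integral_abs_le_norm v.toL2
    simp at h3
    linarith
  have h3 := v.norm_sq
  have h4 := sq_le_sq' (by linarith [abs_nonneg (v.rep x)]) h2
  rw [sq_abs] at h4
  nlinarith [sq_nonneg (‖v.toL2‖ - ‖v.dx‖)]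

theorem abs_rep_le (v : H1) {x : ℝ} (hx : x ∈ Icc (0 : ℝ) 1) : |v.rep x| ≤ √2 * ‖v‖ := by
  refine abs_le_of_sq_le_sq ?_ (by positivity)
  rw [mul_pow, Real.sq_sqrt (by norm_num)]
  exact v.rep_sq_le hx

/-- The embedding of `H¹(0, 1)` into `L²(0, 1)`. -/
def toL2L : H1 →L[ℝ] L2I := (WithLp.fstL 2 ℝ L2I L2I).comp H1Submodule.subtypeL

/-- Evaluation at a point of `[0, 1]`. -/
def evalL (x : Icc (0 : ℝ) 1) : H1 →L[ℝ] ℝ :=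
  LinearMap.mkContinuous
    { toFun := fun v => v.rep x
      map_add' := fun v w => rep_add v w x.2
      map_smul' := fun c v => rep_smul c v x.2 } (√2) fun v => v.abs_rep_le x.2

theorem inner_eq (v w : H1) :
    inner ℝ v w = (inner ℝ v.toL2 w.toL2 : ℝ) + inner ℝ v.dx w.dx :=
  WithLp.prod_inner_apply v.1 w.1

/-- An element of `H1` is a pair, so the weak derivative must be shown to vanish too: its integral
over every subinterval (a, 1) is a difference of boundary values of the zero representative. -/
theorem eq_zero_of_toL2_eq_zero {v : H1} (h : v.toL2 = 0) : v = 0 := by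
  have h0 : EqOn (fun _ => (0 : ℝ)) v.rep (Icc 0 1) := eqOn_rep continuousOn_const (by
    rw [h]; exact (Lp.coeFn_zero ℝ 2 volI).symm)
  have h1 : v.dx = 0 := by
    refine Lp.eq_zero_iff_ae_eq_zero.2 ?_
    change _ =ᵐ[volume.restrict (Ioo 0 1)] _
    rw [restrict_Ioo_eq_restrict_Ioc]
    refine ae_eq_zero_of_integral_tail_eq_zero zero_le_one ?_ fun a ha => ?_
    · exact (integrableOn_Ioc_iff_integrableOn_Ioo).2 (L2I.integrableOn _)
    · rw [← v.rep_sub_rep ha (by simp), ← h0 ha, ← h0 (by simp)]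
      simp
  have h2 := v.norm_sq
  rw [h, h1] at h2
  simpa using h2

/-- Test functions with their classical derivatives belong to `H1`, so the fundamental lemma of the
calculus of variations applies. -/
theorem eq_zero_of_forall_inner_toL2_eq_zero {k : L2I} (h : ∀ v : H1, inner ℝ k v.toL2 = 0) :
    k = 0 := by
  refine Lp.eq_zero_iff_ae_eq_zero.2 ?_
  have main : ∀ᵐ x, x ∈ Ioo (0 : ℝ) 1 → k x = 0 := by
    refine isOpen_Ioo.ae_eq_zero_of_integral_contDiff_smul_eq_zero
      (L2I.integrableOn k).locallyIntegrableOn fun φ h1 h2 h3 => ?_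
    have hd : Continuous (deriv φ) := h1.continuous_deriv (by simp)
    have m1 := memLp_volI_of_continuous h1.continuous
    have m2 := memLp_volI_of_continuous hd
    have hw : HasWeakDerivOn φ (deriv φ) 0 1 := by
      refine hasWeakDerivOn_of_eq_add_integral zero_lt_one
        (hd.continuousOn.integrableOn_Icc.mono_set Ioo_subset_Icc_self) fun t ht => ?_
      rw [intervalIntegral.integral_deriv_eq_sub (fun x _ => (h1.differentiable (by simp)) x)
        (hd.intervalIntegrable _ _)]
      ring
    let v : H1 := ⟨WithLp.toLp 2 (m1.toLp φ, m2.toLp (deriv φ)),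
      hw.congr m1.coeFn_toLp m2.coeFn_toLp⟩
    have h4 := h v
    rw [real_inner_comm] at h4
    have h5 := (integral_mul_eq_inner m1 k).trans h4
    rw [← setIntegral_eq_integral_of_forall_compl_eq_zero (s := Ioo 0 1)]
    · refine Eq.trans ?_ h5; simp only [smul_eq_mul, mul_comm]
    · intro x hx
      rw [image_eq_zero_of_notMem_tsupport fun hx' => hx (h3 hx'), zero_smul]
  rw [EventuallyEq, ae_restrict_iff' measurableSet_Ioo]
  exact main

end H1

end

section

/-! ### The truncated power nonlinearity -/

theorem hasDerivAt_powNL {s : ℝ} (hs : 2 < s) (y : ℝ) :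
    HasDerivAt (powNL s) ((s - 1) * |y| ^ (s - 2)) y := by
  rcases eq_or_ne y 0 with rfl | hy
  · have h0 : (s - 1) * |(0 : ℝ)| ^ (s - 2) = 0 := by
      rw [abs_zero, Real.zero_rpow (by linarith), mul_zero]
    rw [h0, hasDerivAt_iff_tendsto_slope]
    have h1 : Tendsto (fun y : ℝ => |y| ^ (s - 2)) (𝓝 0) (𝓝 0) := by
      have : Continuous fun y : ℝ => |y| ^ (s - 2) :=
        continuous_abs.rpow_const fun _ => Or.inr (by linarith)
      have h2 := this.tendsto 0
      rwa [abs_zero, Real.zero_rpow (by linarith)] at h2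
    refine (h1.mono_left nhdsWithin_le_nhds).congr' ?_
    filter_upwards [self_mem_nhdsWithin] with y hy
    rw [slope_def_field, powNL, powNL]
    have hy : y ≠ 0 := hy
    field_simp
    ring
  · have h1 := ((hasDerivAt_abs hy).rpow_const (p := s - 2) (Or.inl (abs_ne_zero.2 hy))).mul
      (hasDerivAt_id y)
    refine h1.congr_deriv ?_
    have h2 : (SignType.sign y : ℝ) * y = |y| := sign_mul_self y
    have h3 : |y| ^ (s - 2 - 1) * |y| = |y| ^ (s - 2) := by
      rw [Real.rpow_sub_one (abs_ne_zero.2 hy)]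
      field_simp
    calc _ = (s - 2) * (|y| ^ (s - 2 - 1) * ((SignType.sign y : ℝ) * y)) + |y| ^ (s - 2) := by
          simp only [id]; ring
      _ = _ := by rw [h2, h3]; ring

theorem continuous_powNL {s : ℝ} (hs : 2 < s) : Continuous (powNL s) :=
  continuous_iff_continuousAt.2 fun y => (hasDerivAt_powNL hs y).continuousAt

/-- The nonlinearity `|y|^{s-2} y`, frozen outside `[-K, K]`. -/
def cutNL (s K y : ℝ) : ℝ := powNL s (max (-K) (min y K))

/-- A Lipschitz constant of `cutNL s K`. -/
def cutLip (s K : ℝ) : NNReal := Real.toNNReal ((s - 1) * K ^ (s - 2))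

theorem cutNL_eq {s K y : ℝ} (h : |y| ≤ K) : cutNL s K y = powNL s y := by
  rw [cutNL, min_eq_left (abs_le.1 h).2, max_eq_right (abs_le.1 h).1]

theorem cutNL_zero {s K : ℝ} (hK : 0 ≤ K) : cutNL s K 0 = 0 := by
  rw [cutNL_eq (by simpa using hK), powNL, mul_zero]

/-- The derivative (s−1)|y|^{s−2} is bounded on [−K, K], and clamping to that interval is
1-Lipschitz. -/
theorem lipschitzWith_cutNL {s K : ℝ} (hs : 2 < s) (hK : 0 ≤ K) :
    LipschitzWith (cutLip s K) (cutNL s K) := by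
  have h1 : LipschitzOnWith (cutLip s K) (powNL s) (Icc (-K) K) := by
    refine (convex_Icc _ _).lipschitzOnWith_of_nnnorm_hasDerivWithin_le
      (fun y _ => (hasDerivAt_powNL hs y).hasDerivWithinAt) fun y hy => ?_
    rw [← NNReal.coe_le_coe, coe_nnnorm, cutLip, Real.coe_toNNReal _ (mul_nonneg (by linarith)
      (Real.rpow_nonneg hK _)), Real.norm_of_nonneg (mul_nonneg (by linarith)
      (Real.rpow_nonneg (abs_nonneg _) _))]
    exact mul_le_mul_of_nonneg_left (Real.rpow_le_rpow (abs_nonneg _) (abs_le.2 hy) (by linarith))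
      (by linarith)
  have h2 : LipschitzWith 1 fun y : ℝ => max (-K) (min y K) :=
    (LipschitzWith.id.min_const K).const_max (-K)
  refine LipschitzWith.of_dist_le_mul fun x y => ?_
  have hm : ∀ z : ℝ, max (-K) (min z K) ∈ Icc (-K) K := fun z =>
    ⟨le_max_left _ _, max_le (by linarith) (min_le_right _ _)⟩
  refine (h1.dist_le_mul _ (hm x) _ (hm y)).trans ?_
  have := h2.dist_le_mul x y
  rw [NNReal.coe_one, one_mul] at this
  exact mul_le_mul_of_nonneg_left this (NNReal.coe_nonneg _)

/-- The primitive of `cutNL s K`. -/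
def cutPot (s K y : ℝ) : ℝ := ∫ z in (0 : ℝ)..y, cutNL s K z

/-- First order Taylor expansion with Lipschitz derivative. The sharp constant would be half as
large, which is not needed. -/
theorem cutPot_sub_le {s K : ℝ} (hs : 2 < s) (hK : 0 ≤ K) (a b : ℝ) :
    |cutPot s K a - cutPot s K b - cutNL s K b * (a - b)| ≤ cutLip s K * (a - b) ^ 2 := by
  have hl := lipschitzWith_cutNL hs hK
  have hi : ∀ x y, IntervalIntegrable (cutNL s K) volume x y := fun x y =>
    hl.continuous.intervalIntegrable x y
  have h1 : cutPot s K a - cutPot s K b - cutNL s K b * (a - b) =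
      ∫ z in b..a, (cutNL s K z - cutNL s K b) := by
    rw [intervalIntegral.integral_sub (hi _ _) intervalIntegrable_const, cutPot, cutPot,
      intervalIntegral.integral_interval_sub_left (hi _ _) (hi _ _)]
    simp [mul_comm]
  rw [h1, ← Real.norm_eq_abs]
  refine (intervalIntegral.norm_integral_le_of_norm_le_const (C := cutLip s K * |a - b|)
    fun z hz => ?_).trans (le_of_eq ?_)
  · rw [← dist_eq_norm]
    refine (hl.dist_le_mul z b).trans (mul_le_mul_of_nonneg_left ?_ (NNReal.coe_nonneg _))
    rw [Real.dist_eq]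
    exact abs_sub_left_of_mem_uIcc (uIoc_subset_uIcc hz)
  · rw [mul_assoc, abs_mul_abs_self]; ring

theorem continuous_cutPot {s K : ℝ} (hs : 2 < s) (hK : 0 ≤ K) : Continuous (cutPot s K) :=
  intervalIntegral.continuous_primitive
    (fun x y => (lipschitzWith_cutNL hs hK).continuous.intervalIntegrable x y) 0

theorem cutPot_zero (s K : ℝ) : cutPot s K 0 = 0 := intervalIntegral.integral_same

theorem abs_cutPot_le {s K : ℝ} (hs : 2 < s) (hK : 0 ≤ K) (a : ℝ) :
    |cutPot s K a| ≤ cutLip s K * a ^ 2 := by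
  simpa [cutPot_zero, cutNL_zero hK] using cutPot_sub_le hs hK a 0

theorem cutPot_eq {s K y : ℝ} (hs : 2 < s) (h : |y| ≤ K) : cutPot s K y = 1 / s * |y| ^ s := by
  have h1 : ∫ z in (0 : ℝ)..y, cutNL s K z = ∫ z in (0 : ℝ)..y, powNL s z := by
    refine intervalIntegral.integral_congr fun z hz => cutNL_eq (le_trans ?_ h)
    simpa using abs_sub_left_of_mem_uIcc hz
  rw [cutPot, h1, intervalIntegral.integral_eq_sub_of_hasDerivAt
    (f := fun y => 1 / s * |y| ^ s) (fun z _ => ?_) ((continuous_powNL hs).intervalIntegrable _ _)]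
  · rw [abs_zero, Real.zero_rpow (by linarith)]; ring
  · refine ((hasDerivAt_abs_rpow z (by linarith)).const_mul (1 / s)).congr_deriv ?_
    rw [powNL]
    have : s ≠ 0 := by linarith
    field_simp

/-! ### The phase space of velocities -/

/-- Velocities: an interior part in `L²(0, 1)` and the two boundary values. -/
abbrev Vel : Type := WithLp 2 (L2I × WithLp 2 (ℝ × ℝ))

namespace Vel

/-- The interior part. -/
def interior : Vel →L[ℝ] L2I := WithLp.fstL 2 ℝ L2I (WithLp 2 (ℝ × ℝ))

/-- The boundary value at `0`. -/
def left : Vel →L[ℝ] ℝ := (WithLp.fstL 2 ℝ ℝ ℝ).comp (WithLp.sndL 2 ℝ L2I (WithLp 2 (ℝ × ℝ)))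

/-- The boundary value at `1`. -/
def right : Vel →L[ℝ] ℝ := (WithLp.sndL 2 ℝ ℝ ℝ).comp (WithLp.sndL 2 ℝ L2I (WithLp 2 (ℝ × ℝ)))

/-- Assembling a velocity from its parts. -/
def mkL : (L2I × ℝ × ℝ) →L[ℝ] Vel :=
  ((WithLp.prodContinuousLinearEquiv 2 ℝ L2I (WithLp 2 (ℝ × ℝ))).symm : _ →L[ℝ] Vel).comp
    ((ContinuousLinearMap.fst ℝ L2I (ℝ × ℝ)).prod
      (((WithLp.prodContinuousLinearEquiv 2 ℝ ℝ ℝ).symm : ℝ × ℝ →L[ℝ] WithLp 2 (ℝ × ℝ)).comp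
        (ContinuousLinearMap.snd ℝ L2I (ℝ × ℝ))))

@[simp] theorem interior_mkL (z : L2I × ℝ × ℝ) : interior (mkL z) = z.1 := rfl
@[simp] theorem left_mkL (z : L2I × ℝ × ℝ) : left (mkL z) = z.2.1 := rfl
@[simp] theorem right_mkL (z : L2I × ℝ × ℝ) : right (mkL z) = z.2.2 := rfl

theorem ext {y z : Vel} (h1 : interior y = interior z) (h2 : left y = left z)
    (h3 : right y = right z) : y = z := by
  have : ∀ y : Vel, y = mkL (interior y, left y, right y) := fun _ => rfl
  rw [this y, this z, h1, h2, h3]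

theorem inner_eq (y z : Vel) : inner ℝ y z =
    (inner ℝ (interior y) (interior z) : ℝ) + left y * left z + right y * right z := by
  rw [WithLp.prod_inner_apply, WithLp.prod_inner_apply]
  simp only [RCLike.inner_apply, conj_trivial]
  rw [add_assoc, mul_comm (left y), mul_comm (right y)]
  rfl

theorem norm_sq (y : Vel) : ‖y‖ ^ 2 = ‖interior y‖ ^ 2 + left y ^ 2 + right y ^ 2 := by
  rw [← real_inner_self_eq_norm_sq, inner_eq, real_inner_self_eq_norm_sq]; ring

end Vel

open Vel

/-- The inclusion of `H¹(0, 1)` together with its boundary values. -/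
def traceL : H1 →L[ℝ] Vel :=
  mkL.comp (H1.toL2L.prod ((H1.evalL 0).prod (H1.evalL 1)))

@[simp] theorem interior_traceL (v : H1) : interior (traceL v) = v.toL2 := rfl
@[simp] theorem left_traceL (v : H1) : left (traceL v) = v.rep 0 := rfl
@[simp] theorem right_traceL (v : H1) : right (traceL v) = v.rep 1 := rfl

/-- The damping operator. -/
def dampL (P : Params) : Vel →L[ℝ] Vel :=
  mkL.comp ((P.lam • interior).prod
    ((P.lam0 • left + P.lamt1 • right).prod (P.lam1 • right + P.lamt0 • left)))

@[simp] theorem interior_dampL (P : Params) (y : Vel) :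
    interior (dampL P y) = P.lam • interior y := rfl
@[simp] theorem left_dampL (P : Params) (y : Vel) :
    left (dampL P y) = P.lam0 * left y + P.lamt1 * right y := rfl
@[simp] theorem right_dampL (P : Params) (y : Vel) :
    right (dampL P y) = P.lam1 * right y + P.lamt0 * left y := rfl

theorem Params.A2.disc_pos {P : Params} (h : P.A2) :
    0 < -(P.lamt0 + P.lamt1) ^ 2 + 4 * P.lam0 * P.lam1 := by
  obtain ⟨h0, h1, h2⟩ := h
  have h3 := pow_lt_pow_left₀ h2 (abs_nonneg _) two_ne_zero
  rw [sq_abs, mul_pow, Real.sq_sqrt (by positivity)] at h3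
  linarith

theorem Params.A2.muStar_pos {P : Params} (h : P.A2) : 0 < P.muStar := by
  have := h.disc_pos
  have h0 := h.1
  have h1 := h.2.1
  unfold Params.muStar
  positivity

/-- Completing the square in a leaves (4λ₀λ₁ − σ²)/(4λ₀)·b², and completing it in b leaves (4λ₀λ₁ −
σ²)/(4λ₁)·a². The number μ_* is the smaller of the two coefficients, and averaging the two bounds
gives μ_*/2. -/
theorem Params.A2.quadratic_ge {P : Params} (h : P.A2) (a b : ℝ) :
    P.muStar / 2 * (a ^ 2 + b ^ 2) ≤
      P.lam0 * a ^ 2 + (P.lamt0 + P.lamt1) * (a * b) + P.lam1 * b ^ 2 := by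
  have hd := h.disc_pos
  have h0 := h.1
  have h1 := h.2.1
  set σ := P.lamt0 + P.lamt1
  have e1 : P.muStar ≤ 1 / 4 * (-σ ^ 2 + 4 * P.lam0 * P.lam1) * (1 / P.lam0) :=
    mul_le_mul_of_nonneg_left (min_le_left _ _) (by linarith)
  have e2 : P.muStar ≤ 1 / 4 * (-σ ^ 2 + 4 * P.lam0 * P.lam1) * (1 / P.lam1) :=
    mul_le_mul_of_nonneg_left (min_le_right _ _) (by linarith)
  have f1 := mul_le_mul_of_nonneg_right e1 (sq_nonneg b)
  have f2 := mul_le_mul_of_nonneg_right e2 (sq_nonneg a)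
  have g1 : P.lam0 * a ^ 2 + σ * (a * b) + P.lam1 * b ^ 2 -
      1 / 4 * (-σ ^ 2 + 4 * P.lam0 * P.lam1) * (1 / P.lam0) * b ^ 2 =
      P.lam0 * (a + σ * b / (2 * P.lam0)) ^ 2 := by field_simp; ring
  have g2 : P.lam0 * a ^ 2 + σ * (a * b) + P.lam1 * b ^ 2 -
      1 / 4 * (-σ ^ 2 + 4 * P.lam0 * P.lam1) * (1 / P.lam1) * a ^ 2 =
      P.lam1 * (b + σ * a / (2 * P.lam1)) ^ 2 := by field_simp; ring
  have k1 : 0 ≤ P.lam0 * (a + σ * b / (2 * P.lam0)) ^ 2 := by positivity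
  have k2 : 0 ≤ P.lam1 * (b + σ * a / (2 * P.lam1)) ^ 2 := by positivity
  linarith

/-- The rate of dissipation that is left after absorbing the nonlocal boundary terms. -/
def Params.dissip (P : Params) : ℝ := min P.lam (P.muStar / 4)

theorem Params.dissip_pos {P : Params} (h1 : P.A1) (h2 : P.A2) : 0 < P.dissip :=
  lt_min h1.2.2.2 (by linarith [h2.muStar_pos])

theorem inner_dampL_ge {P : Params} (h2 : P.A2) (y : Vel) :
    P.lam * ‖interior y‖ ^ 2 + P.muStar / 2 * (left y ^ 2 + right y ^ 2) ≤
      inner ℝ (dampL P y) y := by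
  rw [Vel.inner_eq, interior_dampL, left_dampL, right_dampL, real_inner_smul_left,
    real_inner_self_eq_norm_sq]
  have := h2.quadratic_ge (left y) (right y)
  linarith

theorem dissip_mul_le {P : Params} (h2 : P.A2) (y : Vel) :
    P.dissip * ‖y‖ ^ 2 ≤ inner ℝ (dampL P y) y := by
  refine le_trans ?_ (inner_dampL_ge h2 y)
  have hμ := h2.muStar_pos
  have e1 : P.dissip ≤ P.lam := min_le_left _ _
  have e2 : P.dissip ≤ P.muStar / 2 := (min_le_right _ _).trans (by linarith)
  rw [Vel.norm_sq]
  have f1 := mul_le_mul_of_nonneg_right e1 (sq_nonneg ‖interior y‖)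
  have f2 := mul_le_mul_of_nonneg_right e2 (sq_nonneg (left y))
  have f3 := mul_le_mul_of_nonneg_right e2 (sq_nonneg (right y))
  linarith

/-- The nonlocal boundary operator with coefficients `h0, h1`. -/
def couple (h0 h1 : ℝ) (v : H1) : Vel := mkL (0, h1 * v.rep 1, h0 * v.rep 0)

/-- Half of the boundary dissipation μ_*/2 absorbs the nonlocal terms by Young's inequality and the
other half is kept. The trace bound contributes the factor 2 in 2/μ_*. -/
theorem neg_inner_dampL_sub_inner_couple_le {P : Params} (h2 : P.A2) (h0 h1 : ℝ) (v : H1)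
    (y : Vel) : -inner ℝ (dampL P y) y - inner ℝ (couple h0 h1 v) y ≤
      -(P.dissip * ‖y‖ ^ 2) + 2 / P.muStar * (h0 ^ 2 + h1 ^ 2) * ‖v‖ ^ 2 := by
  have hμ := h2.muStar_pos
  have h3 := inner_dampL_ge h2 y
  have e1 : P.dissip ≤ P.lam := min_le_left _ _
  have e2 : P.dissip ≤ P.muStar / 4 := min_le_right _ _
  have f1 := mul_le_mul_of_nonneg_right e1 (sq_nonneg ‖interior y‖)
  have f2 := mul_le_mul_of_nonneg_right e2 (sq_nonneg (left y))
  have f3 := mul_le_mul_of_nonneg_right e2 (sq_nonneg (right y))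
  have young : ∀ a b : ℝ, -(a * b) ≤ P.muStar / 4 * b ^ 2 + 1 / P.muStar * a ^ 2 := by
    intro a b
    have : P.muStar / 4 * b ^ 2 + 1 / P.muStar * a ^ 2 + a * b =
        1 / P.muStar * (a + P.muStar / 2 * b) ^ 2 := by field_simp; ring
    have h4 : 0 ≤ 1 / P.muStar * (a + P.muStar / 2 * b) ^ 2 := by positivity
    linarith
  have g1 := young (h1 * v.rep 1) (left y)
  have g2 := young (h0 * v.rep 0) (right y)
  have t0 := mul_le_mul_of_nonneg_left (v.rep_sq_le (x := 0) (by simp)) (sq_nonneg h0)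
  have t1 := mul_le_mul_of_nonneg_left (v.rep_sq_le (x := 1) (by simp)) (sq_nonneg h1)
  have t2 := mul_le_mul_of_nonneg_left (add_le_add t0 t1) (show 0 ≤ 1 / P.muStar by positivity)
  rw [Vel.inner_eq (couple h0 h1 v), Vel.norm_sq]
  simp only [couple, interior_mkL, left_mkL, right_mkL, inner_zero_left]
  have t3 : 2 / P.muStar * (h0 ^ 2 + h1 ^ 2) * ‖v‖ ^ 2 =
      1 / P.muStar * (h0 ^ 2 * (2 * ‖v‖ ^ 2) + h1 ^ 2 * (2 * ‖v‖ ^ 2)) := by ring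
  rw [t3]
  linarith

end

/-! ### The chain rule for potentials with Lipschitz gradient -/

section

section ChainRule

variable {Y : Type*} [NormedAddCommGroup Y] [InnerProductSpace ℝ Y] [CompleteSpace Y]

/-- Cauchy–Schwarz in time, from nonnegativity of the variance of ‖y‖ about its mean m. -/
theorem intervalIntegral_norm_sq_le {T s t : ℝ} {y : ℝ → Y}
    (hy : MemLp y 2 (volume.restrict (Ioc 0 T))) (hs : 0 ≤ s) (hst : s ≤ t) (ht : t ≤ T) :
    (∫ σ in s..t, ‖y σ‖) ^ 2 ≤ (t - s) * ∫ σ in s..t, ‖y σ‖ ^ 2 := by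
  have hsub : Ioc s t ⊆ Ioc 0 T := Ioc_subset_Ioc hs ht
  have m1 : MemLp y 2 (volume.restrict (Ioc s t)) :=
    hy.mono_measure (Measure.restrict_mono hsub le_rfl)
  rcases hst.eq_or_lt with rfl | hlt
  · simp
  have i1 : IntervalIntegrable (fun σ => ‖y σ‖) volume s t :=
    (MemLp.intervalIntegrable_of_le hy hs hst ht).norm
  have i2 : IntervalIntegrable (fun σ => ‖y σ‖ ^ 2) volume s t := by
    rw [intervalIntegrable_iff_integrableOn_Ioc_of_le hst]
    exact m1.integrable_norm_pow (by norm_num)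
  set A := ∫ σ in s..t, ‖y σ‖ with hA
  set m := A / (t - s) with hm
  have h1 : 0 ≤ ∫ σ in s..t, (‖y σ‖ - m) ^ 2 :=
    intervalIntegral.integral_nonneg hst fun σ _ => sq_nonneg _
  have h2 : ∫ σ in s..t, (‖y σ‖ - m) ^ 2 =
      (∫ σ in s..t, ‖y σ‖ ^ 2) - 2 * m * A + m ^ 2 * (t - s) := by
    have : ∀ σ, (‖y σ‖ - m) ^ 2 = ‖y σ‖ ^ 2 - 2 * m * ‖y σ‖ + m ^ 2 := fun σ => by ring
    simp only [this]
    rw [intervalIntegral.integral_add (i2.sub (i1.const_mul _)) intervalIntegrable_const,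
      intervalIntegral.integral_sub i2 (i1.const_mul _), intervalIntegral.integral_const_mul,
      intervalIntegral.integral_const, smul_eq_mul]
    ring
  have hpos : 0 < t - s := by linarith
  have h3 : m * (t - s) = A := by rw [hm]; field_simp
  have h4 : m ^ 2 * (t - s) = m * A := by rw [← h3]; ring
  rw [h2, h4] at h1
  have h5 := mul_nonneg hpos.le h1
  have h6 : (t - s) * (2 * m * A) = 2 * A ^ 2 := by rw [← h3]; ring
  have h7 : (t - s) * (m * A) = A ^ 2 := by rw [← h3]; ring
  nlinarith

/-- On n + 1 equal steps the right-hand sides telescope in F with the common factor t/(n+1), so the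
total increment of φ is O(1/n). -/
theorem eq_of_abs_sub_le_mul_sub {T C : ℝ} {φ F : ℝ → ℝ}
    (h : ∀ s t, 0 ≤ s → s ≤ t → t ≤ T → |φ t - φ s| ≤ C * (t - s) * (F t - F s)) :
    ∀ t ∈ Icc 0 T, φ t = φ 0 := by
  intro t ht
  have key : ∀ n : ℕ, |φ t - φ 0| ≤ C * t * (F t - F 0) / (n + 1 : ℝ) := by
    intro n
    have hn : (0 : ℝ) < n + 1 := by positivity
    let x : ℕ → ℝ := fun k => k * (t / (n + 1))
    have hd : 0 ≤ t / (n + 1) := div_nonneg ht.1 hn.le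
    have e1 : x (n + 1) = t := by simp only [x]; push_cast; field_simp
    have e0 : x 0 = 0 := by simp [x]
    have hst : ∀ k, x (k + 1) - x k = t / (n + 1) := fun k => by simp only [x]; push_cast; ring
    have h1 : ∀ k ∈ Finset.range (n + 1), |φ (x (k + 1)) - φ (x k)| ≤
        C * (t / (n + 1)) * (F (x (k + 1)) - F (x k)) := by
      intro k hk
      rw [← hst k]
      refine h _ _ (by positivity) (by linarith [hst k]) ?_
      refine le_trans ?_ (e1.le.trans ht.2)
      have : ((k + 1 : ℕ) : ℝ) ≤ ((n + 1 : ℕ) : ℝ) := by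
        exact_mod_cast Finset.mem_range.1 hk
      exact mul_le_mul_of_nonneg_right this hd
    have h2 := Finset.sum_le_sum h1
    rw [← Finset.mul_sum, Finset.sum_range_sub (fun k => F (x k)), e1, e0] at h2
    have h3 := Finset.abs_sum_le_sum_abs (fun k => φ (x (k + 1)) - φ (x k)) (Finset.range (n + 1))
    rw [Finset.sum_range_sub (fun k => φ (x k)), e1, e0] at h3
    refine (h3.trans h2).trans (le_of_eq ?_)
    ring
  have h3 : Tendsto (fun n : ℕ => C * t * (F t - F 0) / (n + 1 : ℝ)) atTop (𝓝 0) := by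
    have := (tendsto_one_div_add_atTop_nhds_zero_nat (𝕜 := ℝ)).const_mul (C * t * (F t - F 0))
    simpa [mul_div_assoc, div_eq_mul_inv] using this
  have h4 := ge_of_tendsto' h3 key
  exact sub_eq_zero.1 (abs_nonpos_iff.1 h4)

/-- The chain rule for a potential with Lipschitz gradient along a curve with square integrable
derivative. -/
theorem potential_eq_add_integral {T : ℝ} {X y : ℝ → Y} {G : Y → ℝ} {N : Y → Y} {L : NNReal}
    (hN : LipschitzWith L N) (hG : ∀ a b, |G a - G b - inner ℝ (N b) (a - b)| ≤ L * ‖a - b‖ ^ 2)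
    (hy : MemLp y 2 (volume.restrict (Ioc 0 T)))
    (hX : ∀ t ∈ Icc 0 T, X t = X 0 + ∫ s in (0 : ℝ)..t, y s) (hXc : ContinuousOn X (Icc 0 T)) :
    IntegrableOn (fun s => inner ℝ (N (X s)) (y s)) (Ioc 0 T) ∧
    ∀ t ∈ Icc 0 T, G (X t) = G (X 0) + ∫ s in (0 : ℝ)..t, inner ℝ (N (X s)) (y s) := by
  have hNX : ContinuousOn (fun s => N (X s)) (Icc 0 T) := hN.continuous.comp_continuousOn hXc
  have hint : IntegrableOn (fun s => inner ℝ (N (X s)) (y s)) (Ioc 0 T) :=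
    integrable_inner_of_memLp (ContinuousOn.memLp_two hNX) hy
  refine ⟨hint, ?_⟩
  have hii : ∀ s t, 0 ≤ s → s ≤ t → t ≤ T →
      IntervalIntegrable (fun s => inner ℝ (N (X s)) (y s)) volume s t := fun s t h0 hst ht => by
    rw [intervalIntegrable_iff_integrableOn_Ioc_of_le hst]
    exact hint.mono_set (Ioc_subset_Ioc h0 ht)
  have hi2 : ∀ s t, 0 ≤ s → s ≤ t → t ≤ T →
      IntervalIntegrable (fun s => ‖y s‖ ^ 2) volume s t := fun s t h0 hst ht => by
    rw [intervalIntegrable_iff_integrableOn_Ioc_of_le hst]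
    have : IntegrableOn (fun s => ‖y s‖ ^ 2) (Ioc 0 T) := hy.integrable_norm_pow (by norm_num)
    exact this.mono_set (Ioc_subset_Ioc h0 ht)
  have hXst : ∀ s t, 0 ≤ s → s ≤ t → t ≤ T → X t - X s = ∫ σ in s..t, y σ := fun s t h0 hst ht => by
    rw [hX t ⟨h0.trans hst, ht⟩, hX s ⟨h0, hst.trans ht⟩, add_sub_add_left_eq_sub]
    exact intervalIntegral.integral_interval_sub_left
      (MemLp.intervalIntegrable_of_le hy le_rfl (h0.trans hst) ht)
      (MemLp.intervalIntegrable_of_le hy le_rfl h0 (hst.trans ht))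
  -- The defect G(X) − ∫⟨N(X), y⟩ has increments of second order: the Taylor remainder of G and the
  -- variation of N along the curve each cost at most L(∫‖y‖)² ≤ L(t − s)∫‖y‖². Hence the constant
  -- 2L.
  have hconst := eq_of_abs_sub_le_mul_sub (T := T) (C := 2 * L)
    (φ := fun t => G (X t) - ∫ s in (0 : ℝ)..t, inner ℝ (N (X s)) (y s))
    (F := fun t => ∫ s in (0 : ℝ)..t, ‖y s‖ ^ 2) fun s t h0 hst ht => by
      have iy := MemLp.intervalIntegrable_of_le hy h0 hst ht
      have n1 : ∀ σ ∈ Icc s t, ‖X σ - X s‖ ≤ ∫ σ in s..t, ‖y σ‖ := fun σ hσ => by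
        rw [hXst s σ h0 hσ.1 (hσ.2.trans ht)]
        refine (intervalIntegral.norm_integral_le_integral_norm hσ.1).trans ?_
        exact intervalIntegral.integral_mono_interval le_rfl hσ.1 hσ.2
          (Eventually.of_forall fun _ => norm_nonneg _) iy.norm
      set A := ∫ σ in s..t, ‖y σ‖ with hA
      have hA0 : 0 ≤ A := intervalIntegral.integral_nonneg hst fun _ _ => norm_nonneg _
      have e1 : (∫ s in (0 : ℝ)..t, inner ℝ (N (X s)) (y s)) -
          ∫ σ in (0 : ℝ)..s, inner ℝ (N (X σ)) (y σ) = ∫ σ in s..t, inner ℝ (N (X σ)) (y σ) :=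
        intervalIntegral.integral_interval_sub_left (hii _ _ le_rfl (h0.trans hst) ht)
          (hii _ _ le_rfl h0 (hst.trans ht))
      have e2 : (∫ s in (0 : ℝ)..t, ‖y s‖ ^ 2) - ∫ σ in (0 : ℝ)..s, ‖y σ‖ ^ 2 =
          ∫ σ in s..t, ‖y σ‖ ^ 2 :=
        intervalIntegral.integral_interval_sub_left (hi2 _ _ le_rfl (h0.trans hst) ht)
          (hi2 _ _ le_rfl h0 (hst.trans ht))
      have e3 : inner ℝ (N (X s)) (X t - X s) = ∫ σ in s..t, inner ℝ (N (X s)) (y σ) := by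
        rw [hXst s t h0 hst ht, intervalIntegral.integral_of_le hst,
          intervalIntegral.integral_of_le hst, ← integral_inner
          ((intervalIntegrable_iff_integrableOn_Ioc_of_le hst).1 iy)]
      have b1 := hG (X t) (X s)
      have b2 : |∫ σ in s..t, (inner ℝ (N (X σ)) (y σ) - inner ℝ (N (X s)) (y σ))| ≤ L * A * A := by
        rw [← Real.norm_eq_abs]
        refine (intervalIntegral.norm_integral_le_integral_norm hst).trans ?_
        rw [hA, ← intervalIntegral.integral_const_mul]
        have ic : IntervalIntegrable (fun σ => inner ℝ (N (X s)) (y σ)) volume s t := by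
          rw [intervalIntegrable_iff_integrableOn_Ioc_of_le hst] at iy ⊢
          exact iy.const_inner _
        refine intervalIntegral.integral_mono_on hst ((hii _ _ h0 hst ht).sub ic).norm
          (iy.norm.const_mul _) fun σ hσ => ?_
        rw [← inner_sub_left]
        refine (norm_inner_le_norm _ _).trans (mul_le_mul_of_nonneg_right ?_ (norm_nonneg _))
        exact (hN.norm_sub_le _ _).trans (mul_le_mul_of_nonneg_left (n1 σ hσ) L.2)
      rw [intervalIntegral.integral_sub (hii _ _ h0 hst ht) (by
        rw [intervalIntegrable_iff_integrableOn_Ioc_of_le hst] at iy ⊢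
        exact iy.const_inner _), ← e3] at b2
      have b3 : ‖X t - X s‖ ^ 2 ≤ A ^ 2 :=
        pow_le_pow_left₀ (norm_nonneg _) (n1 t ⟨hst, le_rfl⟩) 2
      have b4 := intervalIntegral_norm_sq_le hy h0 hst ht
      have e4 : (G (X t) - ∫ s in (0 : ℝ)..t, inner ℝ (N (X s)) (y s)) -
          (G (X s) - ∫ σ in (0 : ℝ)..s, inner ℝ (N (X σ)) (y σ)) =
          (G (X t) - G (X s) - inner ℝ (N (X s)) (X t - X s)) -
          ((∫ σ in s..t, inner ℝ (N (X σ)) (y σ)) - inner ℝ (N (X s)) (X t - X s)) := by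
        rw [← e1]; ring
      rw [e4, e2]
      refine (abs_sub _ _).trans ?_
      have hL : (0 : ℝ) ≤ L := L.2
      have b5 := mul_le_mul_of_nonneg_left b3 hL
      have b6 := mul_le_mul_of_nonneg_left b4 hL
      nlinarith
  intro t ht
  have h1 := hconst t ht
  simp only [intervalIntegral.integral_same] at h1
  linarith

end ChainRule

open Vel

/-! ### Potential and gradient of the truncated nonlinearities -/

/-- The hypotheses `p, α, β > 2`. -/
structure Params.Superlinear (P : Params) : Prop where
  p : 2 < P.p
  α : 2 < P.α
  β : 2 < P.β

theorem Params.A1.superlinear {P : Params} (h : P.A1) : P.Superlinear := ⟨h.1, h.2.1, h.2.2.1⟩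

/-- The nonlinear source as a map on velocities, truncated at height `K`. -/
def grad (P : Params) (hP : P.Superlinear) (K : ℝ) (hK : 0 ≤ K) (y : Vel) : Vel :=
  mkL ((lipschitzWith_cutNL hP.p hK).compLp (cutNL_zero hK) (interior y),
    cutNL P.α K (left y), cutNL P.β K (right y))

/-- The potential of `grad`. -/
def potential (P : Params) (K : ℝ) (y : Vel) : ℝ :=
  (∫ x in Ioo 0 1, cutPot P.p K (interior y x)) + cutPot P.α K (left y) + cutPot P.β K (right y)

/-- A Lipschitz constant of `grad`. -/
def gradLip (P : Params) (K : ℝ) : NNReal := cutLip P.p K + cutLip P.α K + cutLip P.β K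

variable {P : Params} (hP : P.Superlinear) {K : ℝ} (hK : 0 ≤ K)

theorem lipschitzWith_grad : LipschitzWith (gradLip P K) (grad P hP K hK) := by
  refine LipschitzWith.of_dist_le_mul fun y z => ?_
  rw [dist_eq_norm, dist_eq_norm]
  refine abs_le_of_sq_le_sq' ?_ (by positivity) |>.2
  rw [Vel.norm_sq, mul_pow, Vel.norm_sq (y - z)]
  simp only [map_sub, grad, interior_mkL, left_mkL, right_mkL]
  have a0 : (0 : ℝ) ≤ cutLip P.p K := NNReal.coe_nonneg _
  have a1 : (0 : ℝ) ≤ cutLip P.α K := NNReal.coe_nonneg _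
  have a2 : (0 : ℝ) ≤ cutLip P.β K := NNReal.coe_nonneg _
  have hL : (gradLip P K : ℝ) = cutLip P.p K + cutLip P.α K + cutLip P.β K := by
    simp [gradLip]
  have h1 : ‖(lipschitzWith_cutNL hP.p hK).compLp (cutNL_zero hK) (interior y) -
      (lipschitzWith_cutNL hP.p hK).compLp (cutNL_zero hK) (interior z)‖ ^ 2 ≤
      (gradLip P K : ℝ) ^ 2 * ‖interior y - interior z‖ ^ 2 := by
    rw [← mul_pow]
    refine pow_le_pow_left₀ (norm_nonneg _) (((lipschitzWith_cutNL hP.p hK).norm_compLp_sub_le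
      (cutNL_zero hK) _ _).trans (mul_le_mul_of_nonneg_right (by linarith) (norm_nonneg _))) 2
  have h2 : ∀ {s : ℝ}, 2 < s → (cutLip s K : ℝ) ≤ gradLip P K → ∀ a b : ℝ,
      (cutNL s K a - cutNL s K b) ^ 2 ≤ (gradLip P K : ℝ) ^ 2 * (a - b) ^ 2 := by
    intro s hs hle a b
    have := (lipschitzWith_cutNL hs hK).dist_le_mul a b
    rw [Real.dist_eq, Real.dist_eq] at this
    rw [← mul_pow, ← sq_abs, ← sq_abs (_ * (a - b)), abs_mul, abs_of_nonneg (NNReal.coe_nonneg _)]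
    exact pow_le_pow_left₀ (abs_nonneg _)
      (this.trans (mul_le_mul_of_nonneg_right hle (abs_nonneg _))) 2
  have h3 := h2 hP.α (by linarith) (left y) (left z)
  have h4 := h2 hP.β (by linarith) (right y) (right z)
  linarith

theorem grad_zero : grad P hP K hK 0 = 0 := by
  refine Vel.ext ?_ ?_ ?_
  · simp only [grad, interior_mkL, map_zero]
    exact LipschitzWith.compLp_zero _ _
  · simp [grad, cutNL_zero hK]
  · simp [grad, cutNL_zero hK]

theorem inner_grad (y z : Vel) : inner ℝ (grad P hP K hK y) z =
    (∫ x in Ioo 0 1, cutNL P.p K (interior y x) * interior z x) +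
      cutNL P.α K (left y) * left z + cutNL P.β K (right y) * right z := by
  rw [Vel.inner_eq]
  simp only [grad, interior_mkL, left_mkL, right_mkL]
  congr 2
  rw [L2.inner_def]
  refine integral_congr_ae ?_
  filter_upwards [LipschitzWith.coeFn_compLp (lipschitzWith_cutNL hP.p hK) (cutNL_zero hK)
    (interior y)] with x hx
  rw [hx]
  simp [mul_comm]

theorem integrableOn_cutPot {s : ℝ} (hs : 2 < s) (hK : 0 ≤ K) (f : L2I) :
    IntegrableOn (fun x => cutPot s K (f x)) (Ioo 0 1) := by
  have h1 : IntegrableOn (fun x => f x ^ 2) (Ioo 0 1) := (Lp.memLp f).integrable_sq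
  refine Integrable.mono' (h1.const_mul (cutLip s K : ℝ)) ?_ (Eventually.of_forall fun x => ?_)
  · exact (continuous_cutPot hs hK).comp_aestronglyMeasurable (Lp.aestronglyMeasurable f)
  · exact abs_cutPot_le hs hK _

/-- The scalar Taylor bounds, integrated over the interior and added to the two boundary ones. This
is the hypothesis under which the chain rule `potential_eq_add_integral` applies. -/
theorem abs_potential_sub_le (y z : Vel) :
    |potential P K y - potential P K z - inner ℝ (grad P hP K hK z) (y - z)| ≤
      gradLip P K * ‖y - z‖ ^ 2 := by
  have i1 := integrableOn_cutPot hP.p hK (interior y)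
  have i2 := integrableOn_cutPot hP.p hK (interior z)
  have hl := lipschitzWith_cutNL hP.p hK
  have i3 : IntegrableOn (fun x => cutNL P.p K (interior z x) * interior (y - z) x) (Ioo 0 1) := by
    have := L2.integrable_inner (𝕜 := ℝ) (interior (y - z)) (hl.compLp (cutNL_zero hK) (interior z))
    refine this.congr ?_
    filter_upwards [LipschitzWith.coeFn_compLp hl (cutNL_zero hK) (interior z)] with x hx
    rw [hx]
    simp
  have i4 : IntegrableOn (fun x => interior (y - z) x ^ 2) (Ioo 0 1) :=
    (Lp.memLp (interior (y - z))).integrable_sq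
  have h0 : |(∫ x in Ioo 0 1, cutPot P.p K (interior y x)) -
      (∫ x in Ioo 0 1, cutPot P.p K (interior z x)) -
      ∫ x in Ioo 0 1, cutNL P.p K (interior z x) * interior (y - z) x| ≤
      cutLip P.p K * ‖interior (y - z)‖ ^ 2 := by
    have i12 : IntegrableOn (fun x => cutPot P.p K (interior y x) - cutPot P.p K (interior z x))
        (Ioo 0 1) := i1.sub i2
    rw [← integral_sub i1 i2, ← integral_sub i12 i3, ← real_inner_self_eq_norm_sq,
      L2.inner_def, ← MeasureTheory.integral_const_mul, ← Real.norm_eq_abs]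
    refine norm_integral_le_of_norm_le ((i4.const_mul (cutLip P.p K : ℝ)).congr
      (Eventually.of_forall fun x => by simp [sq])) ?_
    have : (interior (y - z) : ℝ → ℝ) =ᵐ[volI] fun x => interior y x - interior z x := by
      rw [map_sub]
      exact Lp.coeFn_sub _ _
    filter_upwards [this] with x hx
    rw [hx]
    refine (cutPot_sub_le hP.p hK _ _).trans (le_of_eq ?_)
    simp [sq]
  have h1 := cutPot_sub_le hP.α hK (left y) (left z)
  have h2 := cutPot_sub_le hP.β hK (right y) (right z)
  rw [inner_grad, Vel.norm_sq]
  have e : potential P K y - potential P K z -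
      ((∫ x in Ioo 0 1, cutNL P.p K (interior z x) * interior (y - z) x) +
      cutNL P.α K (left z) * left (y - z) + cutNL P.β K (right z) * right (y - z)) =
      ((∫ x in Ioo 0 1, cutPot P.p K (interior y x)) -
      (∫ x in Ioo 0 1, cutPot P.p K (interior z x)) -
      ∫ x in Ioo 0 1, cutNL P.p K (interior z x) * interior (y - z) x) +
      (cutPot P.α K (left y) - cutPot P.α K (left z) - cutNL P.α K (left z) * (left y - left z)) +
      (cutPot P.β K (right y) - cutPot P.β K (right z) -
        cutNL P.β K (right z) * (right y - right z)) := by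
    rw [map_sub left, map_sub right, potential, potential]; ring
  rw [e]
  refine (abs_add_three _ _ _).trans ?_
  have a0 : (0 : ℝ) ≤ cutLip P.p K := NNReal.coe_nonneg _
  have a1 : (0 : ℝ) ≤ cutLip P.α K := NNReal.coe_nonneg _
  have a2 : (0 : ℝ) ≤ cutLip P.β K := NNReal.coe_nonneg _
  have hL : (gradLip P K : ℝ) = cutLip P.p K + cutLip P.α K + cutLip P.β K := by
    simp [gradLip]
  rw [map_sub left, map_sub right, hL]
  nlinarith [sq_nonneg ‖interior (y - z)‖, sq_nonneg (left y - left z),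
    sq_nonneg (right y - right z), mul_nonneg a1 (sq_nonneg ‖interior (y - z)‖),
    mul_nonneg a2 (sq_nonneg ‖interior (y - z)‖), mul_nonneg a0 (sq_nonneg (left y - left z)),
    mul_nonneg a2 (sq_nonneg (left y - left z)), mul_nonneg a0 (sq_nonneg (right y - right z)),
    mul_nonneg a1 (sq_nonneg (right y - right z))]

end

/-! ### Weak solutions as abstract evolutions -/

section

open Vel

theorem hasDerivWithinAt_integral_Icc {E : Type*} [NormedAddCommGroup E] [NormedSpace ℝ E]
    [CompleteSpace E] {T : ℝ} {w : ℝ → E} (hw : ContinuousOn w (Icc 0 T)) {t : ℝ}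
    (ht : t ∈ Icc 0 T) :
    HasDerivWithinAt (fun s => ∫ σ in (0 : ℝ)..s, w σ) (w t) (Icc 0 T) t := by
  have hT : 0 ≤ T := ht.1.trans ht.2
  have hc : Continuous (IccExtend hT ((Icc 0 T).domRestrict w)) :=
    hw.domRestrict.Icc_extend'
  have he : ∀ s ∈ Icc 0 T, IccExtend hT ((Icc 0 T).domRestrict w) s = w s := fun s hs => by
    rw [IccExtend_of_mem _ _ hs]; rfl
  have h1 := (intervalIntegral.integral_hasDerivAt_right (hc.intervalIntegrable 0 t)
    (hc.stronglyMeasurableAtFilter _ _) hc.continuousAt).hasDerivWithinAt (s := Icc 0 T)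
  rw [he t ht] at h1
  refine h1.congr_of_mem (fun s hs => ?_) ht
  refine intervalIntegral.integral_congr fun σ hσ => (he σ ?_).symm
  rw [uIcc_of_le hs.1] at hσ
  exact ⟨hσ.1, hσ.2.trans hs.2⟩

theorem eq_add_integral_of_hasDerivWithinAt_Icc {E : Type*} [NormedAddCommGroup E]
    [NormedSpace ℝ E] [CompleteSpace E] {T : ℝ} {f w : ℝ → E} (hw : ContinuousOn w (Icc 0 T))
    (hf : ∀ t ∈ Icc 0 T, HasDerivWithinAt f (w t) (Icc 0 T) t) :
    ∀ t ∈ Icc 0 T, f t = f 0 + ∫ s in (0 : ℝ)..t, w s := by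
  intro t ht
  have hsub : Icc 0 t ⊆ Icc 0 T := Icc_subset_Icc_right ht.2
  have h1 : ContinuousOn f (Icc 0 t) := fun s hs =>
    ((hf s (hsub hs)).mono hsub).continuousWithinAt
  have h2 : ∀ s ∈ Ioo 0 t, HasDerivWithinAt f (w s) (Ioi s) s := fun s hs =>
    ((hf s (hsub (Ioo_subset_Icc_self hs))).hasDerivAt
      (Icc_mem_nhds hs.1 (hs.2.trans_le ht.2))).hasDerivWithinAt
  have h3 : IntervalIntegrable w volume 0 t := by
    refine ContinuousOn.intervalIntegrable ?_
    rw [uIcc_of_le ht.1]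
    exact hw.mono hsub
  rw [intervalIntegral.integral_eq_sub_of_hasDeriv_right_of_le ht.1 h1 h2 h3]
  abel

theorem traceL_injective (v : H1) (h : interior (traceL v) = 0) : v = 0 :=
  H1.eq_zero_of_toL2_eq_zero h

theorem traceL_dense (k : L2I) (h : ∀ v, inner ℝ k (interior (traceL v)) = 0) : k = 0 :=
  H1.eq_zero_of_forall_inner_toL2_eq_zero h

theorem couple_sub (a b : ℝ) (u v : H1) : couple a b (u - v) = couple a b u - couple a b v := by
  have h : ∀ x : Icc (0 : ℝ) 1, (u - v).rep x = u.rep x - v.rep x := fun x =>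
    map_sub (H1.evalL x) u v
  have h0 := h 0
  have h1 := h 1
  simp only [Icc.coe_zero, Icc.coe_one] at h0 h1
  refine Vel.ext ?_ ?_ ?_
  · simp [couple]
  · simp only [couple, map_sub, left_mkL, h1]; ring
  · simp only [couple, map_sub, right_mkL, h0]; ring

theorem norm_couple_sq_le (a b : ℝ) (v : H1) :
    ‖couple a b v‖ ^ 2 ≤ 2 * (a ^ 2 + b ^ 2) * ‖v‖ ^ 2 := by
  have t0 := mul_le_mul_of_nonneg_left (v.rep_sq_le (x := 0) (by simp)) (sq_nonneg a)
  have t1 := mul_le_mul_of_nonneg_left (v.rep_sq_le (x := 1) (by simp)) (sq_nonneg b)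
  rw [Vel.norm_sq]
  simp only [couple, interior_mkL, left_mkL, right_mkL, norm_zero]
  linarith

theorem norm_couple_le {a b M : ℝ} (hM : 0 ≤ M) (ha : |a| ≤ M) (hb : |b| ≤ M) (v : H1) :
    ‖couple a b v‖ ≤ 2 * M * ‖v‖ := by
  refine abs_le_of_sq_le_sq' ?_ (by positivity) |>.2
  refine (norm_couple_sq_le a b v).trans ?_
  have h1 := sq_le_sq' (by linarith [abs_nonneg a]) ha
  have h2 := sq_le_sq' (by linarith [abs_nonneg b]) hb
  rw [sq_abs] at h1 h2
  have := mul_le_mul_of_nonneg_right (add_le_add h1 h2) (sq_nonneg ‖v‖)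
  nlinarith

/-- The right hand side of the truncated problem. -/
def source (P : Params) (hP : P.Superlinear) (K : ℝ) (hK : 0 ≤ K) (h0 h1 : ℝ → ℝ) (t : ℝ)
    (v : H1) : Vel :=
  grad P hP K hK (traceL v) - couple (h0 t) (h1 t) v

theorem BoundedL2.exists_bound {h : ℝ → ℝ} (hh : BoundedL2 h) (T : ℝ) :
    ∃ M, 0 ≤ M ∧ ∀ᵐ t ∂(volume.restrict (Ioc 0 T)), |h t| ≤ M := by
  refine ⟨(eLpNorm h ∞ (volume.restrict (Ioi 0))).toReal, ENNReal.toReal_nonneg, ?_⟩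
  refine ae_restrict_of_ae_restrict_of_subset Ioc_subset_Ioi_self ?_
  filter_upwards [ae_le_eLpNormEssSup (f := h) (μ := volume.restrict (Ioi 0))] with t ht
  rw [← eLpNorm_exponent_top] at ht
  have := ENNReal.toReal_mono hh.1.2.ne ht
  rwa [toReal_enorm, Real.norm_eq_abs] at this

variable {P : Params} (hP : P.Superlinear) {K : ℝ} (hK : 0 ≤ K) {h0 h1 : ℝ → ℝ} {T : ℝ}

/-- Boundedness of h₀ and h₁ makes the coupling Lipschitz uniformly in time; truncation does the
same for the nonlinear part. -/
theorem exists_isLipSource (hh0 : BoundedL2 h0) (hh1 : BoundedL2 h1) (T : ℝ) :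
    ∃ L, IsLipSource (source P hP K hK h0 h1) L T := by
  obtain ⟨M0, hM0, b0⟩ := hh0.exists_bound T
  obtain ⟨M1, hM1, b1⟩ := hh1.exists_bound T
  refine ⟨gradLip P K * ‖traceL‖ + 2 * max M0 M1, ?_, ?_, ?_⟩
  · intro u hu
    have hm : ∀ {h : ℝ → ℝ}, BoundedL2 h → AEStronglyMeasurable h (volume.restrict (Ioc 0 T)) :=
      fun hh => hh.1.1.mono_measure (Measure.restrict_mono Ioc_subset_Ioi_self le_rfl)
    have hr : ∀ x : Icc (0 : ℝ) 1, AEStronglyMeasurable (fun t => (u t).rep x)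
        (volume.restrict (Ioc 0 T)) := fun x =>
      (((H1.evalL x).continuous.comp_continuousOn hu).mono
        Ioc_subset_Icc_self).aestronglyMeasurable measurableSet_Ioc
    have hg : AEStronglyMeasurable (fun t => grad P hP K hK (traceL (u t)))
        (volume.restrict (Ioc 0 T)) :=
      (((lipschitzWith_grad hP hK).continuous.comp_continuousOn
        (traceL.continuous.comp_continuousOn hu)).mono
        Ioc_subset_Icc_self).aestronglyMeasurable measurableSet_Ioc
    exact hg.sub (mkL.continuous.comp_aestronglyMeasurable
      (aestronglyMeasurable_const.prodMk (((hm hh1).mul (hr 1)).prodMk ((hm hh0).mul (hr 0)))))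
  · filter_upwards [b0, b1] with t ht0 ht1 u v
    have e : source P hP K hK h0 h1 t u - source P hP K hK h0 h1 t v =
        (grad P hP K hK (traceL u) - grad P hP K hK (traceL v)) - couple (h0 t) (h1 t) (u - v) := by
      rw [couple_sub, source, source]; abel
    rw [e, add_mul]
    refine (norm_sub_le _ _).trans (add_le_add ?_ ?_)
    · refine ((lipschitzWith_grad hP hK).norm_sub_le _ _).trans ?_
      rw [mul_assoc, ← map_sub]
      exact mul_le_mul_of_nonneg_left (traceL.le_opNorm _) (NNReal.coe_nonneg _)
    · exact norm_couple_le (le_max_of_le_left hM0) (ht0.trans (le_max_left _ _))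
        (ht1.trans (le_max_right _ _)) _
  · intro t
    have : couple (h0 t) (h1 t) 0 = 0 := by
      have := couple_sub (h0 t) (h1 t) 0 0
      simpa using this
    rw [source, map_zero, grad_zero, this, sub_zero]

theorem integral_cutNL_eq {s : ℝ} {v φ : H1} (hv : ∀ x ∈ Icc (0 : ℝ) 1, |v.rep x| ≤ K) :
    ∫ x in Ioo 0 1, cutNL s K (v.toL2 x) * φ.toL2 x =
      ∫ x in (0 : ℝ)..1, powNL s (v.rep x) * φ.rep x := by
  rw [intervalIntegral.integral_of_le zero_le_one, integral_Ioc_eq_integral_Ioo]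
  refine integral_congr_ae ?_
  filter_upwards [v.rep_ae_eq, φ.rep_ae_eq, ae_restrict_mem measurableSet_Ioo] with x hx hx' hxm
  rw [← hx, ← hx', cutNL_eq (hv x (Ioo_subset_Icc_self hxm))]

/-- Below the truncation height, the abstract integrand is the right-hand side of the weak
formulation term by term. This links the two notions of solution in both directions. -/
theorem inner_source_sub {v φ : H1} (hv : ∀ x ∈ Icc (0 : ℝ) 1, |v.rep x| ≤ K) (t : ℝ) (y : Vel) :
    inner ℝ (source P hP K hK h0 h1 t v - dampL P y) (traceL φ) - inner ℝ v φ =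
    (∫ x in (0 : ℝ)..1, powNL P.p (v.rep x) * φ.rep x)
          + powNL P.α (v.rep 0) * φ.rep 0 + powNL P.β (v.rep 1) * φ.rep 1
          - inner ℝ v.dx φ.dx - inner ℝ v.toL2 φ.toL2 - P.lam * inner ℝ (interior y) φ.toL2
          - (P.lam0 * left y + h1 t * v.rep 1 + P.lamt1 * right y) * φ.rep 0
          - (P.lam1 * right y + h0 t * v.rep 0 + P.lamt0 * left y) * φ.rep 1 := by
  rw [source, inner_sub_left, inner_sub_left, inner_grad, Vel.inner_eq (couple _ _ _),
    Vel.inner_eq (dampL P y), H1.inner_eq]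
  simp only [couple, interior_mkL, left_mkL, right_mkL, inner_zero_left, interior_traceL,
    left_traceL, right_traceL, interior_dampL, left_dampL, right_dampL, real_inner_smul_left,
    integral_cutNL_eq hv, cutNL_eq (hv 0 (by simp)), cutNL_eq (hv 1 (by simp))]
  ring

/-- The single equation for κu is read componentwise: its interior part gives u ∈ C¹([0,T]; L²), its
two scalar parts give the traces in H¹(0,T) with derivatives `left` and `right` of y. -/
theorem isWeakSolutionOn_of_isEvol (hT : 0 < T) {u : ℝ → H1} {w : ℝ → L2I} {y : ℝ → Vel}
    (hE : IsEvol traceL interior T (fun t => source P hP K hK h0 h1 t (u t) - dampL P (y t)) u w y)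
    (hb : ∀ t ∈ Icc 0 T, ∀ x ∈ Icc (0 : ℝ) 1, |(u t).rep x| ≤ K) :
    IsWeakSolutionOn P h0 h1 (u 0) (w 0) T u w := by
  have hyi : ∀ t ∈ Icc 0 T, IntervalIntegrable y volume 0 t := fun t ht =>
    MemLp.intervalIntegrable_of_le hE.memY le_rfl ht.1 ht.2
  have hcl : ∀ (ℓ : Vel →L[ℝ] ℝ), ∀ t ∈ Icc 0 T, ℓ (traceL (u t)) = ℓ (traceL (u 0)) +
      ∫ s in (0 : ℝ)..t, ℓ (y s) := fun ℓ t ht => by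
    rw [hE.eqU t ht, map_add, ℓ.intervalIntegral_comp_comm (hyi t ht)]
  have hm : ∀ (ℓ : Vel →L[ℝ] ℝ), MemLp (fun t => ℓ (y t)) 2 (volume.restrict (Ioo 0 T)) :=
    fun ℓ => by
      rw [restrict_Ioo_eq_restrict_Ioc]
      exact ℓ.comp_memLp' hE.memY
  refine ⟨hE.contU, hE.contW, fun t ht => ?_, rfl, rfl, fun t => left (y t), fun t => right (y t),
    hm left, hm right, hasWeakDerivOn_of_eq_add_integral hT ((hm left).integrable (by norm_num))
      (hcl left), hasWeakDerivOn_of_eq_add_integral hT ((hm right).integrable (by norm_num))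
      (hcl right), fun v => ?_⟩
  · have h1 : ∀ s ∈ Icc 0 T, (u s).toL2 = (u 0).toL2 + ∫ σ in (0 : ℝ)..s, w σ := fun s hs => by
      have h2 := congrArg interior (hE.eqU s hs)
      rw [map_add, interior_traceL, interior_traceL] at h2
      rw [h2, ← interior.intervalIntegral_comp_comm (hyi s hs)]
      congr 1
      refine intervalIntegral.integral_congr_ae_restrict ?_
      rw [uIoc_of_le hs.1]
      exact ae_restrict_of_ae_restrict_of_subset (Ioc_subset_Ioc_right hs.2) hE.pi_y
    exact ((hasDerivWithinAt_integral_Icc hE.contW ht).const_add _).congr_of_mem h1 ht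
  · have hi := hE.integrand_intervalIntegrable le_rfl hT.le le_rfl v
    have h1 := hi.1.sub hi.2
    rw [intervalIntegrable_iff_integrableOn_Ioo_of_le hT.le] at h1
    refine (hasWeakDerivOn_of_eq_add_integral hT h1 fun t ht => hE.eqW t ht v).congr
      (EventuallyEq.refl _ _) ?_
    have hpi := hE.pi_y
    rw [← restrict_Ioo_eq_restrict_Ioc] at hpi
    filter_upwards [hpi, ae_restrict_mem measurableSet_Ioo] with t ht htm
    rw [inner_source_sub hP hK (hb t (Ioo_subset_Icc_self htm)), ht]

/-- The velocity y is assembled from u' and the two weak time derivatives of the traces. -/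
theorem IsWeakSolutionOn.exists_isEvol {L : ℝ} (hT : 0 < T)
    (hlip : IsLipSource (source P hP K hK h0 h1) L T) {u0 : H1} {u1 : L2I} {u : ℝ → H1}
    {w : ℝ → L2I} (h : IsWeakSolutionOn P h0 h1 u0 u1 T u w)
    (hb : ∀ t ∈ Icc 0 T, ∀ x ∈ Icc (0 : ℝ) 1, |(u t).rep x| ≤ K) :
    ∃ y, IsEvol traceL interior T
      (fun t => source P hP K hK h0 h1 t (u t) - dampL P (y t)) u w y := by
  obtain ⟨b0, b1, m0, m1, d0, d1, hw⟩ := h.weak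
  have hrep : ∀ x : Icc (0 : ℝ) 1, ContinuousOn (fun t => (u t).rep x) (Icc 0 T) := fun x =>
    (H1.evalL x).continuous.comp_continuousOn h.continuousOn_u
  have e0 := d0.eq_add_integral hT (hrep 0)
  have e1 := d1.eq_add_integral hT (hrep 1)
  have eu := eq_add_integral_of_hasDerivWithinAt_Icc h.continuousOn_ut h.hasDeriv
  rw [restrict_Ioo_eq_restrict_Ioc] at m0 m1
  have mw : MemLp w 2 (volume.restrict (Ioc 0 T)) := ContinuousOn.memLp_two h.continuousOn_ut
  have my : MemLp (fun t => mkL (w t, b0 t, b1 t)) 2 (volume.restrict (Ioc 0 T)) := by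
    have e : (fun t => mkL (w t, b0 t, b1 t)) = fun t => mkL (w t, 0, 0) +
        (mkL (0, b0 t, 0) + mkL (0, 0, b1 t)) := by
      funext t
      rw [← map_add, ← map_add]
      simp
    rw [e]
    exact ((mkL.comp (ContinuousLinearMap.inl ℝ L2I (ℝ × ℝ))).comp_memLp' mw).add
      (((mkL.comp ((ContinuousLinearMap.inr ℝ L2I (ℝ × ℝ)).comp
        (ContinuousLinearMap.inl ℝ ℝ ℝ))).comp_memLp' m0).add
      ((mkL.comp ((ContinuousLinearMap.inr ℝ L2I (ℝ × ℝ)).comp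
        (ContinuousLinearMap.inr ℝ ℝ ℝ))).comp_memLp' m1))
  refine ⟨fun t => mkL (w t, b0 t, b1 t), h.continuousOn_u, h.continuousOn_ut, my,
    (hlip.memLp h.continuousOn_u).sub ((dampL P).comp_memLp' my), Eventually.of_forall fun t => rfl,
    fun t ht => ?_, fun t ht v => ?_⟩
  · have hyi := MemLp.intervalIntegrable_of_le my le_rfl ht.1 ht.2
    refine Vel.ext ?_ ?_ ?_
    · rw [map_add, ← interior.intervalIntegral_comp_comm hyi]
      exact eu t ht
    · rw [map_add, ← left.intervalIntegral_comp_comm hyi]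
      exact e0 t ht
    · rw [map_add, ← right.intervalIntegral_comp_comm hyi]
      exact e1 t ht
  · refine ((hw v).eq_add_integral hT (h.continuousOn_ut.inner continuousOn_const) t ht).trans ?_
    congr 1
    refine intervalIntegral.integral_congr fun s hs => ?_
    rw [uIcc_of_le ht.1] at hs
    simp only [inner_source_sub hP hK (hb s ⟨hs.1, hs.2.trans ht.2⟩)]
    rfl

theorem exists_rep_bound {u : ℝ → H1} (hu : ContinuousOn u (Icc 0 T)) :
    ∃ K, 0 ≤ K ∧ ∀ t ∈ Icc 0 T, ∀ x ∈ Icc (0 : ℝ) 1, |(u t).rep x| ≤ K := by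
  obtain ⟨C, hC⟩ := isCompact_Icc.exists_bound_of_continuousOn hu
  refine ⟨√2 * max C 0, by positivity, fun t ht x hx => ((u t).abs_rep_le hx).trans ?_⟩
  exact mul_le_mul_of_nonneg_left ((hC t ht).trans (le_max_left _ _)) (by positivity)

/-- Uniqueness of weak solutions. -/
theorem IsWeakSolutionOn.unique (hP1 : P.A1) (hP2 : P.A2) (hh0 : BoundedL2 h0)
    (hh1 : BoundedL2 h1) (hT : 0 < T) {u0 : H1} {u1 : L2I} {u v : ℝ → H1} {w z : ℝ → L2I}
    (hu : IsWeakSolutionOn P h0 h1 u0 u1 T u w) (hv : IsWeakSolutionOn P h0 h1 u0 u1 T v z) :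
    ∀ t ∈ Icc 0 T, u t = v t ∧ w t = z t := by
  obtain ⟨K1, hK1, b1⟩ := exists_rep_bound hu.continuousOn_u
  obtain ⟨K2, hK2, b2⟩ := exists_rep_bound hv.continuousOn_u
  -- A common height above both solutions makes them solutions of one and the same truncated
  -- problem.
  have hK : 0 ≤ max K1 K2 := le_max_of_le_left hK1
  obtain ⟨L, hL⟩ := exists_isLipSource hP1.superlinear hK hh0 hh1 T
  obtain ⟨y1, E1⟩ := hu.exists_isEvol hP1.superlinear hK hT hL
    fun t ht x hx => (b1 t ht x hx).trans (le_max_left _ _)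
  obtain ⟨y2, E2⟩ := hv.exists_isEvol hP1.superlinear hK hT hL
    fun t ht x hx => (b2 t ht x hx).trans (le_max_right _ _)
  exact hL.unique (Params.dissip_pos hP1 hP2) (dissip_mul_le hP2) E1 E2
    (hu.init_u.trans hv.init_u.symm) (hu.init_ut.trans hv.init_ut.symm)

/-- The truncated problem is globally solvable. -/
theorem exists_isEvol_truncated (hP1 : P.A1) (hP2 : P.A2) (hh0 : BoundedL2 h0)
    (hh1 : BoundedL2 h1) (hT : 0 ≤ T) (u0 : H1) (u1 : L2I) :
    ∃ u w y, IsEvol traceL interior T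
      (fun t => source P hP K hK h0 h1 t (u t) - dampL P (y t)) u w y ∧ u 0 = u0 ∧ w 0 = u1 := by
  obtain ⟨L, hL⟩ := exists_isLipSource hP hK hh0 hh1 T
  exact hL.exists_isEvol hT (Params.dissip_pos hP1 hP2) (dissip_mul_le hP2) traceL_injective
    traceL_dense u0 u1

end

section

open Vel

/-! ### A Grönwall inequality for absolutely continuous functions -/

/-- Needed for the integrating factor in Grönwall's inequality: the exponential is Lipschitz only on
the bounded range of the primitive. -/
theorem LipschitzOnWith.comp_absolutelyContinuousOnInterval {f g : ℝ → ℝ} {a b : ℝ} {L : NNReal}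
    {s : Set ℝ} (hg : LipschitzOnWith L g s) (hf : AbsolutelyContinuousOnInterval f a b)
    (hs : MapsTo f (uIcc a b) s) : AbsolutelyContinuousOnInterval (fun x => g (f x)) a b := by
  unfold AbsolutelyContinuousOnInterval at hf ⊢
  have h1 := hf.const_mul (L : ℝ)
  rw [mul_zero] at h1
  refine squeeze_zero' (Eventually.of_forall fun E => Finset.sum_nonneg fun _ _ => dist_nonneg)
    ?_ h1
  filter_upwards [mem_inf_of_right (mem_principal_self _)] with E hE
  rw [Finset.mul_sum]
  exact Finset.sum_le_sum fun i hi => hg.dist_le_mul _ (hs (hE.1 i hi).1) _ (hs (hE.1 i hi).2)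

/-- The product of E with exp(−∫k) is absolutely continuous with almost everywhere nonpositive
derivative. No sign of k is needed, so the inequality yields growth bounds and decay alike. -/
theorem le_mul_exp_of_ae_le {T : ℝ} (hT : 0 ≤ T) {E e k : ℝ → ℝ} (he : IntegrableOn e (Ioc 0 T))
    (hk : IntegrableOn k (Ioc 0 T)) (hE : ∀ t ∈ Icc 0 T, E t = E 0 + ∫ s in (0 : ℝ)..t, e s)
    (h : ∀ᵐ t ∂(volume.restrict (Ioc 0 T)), e t ≤ k t * E t) :
    E T ≤ E 0 * Real.exp (∫ s in (0 : ℝ)..T, k s) := by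
  have ie : IntervalIntegrable e volume 0 T :=
    (intervalIntegrable_iff_integrableOn_Ioc_of_le hT).2 he
  have ik : IntervalIntegrable k volume 0 T :=
    (intervalIntegrable_iff_integrableOn_Ioc_of_le hT).2 hk
  have ace : AbsolutelyContinuousOnInterval (fun x => ∫ t in (0 : ℝ)..x, e t) 0 T :=
    ie.absolutelyContinuousOnInterval_intervalIntegral (by simp)
  have ack : AbsolutelyContinuousOnInterval (fun x => ∫ t in (0 : ℝ)..x, k t) 0 T :=
    ik.absolutelyContinuousOnInterval_intervalIntegral (by simp)
  have acF : AbsolutelyContinuousOnInterval (fun x => E 0 + ∫ t in (0 : ℝ)..x, e t) 0 T :=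
    (LipschitzWith.const (E 0)).lipschitzOnWith.absolutelyContinuousOnInterval.add ace
  obtain ⟨C, hC⟩ := ack.exists_bound
  obtain ⟨L, hL⟩ : ∃ L, LipschitzOnWith L (fun x => Real.exp (-x)) (Icc (-C) C) :=
    (by fun_prop : ContDiff ℝ 1 fun x : ℝ => Real.exp (-x)).contDiffOn.exists_lipschitzOnWith
      one_ne_zero (convex_Icc _ _) isCompact_Icc
  have acg := LipschitzOnWith.comp_absolutelyContinuousOnInterval hL ack
    fun x hx => abs_le.1 (hC x hx)
  have h1 := acF.integral_deriv_mul_eq_sub acg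
  have h2 : ∫ x in (0 : ℝ)..T, (deriv (fun x => E 0 + ∫ t in (0 : ℝ)..x, e t) x *
      Real.exp (-∫ t in (0 : ℝ)..x, k t) + (E 0 + ∫ t in (0 : ℝ)..x, e t) *
      deriv (fun x => Real.exp (-∫ t in (0 : ℝ)..x, k t)) x) ≤ 0 := by
    rw [intervalIntegral.integral_of_le hT]
    refine integral_nonpos_of_ae ?_
    have d1 := (ae_restrict_iff' measurableSet_Ioc).2 (ie.ae_hasDerivAt_integral.mono
      fun x hx (hxm : x ∈ Ioc 0 T) => hx (by rw [uIcc_of_le hT]; exact Ioc_subset_Icc_self hxm)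
        0 (by simp))
    have d2 := (ae_restrict_iff' measurableSet_Ioc).2 (ik.ae_hasDerivAt_integral.mono
      fun x hx (hxm : x ∈ Ioc 0 T) => hx (by rw [uIcc_of_le hT]; exact Ioc_subset_Icc_self hxm)
        0 (by simp))
    filter_upwards [h, d1, d2, ae_restrict_mem measurableSet_Ioc] with x hx hd1 hd2 hxm
    have hd3 : HasDerivAt (fun x => Real.exp (-∫ t in (0 : ℝ)..x, k t))
        (Real.exp (-∫ t in (0 : ℝ)..x, k t) * -k x) x := hd2.neg.exp
    rw [(hd1.const_add (E 0)).deriv, hd3.deriv, ← hE x (Ioc_subset_Icc_self hxm)]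
    have := mul_le_mul_of_nonneg_right hx (Real.exp_pos (-∫ t in (0 : ℝ)..x, k t)).le
    simp only [Pi.zero_apply]
    linarith
  rw [h1, ← hE T ⟨hT, le_rfl⟩] at h2
  simp only [intervalIntegral.integral_same, add_zero, neg_zero, Real.exp_zero, mul_one] at h2
  rw [Real.exp_neg, ← div_eq_mul_inv, sub_nonpos, div_le_iff₀ (Real.exp_pos _)] at h2
  exact h2

/-- Continuity argument: at the first time f reaches R it has stayed at most R before, by the
intermediate value theorem, and the implication then gives a contradiction. -/
theorem lt_of_forall_le_imp_lt {T R : ℝ} {f : ℝ → ℝ} (hf : ContinuousOn f (Icc 0 T))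
    (h0 : f 0 < R) (h : ∀ t ∈ Icc 0 T, (∀ s ∈ Icc 0 t, f s ≤ R) → f t < R) :
    ∀ t ∈ Icc 0 T, f t < R := by
  by_contra! hcon
  obtain ⟨t1, ht1, hR1⟩ := hcon
  have hAc : IsCompact (Icc 0 T ∩ f ⁻¹' Ici R) :=
    isCompact_Icc.of_isClosed_subset (hf.preimage_isClosed_of_isClosed isClosed_Icc isClosed_Ici)
      inter_subset_left
  obtain ⟨t0, ⟨ht0, hR0⟩, hmin⟩ := hAc.exists_isLeast ⟨t1, ht1, hR1⟩
  refine absurd (h t0 ht0 fun s hs => ?_) (not_lt.2 hR0)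
  by_contra! hlt
  obtain ⟨σ, hσ, hσR⟩ := intermediate_value_Icc hs.1
    (hf.mono (Icc_subset_Icc_right (hs.2.trans ht0.2))) (show R ∈ Icc (f 0) (f s) from ⟨h0.le, hlt.le⟩)
  have h1 := hmin ⟨⟨hσ.1, hσ.2.trans (hs.2.trans ht0.2)⟩, hσR.ge⟩
  have h2 : σ = s := le_antisymm hσ.2 (hs.2.trans h1)
  rw [h2] at hσR
  linarith

/-! ### Bounds for the nonlinear functionals -/

/-- The sum of the nonlinear terms of `functionalI`. -/
def nonlinSum (P : Params) (v : H1) : ℝ :=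
  v.lpPow P.p + |v.rep 0| ^ P.α + |v.rep 1| ^ P.β

/-- The factor `η` such that `nonlinSum P v ≤ η ‖v‖²` if `‖v‖² ≤ R`. -/
def smallness (P : Params) (Cp R : ℝ) : ℝ :=
  Cp ^ P.p * R ^ ((P.p - 2) / 2) + 2 ^ (P.α / 2) * R ^ ((P.α - 2) / 2)
    + 2 ^ (P.β / 2) * R ^ ((P.β - 2) / 2)

theorem H1.lpPow_nonneg (s : ℝ) (v : H1) : 0 ≤ v.lpPow s :=
  intervalIntegral.integral_nonneg zero_le_one fun _ _ => Real.rpow_nonneg (abs_nonneg _) _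

theorem nonlinSum_nonneg (P : Params) (v : H1) : 0 ≤ nonlinSum P v :=
  add_nonneg (add_nonneg (v.lpPow_nonneg _) (Real.rpow_nonneg (abs_nonneg _) _))
    (Real.rpow_nonneg (abs_nonneg _) _)

theorem rpow_le_rpow_mul_sq {n R s : ℝ} (hn : 0 ≤ n) (hR : n ^ 2 ≤ R) (hs : 2 < s) :
    n ^ s ≤ R ^ ((s - 2) / 2) * n ^ 2 := by
  rcases hn.eq_or_lt with rfl | hpos
  · rw [Real.zero_rpow (by linarith)]; simp
  · have h1 : n ^ s = (n ^ 2) ^ ((s - 2) / 2) * n ^ 2 := by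
      rw [← Real.rpow_natCast n 2, ← Real.rpow_mul hn, ← Real.rpow_add hpos]
      congr 1
      push_cast; ring
    rw [h1]
    exact mul_le_mul_of_nonneg_right (Real.rpow_le_rpow (sq_nonneg n) hR (by linarith))
      (sq_nonneg n)

/-- Each power s > 2 splits as ‖v‖^s ≤ R^{(s−2)/2}‖v‖²; the embedding constant handles the interior
and √2 the boundary values. At R = 2qrE(0)/(q−2), `smallness` is η*. -/
theorem nonlinSum_le {P : Params} (hP : P.Superlinear) {Cp R : ℝ} (hCp : IsEmbeddingConst P Cp)
    (hCp0 : 0 ≤ Cp) {v : H1} (hR : ‖v‖ ^ 2 ≤ R) :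
    nonlinSum P v ≤ smallness P Cp R * ‖v‖ ^ 2 := by
  have hb : ∀ {s : ℝ} (x : ℝ), 2 < s → x ∈ Icc (0 : ℝ) 1 →
      |v.rep x| ^ s ≤ 2 ^ (s / 2) * R ^ ((s - 2) / 2) * ‖v‖ ^ 2 := by
    intro s x hs hx
    refine (Real.rpow_le_rpow (abs_nonneg _) (v.abs_rep_le hx) (by linarith)).trans ?_
    rw [Real.mul_rpow (by positivity) (norm_nonneg _), Real.sqrt_eq_rpow,
      ← Real.rpow_mul (by norm_num), mul_assoc, show 1 / 2 * s = s / 2 by ring]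
    exact mul_le_mul_of_nonneg_left (rpow_le_rpow_mul_sq (norm_nonneg _) hR hs) (by positivity)
  have hp : v.lpPow P.p ≤ Cp ^ P.p * R ^ ((P.p - 2) / 2) * ‖v‖ ^ 2 := by
    have h1 := Real.rpow_le_rpow (Real.rpow_nonneg (v.lpPow_nonneg _) _) (hCp v)
      (show 0 ≤ P.p by linarith [hP.p])
    rw [← Real.rpow_mul (v.lpPow_nonneg _), one_div_mul_cancel (by linarith [hP.p]),
      Real.rpow_one, Real.mul_rpow hCp0 (norm_nonneg _)] at h1
    rw [mul_assoc]
    exact h1.trans (mul_le_mul_of_nonneg_left (rpow_le_rpow_mul_sq (norm_nonneg _) hR hP.p)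
      (Real.rpow_nonneg hCp0 _))
  have h0 := hb 0 hP.α (by simp)
  have h1 := hb 1 hP.β (by simp)
  unfold nonlinSum smallness
  linarith

variable {P : Params}

theorem two_lt_q (hP : P.Superlinear) : 2 < P.q := lt_min hP.p (lt_min hP.α hP.β)

theorem energy_eq_sub (u : H1) (w : L2I) : energy P u w = 1 / 2 * ‖w‖ ^ 2 + 1 / 2 * ‖u‖ ^ 2 -
    (1 / P.p * u.lpPow P.p + 1 / P.α * |u.rep 0| ^ P.α + 1 / P.β * |u.rep 1| ^ P.β) := by
  unfold energy; ring

theorem energy_ge (hP : P.Superlinear) (u : H1) (w : L2I) :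
    1 / 2 * ‖w‖ ^ 2 + 1 / 2 * ‖u‖ ^ 2 - 1 / P.q * nonlinSum P u ≤ energy P u w := by
  have hq := two_lt_q hP
  have e1 : 1 / P.p ≤ 1 / P.q := one_div_le_one_div_of_le (by linarith) (min_le_left _ _)
  have e2 : 1 / P.α ≤ 1 / P.q := one_div_le_one_div_of_le (by linarith)
    ((min_le_right _ _).trans (min_le_left _ _))
  have e3 : 1 / P.β ≤ 1 / P.q := one_div_le_one_div_of_le (by linarith)
    ((min_le_right _ _).trans (min_le_right _ _))
  have f1 := mul_le_mul_of_nonneg_right e1 (u.lpPow_nonneg P.p)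
  have f2 := mul_le_mul_of_nonneg_right e2 (Real.rpow_nonneg (abs_nonneg (u.rep 0)) P.α)
  have f3 := mul_le_mul_of_nonneg_right e3 (Real.rpow_nonneg (abs_nonneg (u.rep 1)) P.β)
  rw [energy_eq_sub, nonlinSum]
  linarith

theorem energy_le (hP : P.Superlinear) (u : H1) (w : L2I) :
    energy P u w ≤ 1 / 2 * ‖w‖ ^ 2 + 1 / 2 * ‖u‖ ^ 2 := by
  have h1 := hP.p
  have h2 := hP.α
  have h3 := hP.β
  have f1 : 0 ≤ 1 / P.p * u.lpPow P.p := mul_nonneg (by positivity) (u.lpPow_nonneg P.p)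
  have f2 : 0 ≤ 1 / P.α * |u.rep 0| ^ P.α := by positivity
  have f3 : 0 ≤ 1 / P.β * |u.rep 1| ^ P.β := by positivity
  rw [energy_eq_sub]
  linarith

/-! ### The energy identity -/

variable (hP : P.Superlinear) {K : ℝ} (hK : 0 ≤ K) {h0 h1 : ℝ → ℝ} {T : ℝ}

theorem powNL_mul_self {s : ℝ} (hs : 2 < s) (y : ℝ) : powNL s y * y = |y| ^ s := by
  rcases eq_or_ne y 0 with rfl | hy
  · simp [Real.zero_rpow (by linarith : s ≠ 0)]
  · have h1 : (0 : ℝ) < |y| := abs_pos.2 hy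
    rw [powNL, mul_assoc, ← abs_mul_abs_self, ← sq, ← Real.rpow_natCast |y| 2, ← Real.rpow_add h1]
    congr 1
    push_cast; ring

theorem energy_eq_sub_potential (hP : P.Superlinear) {v : H1} (hv : ∀ x ∈ Icc (0 : ℝ) 1, |v.rep x| ≤ K) (w : L2I) :
    energy P v w = 1 / 2 * ‖v‖ ^ 2 + 1 / 2 * ‖w‖ ^ 2 - potential P K (traceL v) := by
  have e : ∫ x in Ioo 0 1, cutPot P.p K (v.toL2 x) = 1 / P.p * v.lpPow P.p := by
    rw [H1.lpPow, ← intervalIntegral.integral_const_mul,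
      intervalIntegral.integral_of_le zero_le_one, integral_Ioc_eq_integral_Ioo]
    refine integral_congr_ae ?_
    filter_upwards [v.rep_ae_eq, ae_restrict_mem measurableSet_Ioo] with x hx hxm
    rw [← hx, cutPot_eq hP.p (hv x (Ioo_subset_Icc_self hxm))]
  rw [energy_eq_sub, potential, interior_traceL, left_traceL, right_traceL, e,
    cutPot_eq hP.α (hv 0 (by simp)), cutPot_eq hP.β (hv 1 (by simp))]
  ring

theorem inner_grad_traceL {v : H1} (hv : ∀ x ∈ Icc (0 : ℝ) 1, |v.rep x| ≤ K) :
    inner ℝ (grad P hP K hK (traceL v)) (traceL v) = nonlinSum P v := by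
  rw [inner_grad]
  simp only [interior_traceL, left_traceL, right_traceL, integral_cutNL_eq hv,
    cutNL_eq (hv 0 (by simp)), cutNL_eq (hv 1 (by simp)), powNL_mul_self hP.p,
    powNL_mul_self hP.α, powNL_mul_self hP.β]
  rfl

variable {u : ℝ → H1} {w : ℝ → L2I} {y : ℝ → Vel}

/-- The nonlinear source is a gradient, so its power along the motion integrates exactly to the
change of the potential, leaving only damping and coupling. -/
theorem truncated_energy_identity
    (hE : IsEvol traceL interior T (fun t => source P hP K hK h0 h1 t (u t) - dampL P (y t)) u w y) :
    IntegrableOn (fun s => -inner ℝ (dampL P (y s)) (y s) - inner ℝ (couple (h0 s) (h1 s) (u s)) (y s))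
      (Ioc 0 T) ∧ ∀ t ∈ Icc 0 T,
    1 / 2 * ‖u t‖ ^ 2 + 1 / 2 * ‖w t‖ ^ 2 - potential P K (traceL (u t)) =
    1 / 2 * ‖u 0‖ ^ 2 + 1 / 2 * ‖w 0‖ ^ 2 - potential P K (traceL (u 0)) +
      ∫ s in (0 : ℝ)..t,
        (-inner ℝ (dampL P (y s)) (y s) - inner ℝ (couple (h0 s) (h1 s) (u s)) (y s)) := by
  obtain ⟨i1, h2⟩ := potential_eq_add_integral (lipschitzWith_grad hP hK)
    (abs_potential_sub_le hP hK) hE.memY hE.eqU (traceL.continuous.comp_continuousOn hE.contU)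
  have i2 := integrable_inner_of_memLp hE.memF hE.memY
  have e : (fun s => -inner ℝ (dampL P (y s)) (y s) - inner ℝ (couple (h0 s) (h1 s) (u s)) (y s)) =
      fun s => (inner ℝ (source P hP K hK h0 h1 s (u s) - dampL P (y s)) (y s) : ℝ) -
        inner ℝ (grad P hP K hK (traceL (u s))) (y s) := by
    funext s
    rw [source, inner_sub_left, inner_sub_left]
    ring
  rw [e]
  refine ⟨i2.sub i1, fun t ht => ?_⟩
  have hii : ∀ {f : ℝ → ℝ}, IntegrableOn f (Ioc 0 T) → IntervalIntegrable f volume 0 t := fun hf => by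
    rw [intervalIntegrable_iff_integrableOn_Ioc_of_le ht.1]
    exact hf.mono_set (Ioc_subset_Ioc_right ht.2)
  rw [intervalIntegral.integral_sub (hii i2) (hii i1)]
  have h3 := hE.energy_identity t ht
  have h4 := h2 t ht
  linarith

theorem BoundedL2.integrableOn_sq {h : ℝ → ℝ} (hh : BoundedL2 h) :
    IntegrableOn (fun t => h t ^ 2) (Ioi 0) := hh.2.integrable_sq

theorem BoundedL2.integral_sq_le {h : ℝ → ℝ} (hh : BoundedL2 h) (hT : 0 ≤ T) :
    ∫ t in (0 : ℝ)..T, h t ^ 2 ≤ normL2 h ^ 2 := by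
  have h1 : normL2 h ^ 2 = ∫ t in Ioi 0, h t ^ 2 := by
    have h2 := norm_toLp_sq hh.2
    rw [Lp.norm_toLp] at h2
    rw [normL2, h2]
    simp
  rw [h1, intervalIntegral.integral_of_le hT]
  exact setIntegral_mono_set hh.integrableOn_sq (Eventually.of_forall fun t => sq_nonneg _)
    (LE.le.eventuallyLE Ioc_subset_Ioi_self)

end

/-! ### Growth and decay of the energy -/

section

open Vel

variable {P : Params} (hP : P.Superlinear) {K : ℝ} (hK : 0 ≤ K) {h0 h1 : ℝ → ℝ} {T : ℝ}
  {u : ℝ → H1} {w : ℝ → L2I} {y : ℝ → Vel}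

theorem energy_identity_of_bound
    (hE : IsEvol traceL interior T (fun t => source P hP K hK h0 h1 t (u t) - dampL P (y t)) u w y)
    (hb : ∀ t ∈ Icc 0 T, ∀ x ∈ Icc (0 : ℝ) 1, |(u t).rep x| ≤ K) : ∀ t ∈ Icc 0 T,
    energy P (u t) (w t) = energy P (u 0) (w 0) + ∫ s in (0 : ℝ)..t,
        (-inner ℝ (dampL P (y s)) (y s) - inner ℝ (couple (h0 s) (h1 s) (u s)) (y s)) := by
  intro t ht
  rw [energy_eq_sub_potential hP (hb t ht), energy_eq_sub_potential hP
    (hb 0 ⟨le_rfl, ht.1.trans ht.2⟩)]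
  exact (truncated_energy_identity hP hK hE).2 t ht

theorem integrableOn_sq_add_sq (hh0 : BoundedL2 h0) (hh1 : BoundedL2 h1) (T : ℝ) :
    IntegrableOn (fun t => h0 t ^ 2 + h1 t ^ 2) (Ioc 0 T) :=
  (hh0.integrableOn_sq.mono_set Ioc_subset_Ioi_self).add
    (hh1.integrableOn_sq.mono_set Ioc_subset_Ioi_self)

theorem integral_sq_add_sq_le (hh0 : BoundedL2 h0) (hh1 : BoundedL2 h1) (hT : 0 ≤ T) :
    ∫ t in (0 : ℝ)..T, (h0 t ^ 2 + h1 t ^ 2) ≤ normL2 h0 ^ 2 + normL2 h1 ^ 2 := by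
  have hi : ∀ {h : ℝ → ℝ}, BoundedL2 h → IntervalIntegrable (fun t => h t ^ 2) volume 0 T :=
    fun hh => by
      rw [intervalIntegrable_iff_integrableOn_Ioc_of_le hT]
      exact hh.integrableOn_sq.mono_set Ioc_subset_Ioi_self
  rw [intervalIntegral.integral_add (hi hh0) (hi hh1)]
  exact add_le_add (hh0.integral_sq_le hT) (hh1.integral_sq_le hT)

/-- All three exponents are at least q, and 1/2 − η/q = (q−2)/(2q) + (1−η)/q. The last summand
provides strictness when η < 1. -/
theorem norm_sq_le_energy (hP : P.Superlinear) {η : ℝ} {v : H1} (z : L2I)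
    (hS : nonlinSum P v ≤ η * ‖v‖ ^ 2) :
    1 / 2 * ‖z‖ ^ 2 + ((P.q - 2) / (2 * P.q) + (1 - η) / P.q) * ‖v‖ ^ 2 ≤ energy P v z := by
  have hq := two_lt_q hP
  refine le_trans (le_of_eq ?_) ((sub_le_sub_left (mul_le_mul_of_nonneg_left hS
    (show 0 ≤ 1 / P.q by positivity)) _).trans (energy_ge hP v z))
  field_simp
  ring

/-- The growth term (2/μ_*)(h₀² + h₁²)‖u‖² is converted by ‖u‖² ≤ 2q/(q−2)·E into 4q/(μ_*(q−2))·(h₀²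
+ h₁²)E. Integrated in time, this coefficient is bounded by the exponent in `Params.r`. -/
theorem energy_growth (hP2 : P.A2) (hT : 0 ≤ T) (hP1 : P.A1)
    (hh0 : BoundedL2 h0) (hh1 : BoundedL2 h1)
    (hE : IsEvol traceL interior T (fun t => source P hP K hK h0 h1 t (u t) - dampL P (y t)) u w y)
    (hb : ∀ t ∈ Icc 0 T, ∀ x ∈ Icc (0 : ℝ) 1, |(u t).rep x| ≤ K) {η : ℝ} (hη : η ≤ 1)
    (hS : ∀ t ∈ Icc 0 T, nonlinSum P (u t) ≤ η * ‖u t‖ ^ 2) :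
    energy P (u T) (w T) ≤ energy P (u 0) (w 0) * P.r h0 h1 := by
  have hq := two_lt_q hP
  have hμ := hP2.muStar_pos
  have hq2 : 0 < P.q - 2 := by linarith
  have hge : ∀ t ∈ Icc 0 T, (P.q - 2) / (2 * P.q) * ‖u t‖ ^ 2 ≤ energy P (u t) (w t) :=
    fun t ht => by
      refine le_trans ?_ (norm_sq_le_energy hP (w t) (hS t ht))
      have : 0 ≤ (1 - η) / P.q * ‖u t‖ ^ 2 :=
        mul_nonneg (div_nonneg (by linarith) (by linarith)) (sq_nonneg _)
      rw [add_mul]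
      linarith [sq_nonneg ‖w t‖]
  have hE0 : 0 ≤ energy P (u 0) (w 0) :=
    le_trans (by positivity) (hge 0 ⟨le_rfl, hT⟩)
  have hk := (integrableOn_sq_add_sq hh0 hh1 T).const_mul (4 * P.q / (P.muStar * (P.q - 2)))
  have h2 := le_mul_exp_of_ae_le hT (E := fun t => energy P (u t) (w t))
    (truncated_energy_identity hP hK hE).1 hk (energy_identity_of_bound hP hK hE hb) (by
      filter_upwards [ae_restrict_mem measurableSet_Ioc] with t ht
      have h3 := neg_inner_dampL_sub_inner_couple_le hP2 (h0 t) (h1 t) (u t) (y t)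
      have h4 := hge t (Ioc_subset_Icc_self ht)
      have h5 : 0 ≤ P.dissip * ‖y t‖ ^ 2 :=
        mul_nonneg (Params.dissip_pos hP1 hP2).le (sq_nonneg _)
      have h6 := mul_le_mul_of_nonneg_left h4 (show 0 ≤ 4 * P.q / (P.muStar * (P.q - 2)) *
        (h0 t ^ 2 + h1 t ^ 2) by positivity)
      have h7 : 4 * P.q / (P.muStar * (P.q - 2)) * (h0 t ^ 2 + h1 t ^ 2) *
          ((P.q - 2) / (2 * P.q) * ‖u t‖ ^ 2) =
          2 / P.muStar * (h0 t ^ 2 + h1 t ^ 2) * ‖u t‖ ^ 2 := by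
        have : P.q ≠ 0 := by linarith
        field_simp
        ring
      linarith)
  refine h2.trans (mul_le_mul_of_nonneg_left (Real.exp_le_exp.2 ?_) hE0)
  rw [intervalIntegral.integral_const_mul]
  exact mul_le_mul_of_nonneg_left (integral_sq_add_sq_le hh0 hh1 hT) (by positivity)

theorem norm_toL2_le (v : H1) : ‖v.toL2‖ ≤ ‖v‖ := by
  refine abs_le_of_sq_le_sq' ?_ (norm_nonneg _) |>.2
  rw [v.norm_sq]
  linarith [sq_nonneg ‖v.dx‖]

/-- The pointwise dissipation inequality for the perturbed energy. -/
theorem perturbed_dissipation_le (hP2 : P.A2) {η δ ε a b : ℝ} (hδ : 0 < δ) (hη : η = 1 - δ)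
    (hε : 0 < ε) (hε1 : ε * (1 + (‖dampL P‖ * ‖traceL‖) ^ 2 / δ) ≤ P.dissip / 2) {v : H1} {z : L2I}
    {x : Vel} (hx : interior x = z) {S : ℝ} (hS : S ≤ η * ‖v‖ ^ 2) :
    (-inner ℝ (dampL P x) x - inner ℝ (couple a b v) x) +
      ε * ((S - inner ℝ (couple a b v) (traceL v) - inner ℝ (dampL P x) (traceL v)) - ‖v‖ ^ 2 +
        ‖z‖ ^ 2) ≤
    -(P.dissip / 2) * ‖z‖ ^ 2 - ε * δ / 2 * ‖v‖ ^ 2 +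
      (2 / P.muStar + 2 * ‖traceL‖ ^ 2 / δ * ε) * (a ^ 2 + b ^ 2) * ‖v‖ ^ 2 := by
  have e1 := neg_inner_dampL_sub_inner_couple_le hP2 a b v x
  have hz : ‖z‖ ^ 2 ≤ ‖x‖ ^ 2 := by
    rw [Vel.norm_sq, hx]
    linarith [sq_nonneg (left x), sq_nonneg (right x)]
  have hκ : ‖traceL v‖ ≤ ‖traceL‖ * ‖v‖ := traceL.le_opNorm v
  -- The weight δ/4 is used twice, for the coupling and for the damping, so that half of the
  -- available −δ‖v‖² survives. The resulting multiple of ‖x‖² costs at most half of the dissipation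
  -- by the choice of ε.
  have young : ∀ s t : ℝ, s * t ≤ δ / 4 * t ^ 2 + 1 / δ * s ^ 2 := by
    intro s t
    have : δ / 4 * t ^ 2 + 1 / δ * s ^ 2 - s * t = 1 / δ * (s - δ / 2 * t) ^ 2 := by
      field_simp; ring
    have h4 : 0 ≤ 1 / δ * (s - δ / 2 * t) ^ 2 := by positivity
    linarith
  have e2 : -inner ℝ (couple a b v) (traceL v) ≤
      δ / 4 * ‖v‖ ^ 2 + 2 * ‖traceL‖ ^ 2 / δ * (a ^ 2 + b ^ 2) * ‖v‖ ^ 2 := by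
    have f1 := (abs_le.1 (abs_real_inner_le_norm (couple a b v) (traceL v))).1
    have f2 := mul_le_mul_of_nonneg_left hκ (norm_nonneg (couple a b v))
    have f3 := young (‖couple a b v‖ * ‖traceL‖) ‖v‖
    have f4 := mul_le_mul_of_nonneg_left (norm_couple_sq_le a b v)
      (show 0 ≤ 1 / δ * ‖traceL‖ ^ 2 by positivity)
    have f5 : 1 / δ * ‖traceL‖ ^ 2 * (2 * (a ^ 2 + b ^ 2) * ‖v‖ ^ 2) =
      2 * ‖traceL‖ ^ 2 / δ * (a ^ 2 + b ^ 2) * ‖v‖ ^ 2 := by ring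
    rw [mul_pow] at f3
    linarith
  have e3 : -inner ℝ (dampL P x) (traceL v) ≤
      δ / 4 * ‖v‖ ^ 2 + (‖dampL P‖ * ‖traceL‖) ^ 2 / δ * ‖x‖ ^ 2 := by
    have f1 := (abs_le.1 (abs_real_inner_le_norm (dampL P x) (traceL v))).1
    have f2 := mul_le_mul ((dampL P).le_opNorm x) hκ (norm_nonneg _) (by positivity)
    have f3 := young (‖dampL P‖ * ‖traceL‖ * ‖x‖) ‖v‖
    have f5 : 1 / δ * (‖dampL P‖ * ‖traceL‖ * ‖x‖) ^ 2 =
      (‖dampL P‖ * ‖traceL‖) ^ 2 / δ * ‖x‖ ^ 2 := by ring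
    linarith
  have e4 : (S - inner ℝ (couple a b v) (traceL v) - inner ℝ (dampL P x) (traceL v)) - ‖v‖ ^ 2 +
      ‖z‖ ^ 2 ≤ -(δ / 2) * ‖v‖ ^ 2 + 2 * ‖traceL‖ ^ 2 / δ * (a ^ 2 + b ^ 2) * ‖v‖ ^ 2 +
        (1 + (‖dampL P‖ * ‖traceL‖) ^ 2 / δ) * ‖x‖ ^ 2 := by
    rw [hη] at hS
    linarith
  have e5 := mul_le_mul_of_nonneg_left e4 hε.le
  have e6 := mul_le_mul_of_nonneg_right hε1 (sq_nonneg ‖x‖)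
  have hd : 0 ≤ P.dissip / 2 := le_trans (by positivity) hε1
  have e7 := mul_le_mul_of_nonneg_left hz hd
  linarith

/-- Exponential decay of the norm as long as the nonlinear terms are subcritical. -/
theorem exists_decay (hP1 : P.A1) (hP2 : P.A2) {η : ℝ} (hη : η < 1) :
    ∃ C γ B : ℝ, 0 < C ∧ 0 < γ ∧ 0 ≤ B ∧ ∀ (K : ℝ) (hK : 0 ≤ K) (h0 h1 : ℝ → ℝ) (T : ℝ)
      (u : ℝ → H1) (w : ℝ → L2I) (y : ℝ → Vel), 0 ≤ T → BoundedL2 h0 → BoundedL2 h1 →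
      IsEvol traceL interior T
        (fun t => source P hP1.superlinear K hK h0 h1 t (u t) - dampL P (y t)) u w y →
      (∀ t ∈ Icc 0 T, ∀ x ∈ Icc (0 : ℝ) 1, |(u t).rep x| ≤ K) →
      (∀ t ∈ Icc 0 T, nonlinSum P (u t) ≤ η * ‖u t‖ ^ 2) →
      1 / 2 * ‖w T‖ ^ 2 + 1 / 2 * ‖u T‖ ^ 2 ≤ C * (1 / 2 * ‖w 0‖ ^ 2 + 1 / 2 * ‖u 0‖ ^ 2) *
        Real.exp (B * (normL2 h0 ^ 2 + normL2 h1 ^ 2)) * Real.exp (-(γ * T)) := by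
  have hP := hP1.superlinear
  have hq := two_lt_q hP
  have hμ := hP2.muStar_pos
  have hc := Params.dissip_pos hP1 hP2
  obtain ⟨δ, hδ⟩ : ∃ δ, δ = 1 - η := ⟨_, rfl⟩
  have hδ0 : 0 < δ := by linarith
  have hηδ : η = 1 - δ := by linarith
  -- This is the coercivity constant: under the subcriticality assumption the energy is at least κ0
  -- times the quadratic energy N.
  set κ0 := 1 - 2 / P.q with hκ0
  have hκpos : 0 < κ0 := by
    rw [hκ0, sub_pos, div_lt_one (by linarith)]; exact hq
  have hκ1 : κ0 ≤ 1 := by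
    rw [hκ0]; linarith [show 0 ≤ 2 / P.q by positivity]
  set d := 1 + (‖dampL P‖ * ‖traceL‖) ^ 2 / δ with hd
  have hd0 : 0 < d := by positivity
  -- The bound ε ≤ κ0/2 keeps the perturbed energy above κ0/2 · N; the bound on ε * d lets the
  -- damping absorb what the perturbation produces.
  obtain ⟨ε, hε0, hεκ, hεd⟩ : ∃ ε, 0 < ε ∧ ε ≤ κ0 / 2 ∧ ε * d ≤ P.dissip / 2 := by
    refine ⟨min (κ0 / 2) (P.dissip / 2 / d), lt_min (by positivity) (by positivity),
      min_le_left _ _, ?_⟩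
    calc _ ≤ P.dissip / 2 / d * d := mul_le_mul_of_nonneg_right (min_le_right _ _) hd0.le
      _ = _ := by field_simp
  set A := 2 / P.muStar + 2 * ‖traceL‖ ^ 2 / δ * ε with hA
  have hA0 : 0 ≤ A := by positivity
  set γ0 := min P.dissip (ε * δ) with hγ0
  have hγpos : 0 < γ0 := lt_min hc (by positivity)
  refine ⟨2 * 2 / κ0, γ0 / 2, 4 * A / κ0, by positivity, by positivity, by positivity, ?_⟩
  intro K hK h0 h1 T u w y hT hh0 hh1 hE hb hS
  set N : ℝ → ℝ := fun t => 1 / 2 * ‖w t‖ ^ 2 + 1 / 2 * ‖u t‖ ^ 2 with hN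
  have hN0 : ∀ t, 0 ≤ N t := fun t => by positivity
  -- The Lyapunov functional, lying between κ0/2 · N and 2N. The pairing term supplies the
  -- dissipation in ‖u‖² that the energy alone lacks.
  set Lf : ℝ → ℝ := fun t => energy P (u t) (w t) + ε * inner ℝ (w t) (u t).toL2 with hLf
  have hin : ∀ t, |(inner ℝ (w t) (u t).toL2 : ℝ)| ≤ N t := fun t => by
    have f1 := abs_real_inner_le_norm (w t) (u t).toL2
    have f2 := mul_le_mul_of_nonneg_left (norm_toL2_le (u t)) (norm_nonneg (w t))
    simp only [hN]
    nlinarith [sq_nonneg (‖w t‖ - ‖u t‖)]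
  have hEl : ∀ t ∈ Icc 0 T, κ0 * N t ≤ energy P (u t) (w t) := fun t ht => by
    refine le_trans ?_ (norm_sq_le_energy hP (w t) (hS t ht))
    have f1 : (P.q - 2) / (2 * P.q) = κ0 / 2 := by rw [hκ0]; field_simp
    have f2 : 0 ≤ (1 - η) / P.q * ‖u t‖ ^ 2 :=
      mul_nonneg (div_nonneg (by linarith) (by linarith)) (sq_nonneg _)
    have f3 := mul_le_mul_of_nonneg_right hκ1 (sq_nonneg ‖w t‖)
    rw [add_mul, f1]
    simp only [hN]
    linarith
  have hLl : ∀ t ∈ Icc 0 T, κ0 / 2 * N t ≤ Lf t := fun t ht => by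
    have f1 := hEl t ht
    have f2 := mul_le_mul_of_nonneg_left (neg_le_of_abs_le (hin t)) hε0.le
    have f3 := mul_le_mul_of_nonneg_right hεκ (hN0 t)
    simp only [hLf]
    linarith
  have hLu : ∀ t, Lf t ≤ 2 * N t := fun t => by
    have f1 := energy_le hP (u t) (w t)
    have f2 := mul_le_mul_of_nonneg_left (le_of_abs_le (hin t)) hε0.le
    have f3 := mul_le_mul_of_nonneg_right (show ε ≤ 1 by linarith) (hN0 t)
    simp only [hLf]
    simp only [hN] at f3 f2 ⊢
    linarith
  obtain ⟨i1, -⟩ := truncated_energy_identity hP hK hE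
  have hcu : ContinuousOn (fun t => traceL (u t)) (Icc 0 T) :=
    traceL.continuous.comp_continuousOn hE.contU
  have i2 : IntegrableOn (fun s => (inner ℝ (source P hP K hK h0 h1 s (u s) - dampL P (y s))
      (traceL (u s)) : ℝ)) (Ioc 0 T) :=
    integrable_inner_of_memLp hE.memF (ContinuousOn.memLp_two hcu)
  have i3 : IntegrableOn (fun s => (inner ℝ (u s) (u s) : ℝ)) (Ioc 0 T) :=
    integrable_inner_of_memLp (ContinuousOn.memLp_two hE.contU) (ContinuousOn.memLp_two hE.contU)
  have i4 : IntegrableOn (fun s => (inner ℝ (w s) (w s) : ℝ)) (Ioc 0 T) :=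
    integrable_inner_of_memLp (ContinuousOn.memLp_two hE.contW) (ContinuousOn.memLp_two hE.contW)
  have i5 : IntegrableOn (fun s => (inner ℝ (source P hP K hK h0 h1 s (u s) - dampL P (y s))
      (traceL (u s)) : ℝ) - inner ℝ (u s) (u s) + inner ℝ (w s) (w s)) (Ioc 0 T) :=
    (i2.sub i3).add i4
  have hii : ∀ {f : ℝ → ℝ} {t : ℝ}, t ∈ Icc 0 T → IntegrableOn f (Ioc 0 T) →
      IntervalIntegrable f volume 0 t := fun ht hf => by
    rw [intervalIntegrable_iff_integrableOn_Ioc_of_le ht.1]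
    exact hf.mono_set (Ioc_subset_Ioc_right ht.2)
  have hLint : ∀ t ∈ Icc 0 T, Lf t = Lf 0 + ∫ s in (0 : ℝ)..t,
      ((-inner ℝ (dampL P (y s)) (y s) - inner ℝ (couple (h0 s) (h1 s) (u s)) (y s)) +
      ε * ((inner ℝ (source P hP K hK h0 h1 s (u s) - dampL P (y s)) (traceL (u s)) : ℝ) -
        inner ℝ (u s) (u s) + inner ℝ (w s) (w s))) := fun t ht => by
    have f1 := energy_identity_of_bound hP hK hE hb t ht
    have f2 := hE.pairing_identity t ht
    rw [intervalIntegral.integral_add (hii ht i1) ((hii ht i5).const_mul ε),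
      intervalIntegral.integral_const_mul,
      intervalIntegral.integral_add ((hii ht i2).sub (hii ht i3)) (hii ht i4),
      intervalIntegral.integral_sub (hii ht i2) (hii ht i3)]
    simp only [hLf]
    rw [f1]
    rw [interior_traceL, interior_traceL] at f2
    rw [f2]
    ring
  -- The dissipation is at least γ0 · N, hence at least (γ0/2)Lf, since Lf ≤ 2N. The remainder A(h₀²
  -- + h₁²)‖u‖² is turned into a multiple of Lf by ‖u‖² ≤ 2N ≤ (4/κ0)Lf.
  have hk : IntegrableOn (fun s => -(γ0 / 2) + 4 * A / κ0 * (h0 s ^ 2 + h1 s ^ 2)) (Ioc 0 T) :=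
    (integrableOn_const (by simp)).add ((integrableOn_sq_add_sq hh0 hh1 T).const_mul _)
  have hg := le_mul_exp_of_ae_le hT (E := Lf) (i1.add (i5.const_mul ε)) hk hLint (by
    filter_upwards [hE.pi_y, ae_restrict_mem measurableSet_Ioc] with t hpi ht
    have htI := Ioc_subset_Icc_self ht
    have f0 : (inner ℝ (source P hP K hK h0 h1 t (u t) - dampL P (y t)) (traceL (u t)) : ℝ) =
        nonlinSum P (u t) - inner ℝ (couple (h0 t) (h1 t) (u t)) (traceL (u t)) -
        inner ℝ (dampL P (y t)) (traceL (u t)) := by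
      rw [source, inner_sub_left, inner_sub_left, inner_grad_traceL hP hK (hb t htI)]
    have f1 := perturbed_dissipation_le (a := h0 t) (b := h1 t) hP2 hδ0 hηδ hε0 hεd hpi (hS t htI)
    simp only [Pi.add_apply]
    rw [f0, real_inner_self_eq_norm_sq, real_inner_self_eq_norm_sq]
    refine f1.trans ?_
    have g1 := mul_le_mul_of_nonneg_right (min_le_left P.dissip (ε * δ)) (sq_nonneg ‖w t‖)
    have g2 := mul_le_mul_of_nonneg_right (min_le_right P.dissip (ε * δ)) (sq_nonneg ‖u t‖)
    have g3 := mul_le_mul_of_nonneg_left (hLu t) (show 0 ≤ γ0 / 2 by positivity)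
    have hh : 0 ≤ A * (h0 t ^ 2 + h1 t ^ 2) := by positivity
    have g4 := mul_le_mul_of_nonneg_left (hLl t htI) (show 0 ≤ 4 / κ0 by positivity)
    have g5 : 4 / κ0 * (κ0 / 2 * N t) = 2 * N t := by field_simp; ring
    have g6 : ‖u t‖ ^ 2 ≤ 2 * N t := by simp only [hN]; linarith [sq_nonneg ‖w t‖]
    have g7 := mul_le_mul_of_nonneg_left (g6.trans (g5.symm.le.trans g4)) hh
    have g8 : A * (h0 t ^ 2 + h1 t ^ 2) * (4 / κ0 * Lf t) =
      4 * A / κ0 * (h0 t ^ 2 + h1 t ^ 2) * Lf t := by ring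
    rw [g8] at g7
    simp only [← hγ0] at g1 g2
    simp only [hN] at g3
    linarith)
  rw [intervalIntegral.integral_add (by simp) (((hii ⟨hT, le_rfl⟩
    (integrableOn_sq_add_sq hh0 hh1 T))).const_mul _), intervalIntegral.integral_const_mul,
    intervalIntegral.integral_const, smul_eq_mul, sub_zero] at hg
  have hL0 : 0 ≤ Lf 0 := le_trans (mul_nonneg (by positivity) (hN0 0)) (hLl 0 ⟨le_rfl, hT⟩)
  have f1 := hLl T ⟨hT, le_rfl⟩
  have f2 : Real.exp (T * -(γ0 / 2) + 4 * A / κ0 * ∫ t in (0 : ℝ)..T, (h0 t ^ 2 + h1 t ^ 2)) ≤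
      Real.exp (4 * A / κ0 * (normL2 h0 ^ 2 + normL2 h1 ^ 2)) * Real.exp (-(γ0 / 2 * T)) := by
    rw [← Real.exp_add]
    refine Real.exp_le_exp.2 ?_
    have := mul_le_mul_of_nonneg_left (integral_sq_add_sq_le hh0 hh1 hT)
      (show 0 ≤ 4 * A / κ0 by positivity)
    linarith
  have f3 := mul_le_mul (hLu 0) f2 (Real.exp_pos _).le (mul_nonneg (by norm_num) (hN0 0))
  have f4 := mul_le_mul_of_nonneg_left (f1.trans (hg.trans f3)) (show 0 ≤ 2 / κ0 by positivity)
  have f5 : 2 / κ0 * (κ0 / 2 * N T) = N T := by field_simp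
  rw [f5] at f4
  refine f4.trans (le_of_eq ?_)
  simp only [hN]
  ring

end

section

open Vel

variable {P : Params} {h0 h1 : ℝ → ℝ} {u0 : H1} {u1 : L2I} {T : ℝ}

/-! ### Restriction and gluing of weak solutions -/

theorem HasWeakDerivOn.mono {f g : ℝ → ℝ} {a b b' : ℝ} (h : HasWeakDerivOn f g a b) (hb : b' ≤ b) :
    HasWeakDerivOn f g a b' := by
  have hs : Ioo a b' ⊆ Ioo a b := Ioo_subset_Ioo_right hb
  refine ⟨h.1.mono_set hs, h.2.1.mono_set hs, fun φ h1 h2 h3 => ?_⟩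
  have e : ∀ (F ψ : ℝ → ℝ), tsupport ψ ⊆ Ioo a b' →
      ∫ x in Ioo a b', F x * ψ x = ∫ x in Ioo a b, F x * ψ x := fun F ψ hψ => by
    refine (setIntegral_eq_of_subset_of_forall_sdiff_eq_zero measurableSet_Ioo hs
      fun x hx => ?_).symm
    rw [image_eq_zero_of_notMem_tsupport fun hx' => hx.2 (hψ hx'), mul_zero]
  rw [e f _ (tsupport_deriv_subset.trans h3), e g _ h3]
  exact h.2.2 φ h1 h2 (h3.trans hs)

theorem IsWeakSolutionOn.mono {u : ℝ → H1} {w : ℝ → L2I} (h : IsWeakSolutionOn P h0 h1 u0 u1 T u w)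
    {T' : ℝ} (hT : T' ≤ T) : IsWeakSolutionOn P h0 h1 u0 u1 T' u w := by
  have hs : Icc 0 T' ⊆ Icc 0 T := Icc_subset_Icc_right hT
  have hr : volume.restrict (Ioo 0 T') ≤ volume.restrict (Ioo 0 T) :=
    Measure.restrict_mono (Ioo_subset_Ioo_right hT) le_rfl
  obtain ⟨b0, b1, m0, m1, d0, d1, hw⟩ := h.weak
  exact ⟨h.continuousOn_u.mono hs, h.continuousOn_ut.mono hs,
    fun t ht => (h.hasDeriv t (hs ht)).mono hs, h.init_u, h.init_ut, b0, b1, m0.mono_measure hr,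
    m1.mono_measure hr, d0.mono hT, d1.mono hT, fun v => (hw v).mono hT⟩

theorem IsWeakSolutionOn.congr {u u' : ℝ → H1} {w w' : ℝ → L2I}
    (h : IsWeakSolutionOn P h0 h1 u0 u1 T u w) (hT : 0 ≤ T)
    (he : ∀ t ∈ Icc 0 T, u' t = u t ∧ w' t = w t) : IsWeakSolutionOn P h0 h1 u0 u1 T u' w' := by
  obtain ⟨b0, b1, m0, m1, d0, d1, hw⟩ := h.weak
  have hae : ∀ {E : Type} {F F' : ℝ → E}, (∀ t ∈ Icc 0 T, F' t = F t) →
      F' =ᵐ[volume.restrict (Ioo 0 T)] F := fun hF => by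
    filter_upwards [ae_restrict_mem measurableSet_Ioo] with t ht
    exact hF t (Ioo_subset_Icc_self ht)
  have h0T : (0 : ℝ) ∈ Icc 0 T := ⟨le_rfl, hT⟩
  refine ⟨h.continuousOn_u.congr fun t ht => (he t ht).1,
    h.continuousOn_ut.congr fun t ht => (he t ht).2, fun t ht => ?_, (he 0 h0T).1.trans h.init_u,
    (he 0 h0T).2.trans h.init_ut, b0, b1, m0, m1,
    d0.congr (hae fun t ht => by rw [(he t ht).1]) (EventuallyEq.refl _ _),
    d1.congr (hae fun t ht => by rw [(he t ht).1]) (EventuallyEq.refl _ _),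
    fun v => (hw v).congr (hae fun t ht => by rw [(he t ht).2])
      (hae fun t ht => by rw [(he t ht).1, (he t ht).2])⟩
  rw [(he t ht).2]
  exact (h.hasDeriv t ht).congr (fun s hs => by rw [(he s hs).1]) (by rw [(he t ht).1])

theorem exists_isGlobalWeakSolution (hP1 : P.A1) (hP2 : P.A2) (hh0 : BoundedL2 h0)
    (hh1 : BoundedL2 h1)
    (hex : ∀ T, 0 < T → ∃ u w, IsWeakSolutionOn P h0 h1 u0 u1 T u w) :
    ∃ u w, IsGlobalWeakSolution P h0 h1 u0 u1 u w := by
  choose! U W hU using hex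
  -- At time t the value is taken from the solution on [0, |t| + 1], an interval of positive length
  -- containing t ≥ 0. Uniqueness shows that these values agree with any single U T on [0, T].
  refine ⟨fun t => U (|t| + 1) t, fun t => W (|t| + 1) t, fun T hT => ?_⟩
  refine (hU T hT).congr hT.le fun t ht => ?_
  have h1 : 0 < |t| + 1 := by positivity
  rcases le_total T (|t| + 1) with h | h
  · exact ((hU _ h1).mono h).unique hP1 hP2 hh0 hh1 hT (hU T hT) t ht
  · exact (hU _ h1).unique hP1 hP2 hh0 hh1 h1 ((hU T hT).mono h) t
      ⟨ht.1, (le_abs_self t).trans (by linarith)⟩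

/-! ### The a priori bound -/

theorem Params.one_le_r (hP1 : P.A1) (hP2 : P.A2) (h0 h1 : ℝ → ℝ) : 1 ≤ P.r h0 h1 := by
  have hq := two_lt_q hP1.superlinear
  have hμ := hP2.muStar_pos
  refine Real.one_le_exp (mul_nonneg (div_nonneg (by linarith) ?_) (by positivity))
  exact mul_nonneg hμ.le (by linarith)

/-- Positivity of I(0) is the strict form of the subcriticality bound with η = 1. It places the
initial datum inside the ball and makes E(0) positive. -/
theorem norm_sq_lt_of_functionalI_pos (hP : P.Superlinear) (hI : 0 < functionalI P u0) (u1 : L2I) :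
    0 < energy P u0 u1 ∧ ‖u0‖ ^ 2 < 2 * P.q / (P.q - 2) * energy P u0 u1 := by
  have hq := two_lt_q hP
  have hq2 : 0 < P.q - 2 := by linarith
  have h1 : nonlinSum P u0 < ‖u0‖ ^ 2 := by
    unfold functionalI at hI
    unfold nonlinSum
    linarith
  have h2 := energy_ge hP u0 u1
  have h3 := mul_lt_mul_of_pos_left h1 (show 0 < 1 / P.q by positivity)
  have h4 : (P.q - 2) / (2 * P.q) * ‖u0‖ ^ 2 = 1 / 2 * ‖u0‖ ^ 2 - 1 / P.q * ‖u0‖ ^ 2 := by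
    field_simp
  have h5 : (P.q - 2) / (2 * P.q) * ‖u0‖ ^ 2 < energy P u0 u1 := by
    linarith [sq_nonneg ‖u1‖]
  refine ⟨lt_of_le_of_lt (by positivity) h5, ?_⟩
  have h6 := mul_lt_mul_of_pos_left h5 (show 0 < 2 * P.q / (P.q - 2) by positivity)
  refine lt_of_eq_of_lt ?_ h6
  field_simp

theorem norm_pos_of_functionalI_pos (hI : 0 < functionalI P u0) :
    0 < ‖u0‖ := by
  have h := nonlinSum_nonneg P u0
  unfold functionalI at hI
  unfold nonlinSum at h
  by_contra! hn
  have : ‖u0‖ = 0 := le_antisymm hn (norm_nonneg _)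
  rw [this] at hI
  simp only [ne_eq, OfNat.ofNat_ne_zero, not_false_eq_true, zero_pow] at hI
  linarith

/-- A nonzero function rules out negative constants; the real powers of Cp would otherwise be
uncontrolled. -/
theorem IsEmbeddingConst.nonneg {Cp : ℝ} (hCp : IsEmbeddingConst P Cp) (hu0 : 0 < ‖u0‖) :
    0 ≤ Cp := by
  have h := (Real.rpow_nonneg (u0.lpPow_nonneg P.p) (1 / P.p)).trans (hCp u0)
  exact nonneg_of_mul_nonneg_left h hu0

/-- Weak solutions with small data exist on every interval and stay in a fixed ball. -/
theorem exists_isEvol_bounded (hP1 : P.A1) (hP2 : P.A2) (hh0 : BoundedL2 h0)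
    (hh1 : BoundedL2 h1) {Cp R : ℝ} (hCp : IsEmbeddingConst P Cp) (hI : 0 < functionalI P u0)
    (hR : R = 2 * P.q * P.r h0 h1 / (P.q - 2) * energy P u0 u1) (hη : smallness P Cp R < 1)
    (hT : 0 < T) :
    ∃ u w y, IsEvol traceL interior T (fun t => source P hP1.superlinear (√2 * √R) (by positivity)
        h0 h1 t (u t) - dampL P (y t)) u w y ∧ u 0 = u0 ∧ w 0 = u1 ∧
      IsWeakSolutionOn P h0 h1 u0 u1 T u w ∧
      (∀ t ∈ Icc 0 T, ‖u t‖ ^ 2 < R) ∧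
      ∀ t ∈ Icc 0 T, ∀ x ∈ Icc (0 : ℝ) 1, |(u t).rep x| ≤ √2 * √R := by
  have hP := hP1.superlinear
  have hq := two_lt_q hP
  have hq2 : 0 < P.q - 2 := by linarith
  have hr := Params.one_le_r hP1 hP2 h0 h1
  obtain ⟨hE0, hlt⟩ := norm_sq_lt_of_functionalI_pos hP hI u1
  have hCp0 := hCp.nonneg (norm_pos_of_functionalI_pos hI)
  have hR' : R = 2 * P.q / (P.q - 2) * (energy P u0 u1 * P.r h0 h1) := by rw [hR]; ring
  have hRpos : 0 < R := by rw [hR']; positivity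
  have hRge : 2 * P.q / (P.q - 2) * energy P u0 u1 ≤ R := by
    rw [hR']
    exact mul_le_mul_of_nonneg_left (le_mul_of_one_le_right hE0.le hr) (by positivity)
  -- The height √2·√R is the supremum bound on the ball ‖u‖² ≤ R, so the truncation is inactive
  -- while u stays there.
  obtain ⟨u, w, y, hE, hu, hw⟩ := exists_isEvol_truncated hP (K := √2 * √R) (by positivity) hP1 hP2
    hh0 hh1 hT.le u0 u1
  have hrep : ∀ t, ‖u t‖ ^ 2 ≤ R → ∀ x ∈ Icc (0 : ℝ) 1, |(u t).rep x| ≤ √2 * √R := fun t ht x hx =>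
    ((u t).abs_rep_le hx).trans (mul_le_mul_of_nonneg_left (Real.le_sqrt_of_sq_le ht)
      (by positivity))
  have hlt' : ∀ t ∈ Icc 0 T, ‖u t‖ ^ 2 < R := by
    refine lt_of_forall_le_imp_lt (hE.contU.norm.pow 2) ?_ fun t ht hs => ?_
    · rw [hu]
      exact hlt.trans_le hRge
    · have hS : ∀ s ∈ Icc 0 t, nonlinSum P (u s) ≤ smallness P Cp R * ‖u s‖ ^ 2 :=
        fun s hs' => nonlinSum_le hP hCp hCp0 (hs s hs')
      have g1 := energy_growth hP _ hP2 ht.1 hP1 hh0 hh1 (hE.mono ht.2)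
        (fun s hs' => hrep s (hs s hs')) hη.le hS
      rw [hu, hw] at g1
      have g2 := norm_sq_le_energy hP (w t) (hS t ⟨ht.1, le_rfl⟩)
      change ‖u t‖ ^ 2 < R
      -- The continuity argument needs a strict bound. If u(t) = 0 it is R > 0; otherwise it comes
      -- from the gap (1 − η)‖u(t)‖²/q in the energy bound.
      rcases (sq_nonneg ‖u t‖).eq_or_lt with hz | hpos
      · rw [← hz]; exact hRpos
      · have h3 : 0 < (1 - smallness P Cp R) / P.q * ‖u t‖ ^ 2 :=
          mul_pos (div_pos (by linarith) (by linarith)) hpos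
        have h4 : (P.q - 2) / (2 * P.q) * ‖u t‖ ^ 2 < energy P u0 u1 * P.r h0 h1 := by
          rw [add_mul] at g2
          linarith [sq_nonneg ‖w t‖]
        have h5 := mul_lt_mul_of_pos_left h4 (show 0 < 2 * P.q / (P.q - 2) by positivity)
        rw [← hR'] at h5
        refine lt_of_eq_of_lt ?_ h5
        field_simp
  have hweak := isWeakSolutionOn_of_isEvol hP _ hT hE fun t ht => hrep t (hlt' t ht).le
  rw [hu, hw] at hweak
  exact ⟨u, w, y, hE, hu, hw, hweak, hlt', fun t ht => hrep t (hlt' t ht).le⟩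

theorem smallness_mono (hP : P.Superlinear) {Cp R R' : ℝ} (hCp : 0 ≤ Cp) (hR : 0 ≤ R)
    (h : R ≤ R') : smallness P Cp R ≤ smallness P Cp R' := by
  have hm : ∀ {s : ℝ}, 2 < s → R ^ ((s - 2) / 2) ≤ R' ^ ((s - 2) / 2) := fun hs =>
    Real.rpow_le_rpow hR h (by linarith)
  unfold smallness
  have h1 := mul_le_mul_of_nonneg_left (hm hP.p) (Real.rpow_nonneg hCp P.p)
  have h2 := mul_le_mul_of_nonneg_left (hm hP.α) (Real.rpow_nonneg zero_le_two (P.α / 2))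
  have h3 := mul_le_mul_of_nonneg_left (hm hP.β) (Real.rpow_nonneg zero_le_two (P.β / 2))
  linarith

theorem continuous_smallness (hP : P.Superlinear) (Cp : ℝ) : Continuous (smallness P Cp) := by
  have hc : ∀ {s : ℝ}, 2 < s → Continuous fun R : ℝ => R ^ ((s - 2) / 2) := fun hs =>
    Real.continuous_rpow_const (by linarith)
  unfold smallness
  exact ((continuous_const.mul (hc hP.p)).add (continuous_const.mul (hc hP.α))).add
    (continuous_const.mul (hc hP.β))

/-- For small coefficients the condition `etaStar < 1` holds uniformly, or not at all. -/
theorem exists_uniform_smallness (hP1 : P.A1) (hP2 : P.A2) {Cp E0 : ℝ} (hCp : 0 ≤ Cp)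
    (hE0 : 0 ≤ E0) : ∃ ε η : ℝ, 0 < ε ∧ ε ≤ 1 ∧ η < 1 ∧ ∀ h0 h1 : ℝ → ℝ,
      etaStar P Cp h0 h1 E0 < 1 → normL2 h0 < ε → normL2 h1 < ε → etaStar P Cp h0 h1 E0 ≤ η := by
  have hP := hP1.superlinear
  have hq := two_lt_q hP
  have hq2 : 0 < P.q - 2 := by linarith
  set a := 4 * P.q / (P.muStar * (P.q - 2)) with ha
  set F : ℝ → ℝ := fun x => smallness P Cp (2 * P.q * Real.exp (a * x) / (P.q - 2) * E0) with hF
  have hFc : Continuous F := (continuous_smallness hP Cp).comp (by fun_prop)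
  have hFe : ∀ h0 h1, etaStar P Cp h0 h1 E0 = F (normL2 h0 ^ 2 + normL2 h1 ^ 2) := fun h0 h1 => rfl
  -- F is η* as a function of ‖h₀‖² + ‖h₁‖². If F 0 < 1, continuity keeps η* below an intermediate
  -- value near 0; otherwise monotonicity excludes η* < 1 for any h₀, h₁.
  by_cases h : F 0 < 1
  · obtain ⟨η, hη0, hη1⟩ := exists_between h
    have hev := hFc.continuousAt.eventually_lt_const hη0
    obtain ⟨δ, hδ, hball⟩ := Metric.eventually_nhds_iff.1 hev
    -- The bound by 1 lets squares be dominated by first powers, so ‖h₀‖² + ‖h₁‖² < δ; the caller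
    -- also uses it to bound the exponential factor.
    refine ⟨min 1 (δ / 2), η, lt_min one_pos (by positivity), min_le_left _ _, hη1,
      fun h0 h1 _ n0 n1 => ?_⟩
    rw [hFe]
    refine (hball ?_).le
    have p0 : 0 ≤ normL2 h0 := ENNReal.toReal_nonneg
    have p1 : 0 ≤ normL2 h1 := ENNReal.toReal_nonneg
    rw [Real.dist_eq, sub_zero, abs_of_nonneg (by positivity)]
    have q0 := n0.trans_le (min_le_left _ _)
    have q1 := n1.trans_le (min_le_left _ _)
    have r0 := n0.trans_le (min_le_right _ _)
    have r1 := n1.trans_le (min_le_right _ _)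
    nlinarith
  · refine ⟨1, 0, one_pos, le_rfl, one_pos, fun h0 h1 hlt _ _ => absurd hlt ?_⟩
    rw [hFe, not_lt]
    refine (not_lt.1 h).trans (smallness_mono hP hCp (by positivity) ?_)
    have hr := Params.one_le_r hP1 hP2 h0 h1
    have hr' : Real.exp (a * (normL2 h0 ^ 2 + normL2 h1 ^ 2)) = P.r h0 h1 := rfl
    rw [hr', mul_zero, Real.exp_zero]
    gcongr

end

end TwoPointWave

end

/-! ### Global existence, uniqueness and exponential decay. -/

theorem theorem4p1 (P : TwoPointWave.Params) (hA1 : P.A1) (hA2 : P.A2)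
    (Cp : ℝ) (hCp : TwoPointWave.IsEmbeddingConst P Cp)
    (u0 : TwoPointWave.H1) (u1 : TwoPointWave.L2I)
    (hI : 0 < TwoPointWave.functionalI P u0) :
    ∃ ε C γ : ℝ, 0 < ε ∧ 0 < C ∧ 0 < γ ∧
      ∀ h0 h1 : ℝ → ℝ, TwoPointWave.BoundedL2 h0 → TwoPointWave.BoundedL2 h1 →
        TwoPointWave.etaStar P Cp h0 h1 (TwoPointWave.energy P u0 u1) < 1 →
        ∃ (u : ℝ → TwoPointWave.H1) (ut : ℝ → TwoPointWave.L2I),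
          TwoPointWave.IsGlobalWeakSolution P h0 h1 u0 u1 u ut ∧
          (∀ (T : ℝ) (w : ℝ → TwoPointWave.H1) (wt : ℝ → TwoPointWave.L2I), 0 < T →
            TwoPointWave.IsWeakSolutionOn P h0 h1 u0 u1 T w wt →
            ∀ t ∈ Set.Icc 0 T, w t = u t ∧ wt t = ut t) ∧
          (TwoPointWave.normL2 h0 < ε → TwoPointWave.normL2 h1 < ε →
            ∀ t : ℝ, 0 ≤ t → TwoPointWave.energy P (u t) (ut t) ≤ C * Real.exp (-(γ * t))) := by
  open TwoPointWave in
  have hP := hA1.superlinear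
  obtain ⟨hE0, -⟩ := norm_sq_lt_of_functionalI_pos hP hI u1
  have hCp0 := hCp.nonneg (norm_pos_of_functionalI_pos hI)
  obtain ⟨ε, η, hε0, hε1, hη1, hη⟩ := exists_uniform_smallness hA1 hA2 hCp0 hE0.le
  obtain ⟨C, γ, B, hC, hγ, hB, hdecay⟩ := exists_decay hA1 hA2 hη1
  have hN : 0 < 1 / 2 * ‖u1‖ ^ 2 + 1 / 2 * ‖u0‖ ^ 2 := hE0.trans_le (energy_le hP u0 u1)
  -- Since ε ≤ 1, the exponent B(‖h₀‖² + ‖h₁‖²) is at most 2B, so the constant does not depend on h₀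
  -- and h₁.
  refine ⟨ε, C * (1 / 2 * ‖u1‖ ^ 2 + 1 / 2 * ‖u0‖ ^ 2) * Real.exp (B * 2), γ, hε0, by positivity,
    hγ, fun h0 h1 hh0 hh1 hlt => ?_⟩
  have hex := fun T (hT : (0 : ℝ) < T) =>
    exists_isEvol_bounded hA1 hA2 hh0 hh1 hCp hI rfl hlt hT
  obtain ⟨u, w, hglob⟩ := exists_isGlobalWeakSolution hA1 hA2 hh0 hh1 fun T hT => by
    obtain ⟨u, w, y, -, -, -, hweak, -⟩ := hex T hT
    exact ⟨u, w, hweak⟩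
  refine ⟨u, w, hglob, fun T v z hT hv => hv.unique hA1 hA2 hh0 hh1 hT (hglob T hT), ?_⟩
  intro n0 n1 t ht
  -- Existence is stated on intervals of positive length, while t may be 0. The truncated evolution
  -- on [0, t + 1] agrees with the global solution by uniqueness, and its decay estimate is applied
  -- on [0, t].
  have hT : 0 < t + 1 := by linarith
  obtain ⟨v, z, y, hE, hv, hz, hweak, hR, hb⟩ := hex (t + 1) hT
  obtain ⟨e1, e2⟩ := hweak.unique hA1 hA2 hh0 hh1 hT (hglob _ hT) t
    ⟨ht, by linarith⟩
  rw [← e1, ← e2]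
  have hsub : Set.Icc 0 t ⊆ Set.Icc 0 (t + 1) := Set.Icc_subset_Icc_right (by linarith)
  have hd := hdecay _ _ h0 h1 t v z y ht hh0 hh1 (hE.mono (by linarith))
    (fun s hs => hb s (hsub hs)) fun s hs =>
      (nonlinSum_le hP hCp hCp0 (hR s (hsub hs)).le).trans
        (mul_le_mul_of_nonneg_right (hη h0 h1 hlt n0 n1) (sq_nonneg _))
  rw [hv, hz] at hd
  refine (energy_le hP (v t) (z t)).trans (hd.trans ?_)
  have p0 : 0 ≤ normL2 h0 := ENNReal.toReal_nonneg
  have p1 : 0 ≤ normL2 h1 := ENNReal.toReal_nonneg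
  have q0 : normL2 h0 ^ 2 ≤ 1 := pow_le_one₀ p0 (n0.le.trans hε1)
  have q1 : normL2 h1 ^ 2 ≤ 1 := pow_le_one₀ p1 (n1.le.trans hε1)
  have q2 := mul_le_mul_of_nonneg_left (add_le_add q0 q1) hB
  refine mul_le_mul_of_nonneg_right (mul_le_mul_of_nonneg_left (Real.exp_le_exp.2 ?_)
    (by positivity)) (Real.exp_pos _).le
  linarith
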